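/- **Setting.** Fix the number $K$ of latent classes, the parameter dimension $p$, an open parameter space $\Theta\subseteq\mathbb R^p$, a true parameter $\theta^*\in\Theta$ and a window length $dT>0$. For every $m$ let $A=A_m\subseteq[m]\times[m]$ be a directed edge list and $z^*=z^{*}_m\in[K]^m$ the true labels. Given $z\in[K]^m$, the edge $(i,j)\in A$ has conditional intensity $\lambda_{ij}(t|z)=\lambda_{z_iz_j}(t)$, which depends on $\theta$ and possibly on the past events of $(i,j)$ strictly before $t$. The observed event processes $N_{ij}$, $(i,j)\in A$, are independent simple point processes on $(0,\infty)$ with these intensities at $\theta=\theta^*$, $z=z^*$; $\mathbb E^*$ is the expectation under this true process. The number $d_i$ is the number of nodes $j$ with $(i,j)\in A$ or $(j,i)\in A$. Put $$l_n(\theta|z)=\sum_{(i,j)\in A}\Big\{\int_{(n-1)dT}^{n\,dT}\log\lambda_{ij}(t|z)\,dN_{ij}(t)-\int_{(n-1)dT}^{n\,dT}\lambda_{ij}(t|z)\,dt\Big\},\qquad \bar l(\theta|z)=\tfrac1{|A|}\mathbb E^*l_1(\theta|z).$$ For a product distribution $q(z)=\prod_iq_i(z_i)$ on $[K]^m$ let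 $Q_n(\theta,q)=\frac1{|A|}\mathbb E_{q(z)}l_n(\theta|z)$ and $\bar Q(\theta,q)=\mathbb E^*Q_1(\theta,q)$, let $\rho(q)=\frac1{|A|}\sum_i d_i\,\mathrm{TV}(q_i,\delta_{z_i^*})$, and let $\theta(q)\in\Theta$ be a maximizer of $\bar Q(\cdot,q)$ over $\Theta$. **Algorithm.** Start from $\theta^{(0)}$, a product distribution $q^{(0)}$, class proportions $\pi^{(0)}$ (a probability vector on $[K]$) and $S_i^{(0)}(k)=1/K$. For $n=1,\dots,N$ put $$S_i^{(n)}(k)=S_i^{(n-1)}(k)\exp\{\mathbb E_{q^{(n-1)}(z_{-i})}l_n(\theta^{(n-1)}|z_i=k,z_{-i})\},\qquad q_i^{(n)}(k)=\frac{\pi_k^{(n-1)}S_i^{(n)}(k)}{\sum_l\pi_l^{(n-1)}S_i^{(n)}(l)},$$ $$\theta^{(n)}=\theta^{(n-1)}+\eta_n\tfrac1{|A|}\nabla_\theta\mathbb E_{q^{(n)}(z)}l_n(\theta|z)\big|_{\theta=\theta^{(n-1)}},\qquad \pi^{(n)}_k=\tfrac1m\sum_iq_i^{(n)}(k).$$ The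 estimated labels are $\hat z_i=\arg\max_kq_i^{(N)}(k)$. **Conditions.** There are constants $c,\delta,r_d,M>0$ and $D\in\mathbb N$, independent of $m$, such that, with $d_m=m^{r_d}$ and for all large $m$ (C5 does not involve $m$): * C1: $\frac1{|A|}\mathbb E^*l_n(\theta|z)=\bar l(\theta|z)$ for all $n\ge1$, $\theta\in\Theta$ and all $z$. * C2': $\bar l(\theta|z)\le\bar l(\theta|z^*)-c\,\frac{\sum_{i\in\mathcal N}d_i}{|A|}$ for all $\theta\in\Theta\cap B(\theta^*,\delta)$, all $\mathcal N\subseteq[m]$ and all $z$ with $z_i\ne z_i^*$ exactly for $i\in\mathcal N$. * C3': for all product distributions $q$ with $\rho(q)\le\delta$, a maximizer $\theta(q)$ exists and can be chosen so that $\|\theta(q)-\theta^*\|\le M\rho(q)$, and $\bar Q(\theta,q)-\bar l(\theta|z^*)\le M\rho(q)$ for all $\theta\in\Theta\cap B(\theta^*,\delta)$. * C4: for all such $q$ (with the same choice of $\theta(q)$) and all $\theta\in\Theta\cap B(\theta(q),\delta)$, $\nabla_\theta\bar Q(\theta,q)^T(\theta-\theta(q))\le-c\|\theta-\theta(q)\|^2$,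 and $\mathbb E^*\|\nabla_\theta Q_n(\theta,q)\|^2\le M$ for all $n\geq 1$. * C5: on $\Theta$, every $\lambda_{kl}$ is positive and measurable in time and history; $\lambda_{kl}$ and $\log\lambda_{kl}$ are differentiable in $\theta$; these functions and their $\theta$-gradients are bounded by $M$, and the gradients are continuous in $\theta$, uniformly in time and history. * C6': $[m]=\mathcal N_u\sqcup\mathcal N_b$ with $d_i\ge d_m$ for $i\in\mathcal N_u$ and $d_i\le D$ for $i\in\mathcal N_b$; every node has at most $D$ neighbours in $\mathcal N_b$; and $|\mathcal N_b|/|A|\to0$ as $m\to\infty$. **Theorem.** Under these conditions and for every $\kappa>0$ there are $\delta_1,\eta_0,C>0$ such that for all sufficiently large $m$ the following holds. Let $N\ge1$, let $\theta^{(0)}\in B(\theta^*,\delta_1)$, let $\pi^{(0)}_k\ge\kappa$ for all $k$, let the step sizes satisfy $0\le\eta_n\le\eta_0$, and let $q^{(0)}$ satisfy * C7: $\mathbb E_{q^{(0)}(z_{-i})}\bar l(\theta^*|z_i=k,z_{-i})\le\mathbb E_{q^{(0)}(z_{-i})}\bar l(\theta^*|z_i=z_i^*,z_{-i})-c\,\frac{d_i}{|A|}$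 for all $i$ and all $k\ne z_i^*$. Then, with probability at least $1-N\exp(-Cd_m)$, $\hat z_i=z_i^*$ for all $i\in\mathcal N_u$ (whatever rule is used to break ties in the arg max). -/

import Mathlib

open MeasureTheory ProbabilityTheory Filter Topology
open scoped ENNReal

noncomputable section

/-- A realization of a simple point process on the time axis `(0, ∞)`: a locally finite set of
event times. -/
@[ext]
structure EventStream where
  times : Set ℝ
  pos : ∀ t ∈ times, 0 < t
  locallyFinite : ∀ T : ℝ, (times ∩ Set.Iic T).Finite

namespace EventStream

theorem finite_Ioc (x : EventStream) (a b : ℝ) : (x.times ∩ Set.Ioc a b).Finite :=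
  (x.locallyFinite b).subset fun _ ht => ⟨ht.1, ht.2.2⟩

/-- The finite set of event times in the window `(a, b]`. -/
def window (x : EventStream) (a b : ℝ) : Finset ℝ := (x.finite_Ioc a b).toFinset

/-- The counting process `N(t)`: the number of events in `(0, t]`. -/
def count (x : EventStream) (t : ℝ) : ℕ := (x.window 0 t).card

/-- The strict past of `x` before time `t`, i.e. all events at times `s < t`. -/
def before (x : EventStream) (t : ℝ) : EventStream where
  times := x.times ∩ Set.Iio t
  pos := fun s hs => x.pos s hs.1
  locallyFinite := fun T => (x.locallyFinite T).subset fun _ hs => ⟨hs.1.1, hs.2⟩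

/-- The sigma-algebra generated by the counting process. -/
instance : MeasurableSpace EventStream :=
  ⨆ t : ℝ, MeasurableSpace.comap (fun x : EventStream => x.count t) ⊤

end EventStream

/-- The random event stream `X` has the conditional intensity `t ↦ lam t (X.before t)` with respect
to its own history: for every nonnegative process `f t (X.before t)` that depends on the time and on
the strict past only (that is, for every nonnegative predictable process),
`E ∫ f dN = E ∫ f lam dt`. -/
def HasIntensity {Ω : Type*} [MeasurableSpace Ω] (P : Measure Ω) (X : Ω → EventStream)
    (lam : ℝ → EventStream → ℝ) : Prop :=
  ∀ f : ℝ → EventStream → ℝ≥0∞, Measurable (Function.uncurry f) →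
    ∫⁻ ω, ∑' t : (X ω).times, f t ((X ω).before t) ∂P =
      ∫⁻ ω, (∫⁻ t in Set.Ioi (0 : ℝ),
        f t ((X ω).before t) * ENNReal.ofReal (lam t ((X ω).before t)) ∂volume) ∂P

/-- The space of model parameters. -/
abbrev Param (p : ℕ) := EuclideanSpace ℝ (Fin p)

/-- The model with `K` latent classes and parameter `θ`. A pair of nodes of classes `k` and `l` has,
at time `t` and with past events `h`, the intensity `lam k l θ t h`. -/
structure BlockModel (K p : ℕ) where
  lam : Fin K → Fin K → Param p → ℝ → EventStream → ℝ
  /-- the parameter space -/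
  paramSpace : Set (Param p)
  /-- the true parameter -/
  θs : Param p
  /-- the length of a time window -/
  dT : ℝ

/-- The edge list of a network with `m` nodes, with the true latent classes of the nodes. -/
structure LabelledNetwork (K m : ℕ) where
  /-- the directed edge list -/
  A : Finset (Fin m × Fin m)
  /-- the true labels -/
  zs : Fin m → Fin K

/-- The neighbours of a node, in either direction. -/
def LabelledNetwork.nbr {K m : ℕ} (G : LabelledNetwork K m) (i : Fin m) : Finset (Fin m) :=
  Finset.univ.filter fun j => (i, j) ∈ G.A ∨ (j, i) ∈ G.A

/-- The degree `d_i`: the number of nodes that `i` connects to. -/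
def LabelledNetwork.deg {K m : ℕ} (G : LabelledNetwork K m) (i : Fin m) : ℕ := (G.nbr i).card

/-- The event streams of the edges are independent, and that of the edge `(i, j)` has the intensity
given by the true classes of `i` and `j` and the true parameter. -/
structure IsEventData {K p m : ℕ} (B : BlockModel K p) (G : LabelledNetwork K m)
    {Ω : Type*} [MeasurableSpace Ω] (P : Measure Ω) (X : Fin m × Fin m → Ω → EventStream) :
    Prop where
  measurable : ∀ e ∈ G.A, Measurable (X e)
  indep : iIndepFun (fun (e : {e // e ∈ G.A}) => X e) P
  intensity : ∀ e ∈ G.A, HasIntensity P (X e) (B.lam (G.zs e.1) (G.zs e.2) B.θs)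

/-! ### Likelihood -/

/-- `∫_(a,b] log λ_{kl} dN - ∫_a^b λ_{kl} dt` for a single edge. -/
def edgeLogLik {K p : ℕ} (B : BlockModel K p) (k l : Fin K) (θ : Param p) (a b : ℝ)
    (x : EventStream) : ℝ :=
  ∑ t ∈ x.window a b, Real.log (B.lam k l θ t (x.before t)) -
    ∫ t in a..b, B.lam k l θ t (x.before t)

/-- The conditional log-likelihood `l_n(θ | z)` of the `n`-th window `((n-1) dT, n dT]`, `n ≥ 1`
(not normalized). -/
def windowLogLik {K p m : ℕ} (B : BlockModel K p) (G : LabelledNetwork K m)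
    (x : Fin m × Fin m → EventStream) (n : ℕ) (θ : Param p) (z : Fin m → Fin K) : ℝ :=
  ∑ e ∈ G.A, edgeLogLik B (z e.1) (z e.2) θ (((n : ℝ) - 1) * B.dT) ((n : ℝ) * B.dT) (x e)

/-! ### Product distributions on the labels -/

/-- `q` is a family of probability vectors, one for every node; it stands for the product
distribution `q(z) = ∏ q_i(z_i)`. -/
def IsProductDist {K m : ℕ} (q : Fin m → Fin K → ℝ) : Prop := ∀ i, q i ∈ stdSimplex ℝ (Fin K)

/-- `E_{q(z)} g(z)`. -/
def meanOver {K m : ℕ} (q : Fin m → Fin K → ℝ) (g : (Fin m → Fin K) → ℝ) : ℝ :=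
  ∑ z : Fin m → Fin K, (∏ i, q i (z i)) * g z

/-- `E_{q(z_{-i})} g(z_i = k, z_{-i})`. -/
def meanOverOthers {K m : ℕ} (q : Fin m → Fin K → ℝ) (i : Fin m) (k : Fin K)
    (g : (Fin m → Fin K) → ℝ) : ℝ :=
  meanOver (Function.update q i (Pi.single k 1)) g

/-- Total variation distance of probability vectors. -/
def tvDist {K : ℕ} (u v : Fin K → ℝ) : ℝ := (1 / 2) * ∑ k, |u k - v k|

/-- `(1 / |A|) ∑_i d_i TV(q_i, δ_{z_i*})`. -/
def labelDist {K m : ℕ} (G : LabelledNetwork K m) (q : Fin m → Fin K → ℝ) : ℝ :=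
  (1 / (G.A.card : ℝ)) * ∑ i, (G.deg i : ℝ) * tvDist (q i) (Pi.single (G.zs i) 1)

/-! ### The online algorithm -/

/-- The current values of the parameter, the approximate label distribution, the class proportions
and the cumulative evidence. -/
structure OnlineState (K p m : ℕ) where
  θ : Param p
  q : Fin m → Fin K → ℝ
  π : Fin K → ℝ
  S : Fin m → Fin K → ℝ

/-- Processing of the `n`-th window with step size `η`. -/
def onlineStep {K p m : ℕ} (B : BlockModel K p) (G : LabelledNetwork K m)
    (x : Fin m × Fin m → EventStream) (η : ℝ) (n : ℕ) (s : OnlineState K p m) :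
    OnlineState K p m :=
  let S' : Fin m → Fin K → ℝ := fun i k =>
    s.S i k * Real.exp (meanOverOthers s.q i k (windowLogLik B G x n s.θ))
  let q' : Fin m → Fin K → ℝ := fun i k => s.π k * S' i k / ∑ l, s.π l * S' i l
  { θ := s.θ + η • ((1 / (G.A.card : ℝ)) •
      gradient (fun θ => meanOver q' (windowLogLik B G x n θ)) s.θ)
    q := q'
    π := fun k => (1 / (m : ℝ)) * ∑ i, q' i k
    S := S' }

/-- The state of the algorithm after `n` windows, with step sizes `η 1, η 2, …`, started from
`θ0`, `q0`, `π0`. -/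
def onlineRun {K p m : ℕ} (B : BlockModel K p) (G : LabelledNetwork K m)
    (x : Fin m × Fin m → EventStream) (η : ℕ → ℝ) (θ0 : Param p) (q0 : Fin m → Fin K → ℝ)
    (π0 : Fin K → ℝ) : ℕ → OnlineState K p m
  | 0 => { θ := θ0, q := q0, π := π0, S := fun _ _ => 1 / (K : ℝ) }
  | n + 1 => onlineStep B G x (η (n + 1)) (n + 1) (onlineRun B G x η θ0 q0 π0 n)

/-- `ẑ_i` is a maximizer of `q_i`, for every node `i`. -/
def IsArgmaxLabel {K m : ℕ} (q : Fin m → Fin K → ℝ) (zhat : Fin m → Fin K) : Prop :=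
  ∀ i k, q i k ≤ q i (zhat i)

/-! ### Population quantities and the conditions -/

section Conditions

variable {K p m : ℕ} (B : BlockModel K p) (G : LabelledNetwork K m)
  {Ω : Type*} [MeasurableSpace Ω] (P : Measure Ω) (X : Fin m × Fin m → Ω → EventStream)

/-- The expected normalized log-likelihood of the `n`-th window. -/
def meanLogLik (n : ℕ) (θ : Param p) (z : Fin m → Fin K) : ℝ :=
  ∫ ω, (1 / (G.A.card : ℝ)) * windowLogLik B G (fun e => X e ω) n θ z ∂P

/-- `Q(θ, q)` in the `n`-th window, for the data `x`. -/
def sampleQ (x : Fin m × Fin m → EventStream) (n : ℕ) (θ : Param p) (q : Fin m → Fin K → ℝ) : ℝ :=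
  meanOver q fun z => (1 / (G.A.card : ℝ)) * windowLogLik B G x n θ z

/-- The expectation of `Q(θ, q)` under the true process. -/
def meanQ (θ : Param p) (q : Fin m → Fin K → ℝ) : ℝ :=
  ∫ ω, sampleQ B G (fun e => X e ω) 1 θ q ∂P

/-- Stationarity of the expectation. -/
def CondStationary : Prop :=
  ∀ n : ℕ, 1 ≤ n → ∀ θ ∈ B.paramSpace, ∀ z, meanLogLik B G P X n θ z = meanLogLik B G P X 1 θ z

/-- Identification of the latent memberships: changing exactly the labels of the nodes in `S`. -/
def CondIdentification (c δ : ℝ) : Prop :=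
  ∀ θ ∈ B.paramSpace ∩ Metric.ball B.θs δ, ∀ (S : Finset (Fin m)) (z : Fin m → Fin K),
    (∀ i ∈ S, z i ≠ G.zs i) → (∀ i ∉ S, z i = G.zs i) →
      meanLogLik B G P X 1 θ z ≤
        meanLogLik B G P X 1 θ G.zs - c * (∑ i ∈ S, (G.deg i : ℝ)) / (G.A.card : ℝ)

/-- The product distributions in a neighbourhood of the true labels. -/
def NearTruth (δ : ℝ) (q : Fin m → Fin K → ℝ) : Prop := IsProductDist q ∧ labelDist G q ≤ δ

/-- `θq q` is a maximizer of the expected `Q` function. -/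
def IsPopulationMaximizer (θq : (Fin m → Fin K → ℝ) → Param p) (δ : ℝ) : Prop :=
  ∀ q, NearTruth G δ q →
    θq q ∈ B.paramSpace ∧ IsMaxOn (fun θ => meanQ B G P X θ q) B.paramSpace (θq q)

/-- Continuity of the expected `Q` function and of its maximizer. -/
def CondContinuity (θq : (Fin m → Fin K → ℝ) → Param p) (M δ : ℝ) : Prop :=
  ∀ q, NearTruth G δ q →
    (∀ θ ∈ B.paramSpace ∩ Metric.ball B.θs δ,
      meanQ B G P X θ q - meanLogLik B G P X 1 θ G.zs ≤ M * labelDist G q) ∧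
    ‖θq q - B.θs‖ ≤ M * labelDist G q

/-- The gradient condition. -/
def CondGradient (θq : (Fin m → Fin K → ℝ) → Param p) (c M δ : ℝ) : Prop :=
  ∀ q, NearTruth G δ q → ∀ θ ∈ B.paramSpace ∩ Metric.ball (θq q) δ,
    inner ℝ (gradient (fun θ' => meanQ B G P X θ' q) θ) (θ - θq q) ≤ -c * ‖θ - θq q‖ ^ 2 ∧
    ∀ n : ℕ, 1 ≤ n →
      ∫⁻ ω, ‖gradient (fun θ' => sampleQ B G (fun e => X e ω) n θ' q) θ‖ₑ ^ 2 ∂P ≤ ENNReal.ofReal M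

/-- The condition on the initial label distribution. -/
def CondInitial (c : ℝ) (q0 : Fin m → Fin K → ℝ) : Prop :=
  ∀ i k, k ≠ G.zs i →
    meanOverOthers q0 i k (meanLogLik B G P X 1 B.θs) ≤
      meanOverOthers q0 i (G.zs i) (meanLogLik B G P X 1 B.θs) -
        c * (G.deg i : ℝ) / (G.A.card : ℝ)

end Conditions

/-- `f θ t h` and its gradient in `θ` are bounded by `M`, and the gradient is continuous in `θ`, both
uniformly in the time `t` and the history `h`. -/
structure IsBoundedSmooth {p : ℕ} (U : Set (Param p)) (M : ℝ)
    (f : Param p → ℝ → EventStream → ℝ) : Prop where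
  differentiable : ∀ θ ∈ U, ∀ t h, DifferentiableAt ℝ (fun θ' => f θ' t h) θ
  bound : ∀ θ ∈ U, ∀ t h, |f θ t h| ≤ M
  gradient_bound : ∀ θ ∈ U, ∀ t h, ‖gradient (fun θ' => f θ' t h) θ‖ ≤ M
  gradient_continuous :
    EquicontinuousOn (fun (s : ℝ × EventStream) θ => gradient (fun θ' => f θ' s.1 s.2) θ) U

/-- The boundedness condition, with the standing regularity of the model. -/
structure CondBounded {K p : ℕ} (B : BlockModel K p) (M : ℝ) : Prop where
  dT_pos : 0 < B.dT
  isOpen : IsOpen B.paramSpace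
  true_mem : B.θs ∈ B.paramSpace
  measurable : ∀ k l, ∀ θ ∈ B.paramSpace, Measurable (Function.uncurry (B.lam k l θ))
  pos : ∀ k l, ∀ θ ∈ B.paramSpace, ∀ t h, 0 < B.lam k l θ t h
  lam_smooth : ∀ k l, IsBoundedSmooth B.paramSpace M (B.lam k l)
  log_smooth : ∀ k l, IsBoundedSmooth B.paramSpace M fun θ t h => Real.log (B.lam k l θ t h)

/-- Uneven degrees: the nodes in `Nu` have degree at least `d`, all other nodes have degree at most
`D`, and every node has at most `D` neighbours outside `Nu`. -/
def CondDegree {K m : ℕ} (G : LabelledNetwork K m) (Nu : Finset (Fin m)) (d : ℝ) (D : ℕ) : Prop :=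
  (∀ i ∈ Nu, d ≤ (G.deg i : ℝ)) ∧ (∀ i ∉ Nu, G.deg i ≤ D) ∧
    ∀ i, ((G.nbr i).filter fun j => j ∉ Nu).card ≤ D

end

open MeasureTheory ProbabilityTheory Filter Topology
open scoped ENNReal

noncomputable section

/-! ### Measurability of windows, pasts and event times. -/

namespace EventStream

/-! The proof separates a deterministic invariant from a union bound. On a good window one step of
the algorithm preserves the invariant (`GoodState.step`): `θ` stays in a fixed small ball around
`θs`, and at every node of `Nu` the true label has maximal evidence, prior weight at least `1 / (2 *
m)` and, after the first step, posterior weight at least `1 - ξ`. As `ξ ≤ 1 / 4`, the arg max is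
then the true label, however ties are broken.

The iterates depend on the data, so concentration is asked for only at fixed points, with which the
iterates are then compared. For the labels the fixed points are `q0` and the point mass at the true
labels: by C7, and by C2' with one wrong label, a wrong label at `i` costs at least `c * d_i` of
expected log-likelihood, and the sample cost exceeds `c * d_i / 2` up to a probability exponentially
small in `d_i` (`exists_labelGain_rate`). Moving `θ` inside the ball and replacing the point mass by
a nearby `q` uses up at most half of this, because the likelihood is Lipschitz in `θ` and at most
`D` neighbours, few against `m ^ r`, may be badly labelled (`GoodWindow.labelGain_le`). The new
posterior error is at most of order `m * exp (-(c / 4) * m ^ r)`, which tends to zero.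

For the parameter, C3' at the point mass gives `θq q = θs`, and C4 there gives the expected gradient
of the likelihood at the true labels an inner product at most `-c * ‖θ - θs‖ ^ 2` with `θ - θs`.
Difference quotients in this direction replace the derivative. They are finite combinations of
likelihood values, so they concentrate at each point of a finite net, and by C5 they are
equicontinuous in the point and in the step, which carries the bound to all points of the ball. A
short gradient step then cannot leave the ball (`GoodWindow.norm_step_le`).

Concentration rests on an exponential moment for the number of events in a window, which a bounded
intensity provides (`HasIntensity.lintegral_truncExp_le`). Likelihood terms are dominated by these
counts and independent over edges, hence Chernoff (`exists_chernoff_rate`). A window fails to be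
good with probability `O(m) * exp (-C * m ^ r)` (`measure_not_goodWindow_le`). Half of the exponent
absorbs the factor, and a union over the `N` windows concludes. -/

theorem mem_window {x : EventStream} {a b t : ℝ} :
    t ∈ x.window a b ↔ t ∈ x.times ∧ a < t ∧ t ≤ b := by
  simp [window]

theorem mem_times_before {x : EventStream} {t s : ℝ} :
    s ∈ (x.before t).times ↔ s ∈ x.times ∧ s < t := Iff.rfl

theorem measurable_count (t : ℝ) : Measurable fun x : EventStream => x.count t :=
  fun s _ => le_iSup (fun t : ℝ => MeasurableSpace.comap (fun x : EventStream => x.count t) ⊤) t _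
    ⟨s, trivial, rfl⟩

theorem measurable_of_count {α : Type*} [MeasurableSpace α] {f : α → EventStream}
    (h : ∀ t, Measurable fun a => (f a).count t) : Measurable f := by
  rw [measurable_iff_comap_le]
  refine (MeasurableSpace.comap_iSup.trans_le (iSup_le fun t => ?_))
  rw [MeasurableSpace.comap_comp]
  exact (h t).comap_le

theorem window_union (x : EventStream) {a b c : ℝ} (hab : a ≤ b) (hbc : b ≤ c) :
    x.window a c = x.window a b ∪ x.window b c := by
  ext t
  simp only [Finset.mem_union, mem_window]
  constructor
  · rintro ⟨h, h1, h2⟩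
    rcases le_or_gt t b with h3 | h3
    · exact Or.inl ⟨h, h1, h3⟩
    · exact Or.inr ⟨h, h3, h2⟩
  · rintro (⟨h, h1, h2⟩ | ⟨h, h1, h2⟩)
    · exact ⟨h, h1, h2.trans hbc⟩
    · exact ⟨h, hab.trans_lt h1, h2⟩

theorem card_window (x : EventStream) {a b : ℝ} (ha : 0 ≤ a) (hab : a ≤ b) :
    (x.window a b).card = x.count b - x.count a := by
  have hd : Disjoint (x.window 0 a) (x.window a b) := by
    rw [Finset.disjoint_left]
    intro t h1 h2
    rw [mem_window] at h1 h2
    exact absurd h1.2.2 (not_le.2 h2.2.1)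
  unfold count
  rw [window_union x ha hab, Finset.card_union_of_disjoint hd]
  omega

theorem measurable_card_window {a b : ℝ} (ha : 0 ≤ a) :
    Measurable fun x : EventStream => (x.window a b).card := by
  rcases le_total a b with hab | hab
  · simp_rw [fun x => card_window x ha hab]
    exact (measurable_count b).sub (measurable_count a)
  · have : ∀ x : EventStream, x.window a b = ∅ := fun x => by
      ext t
      simp only [mem_window, Finset.notMem_empty, iff_false]
      rintro ⟨-, h1, h2⟩
      exact absurd (h1.trans_le (h2.trans hab)) (lt_irrefl _)
    simp [this]

theorem window_before (x : EventStream) (a b t : ℝ) :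
    (x.before t).window a b = (x.window a b).filter (· < t) := by
  ext s
  simp only [mem_window, mem_times_before, Finset.mem_filter]
  tauto

/-- A rational between the last counted event and `t` replaces the strict inequality. The strict
past thereby becomes a countable union of rectangles, which gives joint measurability in time and
stream. -/
theorem lt_count_before_iff (x : EventStream) (s t : ℝ) (k : ℕ) :
    k < (x.before t).count s ↔ ∃ q : ℚ, (q : ℝ) < t ∧ k < x.count (min s q) := by
  unfold count
  rw [window_before]
  constructor
  · intro h
    have hne : ((x.window 0 s).filter (· < t)).Nonempty := Finset.card_pos.1 (by omega)
    obtain ⟨q, hq1, hq2⟩ := exists_rat_btwn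
      ((Finset.max'_lt_iff _ hne).2 fun y hy => (Finset.mem_filter.1 hy).2)
    refine ⟨q, hq2, h.trans_le (Finset.card_le_card fun y hy => ?_)⟩
    have hy1 := ((Finset.max'_lt_iff _ hne).1 hq1 y hy).le
    rw [Finset.mem_filter, mem_window] at hy
    rw [mem_window]
    exact ⟨hy.1.1, hy.1.2.1, le_min hy.1.2.2 hy1⟩
  · rintro ⟨q, hq, h⟩
    refine h.trans_le (Finset.card_le_card fun y hy => ?_)
    rw [mem_window, le_min_iff] at hy
    rw [Finset.mem_filter, mem_window]
    exact ⟨⟨hy.1, hy.2.1, hy.2.2.1⟩, hy.2.2.2.trans_lt hq⟩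

theorem measurable_before : Measurable fun u : ℝ × EventStream => u.2.before u.1 := by
  refine measurable_of_count fun s => measurable_of_Ioi fun k => ?_
  have : (fun u : ℝ × EventStream => (u.2.before u.1).count s) ⁻¹' Set.Ioi k =
      ⋃ q : ℚ, Set.Ioi (q : ℝ) ×ˢ ((fun x : EventStream => x.count (min s q)) ⁻¹' Set.Ioi k) := by
    ext ⟨t, x⟩
    simp only [Set.mem_preimage, Set.mem_Ioi, Set.mem_iUnion, Set.mem_prod]
    exact lt_count_before_iff x s t k
  rw [this]
  exact MeasurableSet.iUnion fun q =>
    measurableSet_Ioi.prod (measurable_count _ (MeasurableSet.of_discrete))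

/-- The `k`-th event (counted from `0`) in the window, and `0` if there is none. -/
def eventTime (a b : ℝ) (k : ℕ) (x : EventStream) : ℝ :=
  if h : k < (x.window a b).card then (x.window a b).orderEmbOfFin rfl ⟨k, h⟩ else 0

/-- The events are enumerated in increasing order, so the position of the `k`-th one is decided by
counts alone; this makes event times measurable. -/
theorem eventTime_le_iff {a b : ℝ} {k : ℕ} {x : EventStream} (h : k < (x.window a b).card)
    (s : ℝ) : eventTime a b k x ≤ s ↔ k < (x.window a (min s b)).card := by
  have hf : x.window a (min s b) = (x.window a b).filter (· ≤ s) := by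
    ext t
    simp only [mem_window, Finset.mem_filter, le_min_iff]
    tauto
  rw [hf, eventTime, dif_pos h]
  set e := (x.window a b).orderEmbOfFin rfl
  constructor
  · intro hs
    have h1 : (Finset.Iic (⟨k, h⟩ : Fin _)).map e.toEmbedding ⊆
        (x.window a b).filter (· ≤ s) := by
      intro t ht
      obtain ⟨j, hj, rfl⟩ := Finset.mem_map.1 ht
      rw [Finset.mem_filter]
      exact ⟨Finset.orderEmbOfFin_mem _ _ _, (e.monotone (Finset.mem_Iic.1 hj)).trans hs⟩
    have h2 := Finset.card_le_card h1
    rw [Finset.card_map, Fin.card_Iic] at h2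
    exact h2
  · intro hc
    by_contra! hs
    have h1 : (x.window a b).filter (· ≤ s) ⊆
        (Finset.Iio (⟨k, h⟩ : Fin _)).map e.toEmbedding := by
      intro t ht
      rw [Finset.mem_filter] at ht
      have : t ∈ Set.range e := by
        rw [Finset.range_orderEmbOfFin]
        exact ht.1
      obtain ⟨j, rfl⟩ := this
      exact Finset.mem_map.2 ⟨j, Finset.mem_Iio.2 (e.lt_iff_lt.1 (ht.2.trans_lt hs)), rfl⟩
    have h2 := Finset.card_le_card h1
    rw [Finset.card_map, Fin.card_Iio] at h2
    exact absurd hc (not_lt.2 h2)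

theorem measurable_eventTime {a b : ℝ} (ha : 0 ≤ a) (k : ℕ) : Measurable (eventTime a b k) := by
  refine measurable_of_Iic fun s => ?_
  have : eventTime a b k ⁻¹' Set.Iic s =
      ({x | k < (x.window a b).card} ∩ {x | k < (x.window a (min s b)).card}) ∪
        ({x | ¬ k < (x.window a b).card} ∩ {_x | (0 : ℝ) ≤ s}) := by
    ext x
    by_cases h : k < (x.window a b).card
    · simp [h, eventTime_le_iff h]
    · simpa [h, eventTime] using fun _ => not_lt.1 h
  have hm : ∀ b', MeasurableSet {x : EventStream | k < (x.window a b').card} := fun b' =>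
    measurable_card_window ha (MeasurableSet.of_discrete (s := Set.Ioi k))
  rw [this]
  exact ((hm b).inter (hm _)).union ((hm b).compl.inter (MeasurableSet.const _))

theorem sum_window_eq (x : EventStream) (a b : ℝ) (F : ℝ → ℝ) :
    ∑ t ∈ x.window a b, F t = ∑ k ∈ Finset.range (x.window a b).card, F (eventTime a b k x) := by
  have h1 : x.window a b = Finset.univ.map ((x.window a b).orderEmbOfFin rfl).toEmbedding := by
    rw [← Finset.coe_inj]
    simp
  conv_lhs => rw [h1]
  rw [Finset.sum_map, Finset.sum_range]
  refine Finset.sum_congr rfl fun k _ => ?_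
  simp [eventTime]

theorem measurable_sum_window {a b : ℝ} (ha : 0 ≤ a) {F : ℝ → EventStream → ℝ}
    (hF : Measurable (Function.uncurry F)) :
    Measurable fun x : EventStream => ∑ t ∈ x.window a b, F t x := by
  have hk : ∀ k, Measurable fun x => F (eventTime a b k x) x := fun k =>
    hF.comp ((measurable_eventTime ha k).prodMk measurable_id)
  -- The number of terms is random. It is first treated as a free variable in the countable space
  -- `ℕ` and then set to the count.
  have h : Measurable fun u : ℕ × EventStream =>
      ∑ k ∈ Finset.range u.1, F (eventTime a b k u.2) u.2 :=
    measurable_from_prod_countable_right fun n =>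
      Finset.measurable_sum (Finset.range n) fun k _ => hk k
  have h' := h.comp ((measurable_card_window (b := b) ha).prodMk measurable_id)
  convert h' using 1
  exact funext fun x => sum_window_eq x a b fun t => F t x

end EventStream

theorem measurable_uncurry_before {f : ℝ → EventStream → ℝ}
    (hf : Measurable (Function.uncurry f)) :
    Measurable (Function.uncurry fun t (x : EventStream) => f t (x.before t)) :=
  hf.comp (measurable_fst.prodMk EventStream.measurable_before)

theorem measurable_edgeLogLik {K p : ℕ} {B : BlockModel K p} {k l : Fin K} {θ : Param p}
    (h : Measurable (Function.uncurry (B.lam k l θ))) {a b : ℝ} (ha : 0 ≤ a) :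
    Measurable (edgeLogLik B k l θ a b) := by
  have h1 := measurable_uncurry_before h
  refine (EventStream.measurable_sum_window ha ?_).sub ?_
  · exact Real.measurable_log.comp h1
  · simp only [intervalIntegral]
    have h2 : StronglyMeasurable fun u : EventStream × ℝ => B.lam k l θ u.2 (u.1.before u.2) :=
      (h1.comp measurable_swap).stronglyMeasurable
    exact (h2.integral_prod_right).measurable.sub (h2.integral_prod_right).measurable

/-! ### Exponential moments of event counts and Chernoff bounds. -/

/-- In increasing order the number of predecessors runs through `0, 1, 2, …`, once each. -/
theorem sum_card_filter_lt {β : Type*} [AddCommMonoid β] (W : Finset ℝ) (g : ℕ → β) :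
    ∑ t ∈ W, g (W.filter (· < t)).card = ∑ j ∈ Finset.range W.card, g j := by
  induction W using Finset.induction_on_max with
  | empty => simp
  | insert a s hs ih =>
    have ha : a ∉ s := fun h => lt_irrefl _ (hs a h)
    rw [Finset.sum_insert ha, Finset.card_insert_of_notMem ha, Finset.sum_range_succ, add_comm,
      ← ih]
    congr 1
    · refine Finset.sum_congr rfl fun t ht => ?_
      rw [Finset.filter_insert, if_neg (not_lt.2 (hs t ht).le)]
    · rw [Finset.filter_insert, if_neg (lt_irrefl _), Finset.filter_true_of_mem hs]

/-- The integrand sees only the number of earlier events in the window, so it is predictable and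
`HasIntensity` applies to the left side. -/
theorem EventStream.tsum_window (x : EventStream) (a b : ℝ) (g : ℕ → ℝ≥0∞) :
    ∑' t : x.times, (Set.Ioc a b).indicator (fun t => g ((x.before t).window a b).card) (t : ℝ) =
      ∑ j ∈ Finset.range (x.window a b).card, g j := by
  rw [tsum_subtype x.times
    ((Set.Ioc a b).indicator (fun t => g ((x.before t).window a b).card)),
    tsum_eq_sum (s := x.window a b), ← sum_card_filter_lt]
  · refine Finset.sum_congr rfl fun t ht => ?_
    rw [EventStream.mem_window] at ht
    rw [Set.indicator_of_mem ht.1, Set.indicator_of_mem (show t ∈ Set.Ioc a b from ht.2),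
      EventStream.window_before]
  · intro t ht
    rw [EventStream.mem_window] at ht
    by_cases h : t ∈ x.times
    · rw [Set.indicator_of_mem h, Set.indicator_of_notMem (show t ∉ Set.Ioc a b from
        fun h' => ht ⟨h, h'⟩)]
    · rw [Set.indicator_of_notMem h]

/-- The increments of the truncated exponential `j ↦ exp (s * min j k)`. -/
def truncExpIncr (s : ℝ) (k j : ℕ) : ℝ≥0∞ :=
  if j < k then ENNReal.ofReal (Real.exp (s * j) * (Real.exp s - 1)) else 0

theorem one_add_sum_truncExpIncr {s : ℝ} (hs : 0 ≤ s) (k n : ℕ) :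
    1 + ∑ j ∈ Finset.range n, truncExpIncr s k j =
      ENNReal.ofReal (Real.exp (s * (min n k : ℕ))) := by
  induction n with
  | zero => simp
  | succ n ih =>
    rw [Finset.sum_range_succ, ← add_assoc, ih, truncExpIncr]
    split_ifs with h
    · have h1 : (0 : ℝ) ≤ Real.exp s - 1 := by linarith [Real.one_le_exp hs]
      rw [min_eq_left h.le, min_eq_left (Nat.succ_le_of_lt h), ← ENNReal.ofReal_add (by positivity)
        (by positivity)]
      congr 1
      push_cast
      rw [mul_add, Real.exp_add, mul_one]
      ring
    · rw [add_zero, min_eq_right (not_lt.1 h), min_eq_right ((not_lt.1 h).trans n.le_succ)]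

theorem truncExpIncr_le {s : ℝ} (hs : 0 ≤ s) {k j n : ℕ} (hj : j ≤ n) :
    truncExpIncr s k j ≤
      ENNReal.ofReal (Real.exp s - 1) * ENNReal.ofReal (Real.exp (s * (min n k : ℕ))) := by
  have h1 : (0 : ℝ) ≤ Real.exp s - 1 := by linarith [Real.one_le_exp hs]
  rw [truncExpIncr]
  split_ifs with h
  · rw [mul_comm, ENNReal.ofReal_mul h1]
    gcongr
    exact le_min hj h.le
  · exact zero_le

section Moments

variable {Ω : Type*} [MeasurableSpace Ω] {P : Measure Ω}

/-- The truncated exponential of the count is `1` plus the sum of its jumps, one per event. The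
intensity formula turns this sum into a time integral, in which each jump is at most `exp s - 1`
times the final value and the intensity is at most `M`. Hence `J ≤ 1 + J / 2`. The truncation keeps
`J` finite, so that `J / 2` may be subtracted. -/
theorem HasIntensity.lintegral_truncExp_le [IsProbabilityMeasure P] {X : Ω → EventStream}
    {lam : ℝ → EventStream → ℝ} (hX : HasIntensity P X lam) {M s a b : ℝ}
    (hlam : ∀ t h, lam t h ≤ M) (hM : 0 ≤ M) (hs : 0 ≤ s) (ha : 0 ≤ a) (hab : a ≤ b)
    (hsmall : (Real.exp s - 1) * M * (b - a) ≤ 1 / 2) (k : ℕ) :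
    ∫⁻ ω, ENNReal.ofReal (Real.exp (s * (min ((X ω).window a b).card k : ℕ))) ∂P ≤ 2 := by
  set J := ∫⁻ ω, ENNReal.ofReal (Real.exp (s * (min ((X ω).window a b).card k : ℕ))) ∂P
  have h1 : (0 : ℝ) ≤ Real.exp s - 1 := by linarith [Real.one_le_exp hs]
  have hba : 0 ≤ b - a := by linarith
  have hJtop : J ≠ ⊤ := by
    have : J ≤ ENNReal.ofReal (Real.exp (s * k)) := by
      calc J ≤ ∫⁻ _ω, ENNReal.ofReal (Real.exp (s * k)) ∂P := by
            refine lintegral_mono fun ω => ?_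
            gcongr
            exact min_le_right _ _
        _ = _ := by simp
    exact ne_top_of_le_ne_top ENNReal.ofReal_ne_top this
  have hint := hX (fun t h => (Prod.fst ⁻¹' Set.Ioc a b).indicator
    (fun u : ℝ × EventStream => truncExpIncr s k (u.2.window a b).card) (t, h))
    (((measurable_of_countable (truncExpIncr s k)).comp
      ((EventStream.measurable_card_window ha).comp measurable_snd)).indicator
        (measurable_fst measurableSet_Ioc))
  have hJ : J = 1 + ∫⁻ ω, ∑ j ∈ Finset.range ((X ω).window a b).card, truncExpIncr s k j ∂P := by
    have h2 : (1 : ℝ≥0∞) = ∫⁻ _ω, 1 ∂P := by simp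
    conv_rhs => rw [h2]
    rw [← lintegral_add_left measurable_const]
    simp [J, one_add_sum_truncExpIncr hs]
  have hL : ∫⁻ ω, ∑ j ∈ Finset.range ((X ω).window a b).card, truncExpIncr s k j ∂P
      ≤ ENNReal.ofReal (1 / 2) * J := by
    have h2 : ∀ ω, ∑ j ∈ Finset.range ((X ω).window a b).card, truncExpIncr s k j =
        ∑' t : (X ω).times, (Prod.fst ⁻¹' Set.Ioc a b).indicator
          (fun u : ℝ × EventStream => truncExpIncr s k (u.2.window a b).card)
            ((t : ℝ), (X ω).before t) := fun ω => by
      rw [← EventStream.tsum_window]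
      rfl
    simp_rw [h2]
    rw [hint, ← lintegral_const_mul' _ _ ENNReal.ofReal_ne_top]
    refine lintegral_mono fun ω => ?_
    set E := ENNReal.ofReal (Real.exp (s * (min ((X ω).window a b).card k : ℕ)))
    calc _ ≤ ∫⁻ t in Set.Ioi (0 : ℝ), (Set.Ioc a b).indicator
            (fun _ => ENNReal.ofReal (Real.exp s - 1) * E * ENNReal.ofReal M) t := by
          refine lintegral_mono fun t => ?_
          by_cases ht : t ∈ Set.Ioc a b
          · rw [Set.indicator_of_mem ht]
            dsimp only
            rw [Set.indicator_of_mem (show _ ∈ Prod.fst ⁻¹' Set.Ioc a b from ht)]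
            refine mul_le_mul' (truncExpIncr_le hs ?_) (ENNReal.ofReal_le_ofReal (hlam _ _))
            rw [EventStream.window_before]
            exact Finset.card_filter_le _ _
          · dsimp only
            rw [Set.indicator_of_notMem (show _ ∉ Prod.fst ⁻¹' Set.Ioc a b from ht), zero_mul]
            exact zero_le
      _ ≤ ∫⁻ t, (Set.Ioc a b).indicator
            (fun _ => ENNReal.ofReal (Real.exp s - 1) * E * ENNReal.ofReal M) t :=
          setLIntegral_le_lintegral _ _
      _ = ENNReal.ofReal ((Real.exp s - 1) * M * (b - a)) * E := by
          rw [lintegral_indicator measurableSet_Ioc, lintegral_const, Measure.restrict_apply_univ,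
            Real.volume_Ioc, ENNReal.ofReal_mul (by positivity), ENNReal.ofReal_mul (by positivity)]
          ring
      _ ≤ _ := by gcongr
  have hle : J ≤ 1 + ENNReal.ofReal (1 / 2) * J := hJ.trans_le (by gcongr)
  lift J to NNReal using hJtop with j
  have : (j : ℝ≥0∞) = ENNReal.ofReal j := by simp
  rw [this, ← ENNReal.ofReal_one, ← ENNReal.ofReal_mul (by norm_num), ← ENNReal.ofReal_add
    (by norm_num) (by positivity), ENNReal.ofReal_le_ofReal_iff (by positivity)] at hle
  rw [this, ← ENNReal.ofReal_ofNat, ENNReal.ofReal_le_ofReal_iff (by norm_num)]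
  linarith

theorem HasIntensity.lintegral_exp_le [IsProbabilityMeasure P] {X : Ω → EventStream}
    (hXm : Measurable X)
    {lam : ℝ → EventStream → ℝ} (hX : HasIntensity P X lam) {M s a b : ℝ}
    (hlam : ∀ t h, lam t h ≤ M) (hM : 0 ≤ M) (hs : 0 ≤ s) (ha : 0 ≤ a) (hab : a ≤ b)
    (hsmall : (Real.exp s - 1) * M * (b - a) ≤ 1 / 2) :
    ∫⁻ ω, ENNReal.ofReal (Real.exp (s * ((X ω).window a b).card)) ∂P ≤ 2 := by
  refine le_of_tendsto' (lintegral_tendsto_of_tendsto_of_monotone (f := fun k ω =>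
    ENNReal.ofReal (Real.exp (s * (min ((X ω).window a b).card k : ℕ)))) (fun k => ?_) ?_ ?_)
    fun k => hX.lintegral_truncExp_le hlam hM hs ha hab hsmall k
  · exact ((measurable_of_countable fun n : ℕ =>
      ENNReal.ofReal (Real.exp (s * (min n k : ℕ)))).comp
        ((EventStream.measurable_card_window ha).comp hXm)).aemeasurable
  · refine ae_of_all _ fun ω k l hkl => ?_
    dsimp only
    gcongr
  · refine ae_of_all _ fun ω => tendsto_const_nhds.congr' ?_
    filter_upwards [eventually_ge_atTop ((X ω).window a b).card] with k hk
    rw [min_eq_left hk]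

/-- Taylor expansion with the linear term kept exact, so that the mean appears in the bound on the
moment generating function. -/
theorem exp_le_one_add_add_sq_mul_exp_abs (x : ℝ) :
    Real.exp x ≤ 1 + x + x ^ 2 * Real.exp |x| := by
  have h := Complex.norm_exp_sub_sum_le_norm_mul_exp (x : ℂ) 2
  simp only [Finset.sum_range_succ, Finset.sum_range_zero] at h
  have h2 : ‖Complex.exp x - (0 + (x : ℂ) ^ 0 / (Nat.factorial 0 : ℂ) +
      (x : ℂ) ^ 1 / (Nat.factorial 1 : ℂ))‖ = |Real.exp x - (1 + x)| := by
    rw [← Real.norm_eq_abs, ← Complex.norm_real]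
    simp
  rw [h2, Complex.norm_real, Real.norm_eq_abs, sq_abs] at h
  linarith [le_abs_self (Real.exp x - (1 + x))]

variable {N Y : Ω → ℝ} {s H : ℝ}

theorem integrable_exp_of_lintegral_le (hN : Measurable N)
    (hexp : ∫⁻ ω, ENNReal.ofReal (Real.exp (s * N ω)) ∂P ≤ 2) :
    Integrable (fun ω => Real.exp (s * N ω)) P ∧ ∫ ω, Real.exp (s * N ω) ∂P ≤ 2 := by
  have hm : Measurable fun ω => Real.exp (s * N ω) := (hN.const_mul s).exp
  have h0 : 0 ≤ᵐ[P] fun ω => Real.exp (s * N ω) := ae_of_all _ fun ω => (Real.exp_pos _).le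
  refine ⟨⟨hm.aestronglyMeasurable, ?_⟩, ?_⟩
  · rw [hasFiniteIntegral_iff_ofReal h0]
    exact hexp.trans_lt (by norm_num)
  · rw [integral_eq_lintegral_of_nonneg_ae h0 hm.aestronglyMeasurable]
    exact ENNReal.toReal_mono (by norm_num) hexp

theorem integrable_exp_mul_of_dominated (hN : Measurable N) (hY : Measurable Y)
    (hexp : ∫⁻ ω, ENNReal.ofReal (Real.exp (s * N ω)) ∂P ≤ 2) (hs : 0 < s) (hH : 0 < H)
    (hYN : ∀ ω, |Y ω| ≤ H * (N ω + 1)) {t : ℝ} (ht0 : 0 ≤ t) (ht : t ≤ s / (2 * H)) :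
    Integrable (fun ω => Real.exp (t * Y ω)) P := by
  refine ((integrable_exp_of_lintegral_le hN hexp).1.const_mul (Real.exp s)).mono'
    (hY.const_mul t).exp.aestronglyMeasurable (ae_of_all _ fun ω => ?_)
  rw [Real.norm_eq_abs, Real.abs_exp, ← Real.exp_add, Real.exp_le_exp]
  rw [le_div_iff₀ (by positivity)] at ht
  have h0 : 0 ≤ N ω + 1 := by
    have := (abs_nonneg _).trans (hYN ω)
    exact nonneg_of_mul_nonneg_right this hH
  calc t * Y ω ≤ t * (H * (N ω + 1)) :=
        mul_le_mul_of_nonneg_left ((le_abs_self _).trans (hYN ω)) ht0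
    _ = (t * (2 * H)) * (N ω + 1) / 2 := by ring
    _ ≤ s * (N ω + 1) / 2 := by gcongr
    _ ≤ s + s * N ω := by nlinarith

theorem integrable_of_dominated [IsProbabilityMeasure P] (hN : Measurable N) (hY : Measurable Y)
    (hexp : ∫⁻ ω, ENNReal.ofReal (Real.exp (s * N ω)) ∂P ≤ 2) (hs : 0 < s) (hH : 0 ≤ H)
    (hYN : ∀ ω, |Y ω| ≤ H * (N ω + 1)) : Integrable Y P := by
  have h1 := (integrable_exp_of_lintegral_le hN hexp).1
  refine ((h1.const_mul (H / s)).add (integrable_const H)).mono'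
    hY.aestronglyMeasurable (ae_of_all _ fun ω => ?_)
  have h2 : s * N ω ≤ Real.exp (s * N ω) := by linarith [Real.add_one_le_exp (s * N ω)]
  calc |Y ω| ≤ H * (N ω + 1) := hYN ω
    _ ≤ H * (Real.exp (s * N ω) / s + 1) := by
        have h3 : N ω ≤ Real.exp (s * N ω) / s := by rw [le_div_iff₀ hs]; linarith
        gcongr
    _ = _ := by simp only [Pi.add_apply]; ring

theorem mgf_le_of_dominated [IsProbabilityMeasure P] (hN : Measurable N) (hY : Measurable Y)
    (hexp : ∫⁻ ω, ENNReal.ofReal (Real.exp (s * N ω)) ∂P ≤ 2) (hs : 0 < s) (hH : 0 < H)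
    (hYN : ∀ ω, |Y ω| ≤ H * (N ω + 1)) {t : ℝ} (ht0 : 0 ≤ t) (ht : t ≤ s / (2 * H)) :
    mgf Y P t ≤ Real.exp (t * ∫ ω, Y ω ∂P + t ^ 2 * (4 * Real.exp s / (s / (2 * H)) ^ 2)) := by
  set u := s / (2 * H) with hu
  have hu0 : 0 < u := by positivity
  obtain ⟨hi, hle⟩ := integrable_exp_of_lintegral_le hN hexp
  have hYi := integrable_of_dominated hN hY hexp hs hH.le hYN
  -- The domination gives `u * |Y| ≤ s * (N + 1) / 2`. One such half of the exponential moment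
  -- absorbs `Y ^ 2`, the other absorbs `exp |t * Y|`.
  have hpt : ∀ ω, Real.exp (t * Y ω) ≤
      1 + t * Y ω + t ^ 2 * (2 * Real.exp s / u ^ 2) * Real.exp (s * N ω) := fun ω => by
    refine (exp_le_one_add_add_sq_mul_exp_abs _).trans ?_
    gcongr 1 + t * Y ω + ?_
    have h1 : u ^ 2 * Y ω ^ 2 ≤ 2 * Real.exp (u * |Y ω|) := by
      have := Real.quadratic_le_exp_of_nonneg (x := u * |Y ω|) (by positivity)
      have h2 : u ^ 2 * Y ω ^ 2 = (u * |Y ω|) ^ 2 := by rw [mul_pow, sq_abs]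
      have h3 : 0 ≤ u * |Y ω| := by positivity
      rw [h2]
      linarith
    have h2 : |t * Y ω| ≤ u * |Y ω| := by
      rw [abs_mul, abs_of_nonneg ht0]
      gcongr
    have h3 : u * |Y ω| + u * |Y ω| ≤ s + s * N ω := by
      have : u * (2 * H) = s := by rw [hu]; field_simp
      calc u * |Y ω| + u * |Y ω| = 2 * u * |Y ω| := by ring
        _ ≤ 2 * u * (H * (N ω + 1)) := by gcongr; exact hYN ω
        _ = (u * (2 * H)) * (N ω + 1) := by ring
        _ = _ := by rw [this]; ring
    calc (t * Y ω) ^ 2 * Real.exp |t * Y ω|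
        = t ^ 2 * ((u ^ 2 * Y ω ^ 2) * Real.exp |t * Y ω|) / u ^ 2 := by field_simp
      _ ≤ t ^ 2 * ((2 * Real.exp (u * |Y ω|)) * Real.exp (u * |Y ω|)) / u ^ 2 := by gcongr
      _ = t ^ 2 * (2 * Real.exp (u * |Y ω| + u * |Y ω|)) / u ^ 2 := by rw [Real.exp_add]; ring
      _ ≤ t ^ 2 * (2 * Real.exp (s + s * N ω)) / u ^ 2 := by gcongr
      _ = _ := by rw [Real.exp_add]; ring
  have hint : Integrable (fun ω => 1 + t * Y ω +
      t ^ 2 * (2 * Real.exp s / u ^ 2) * Real.exp (s * N ω)) P :=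
    ((integrable_const 1).add (hYi.const_mul t)).add (hi.const_mul _)
  calc mgf Y P t ≤ ∫ ω, (1 + t * Y ω +
        t ^ 2 * (2 * Real.exp s / u ^ 2) * Real.exp (s * N ω)) ∂P :=
        integral_mono (integrable_exp_mul_of_dominated hN hY hexp hs hH hYN ht0 ht) hint hpt
    _ = 1 + t * ∫ ω, Y ω ∂P +
        t ^ 2 * (2 * Real.exp s / u ^ 2) * ∫ ω, Real.exp (s * N ω) ∂P := by
        have h1 := integral_add ((integrable_const 1).add (hYi.const_mul t))
          (hi.const_mul (t ^ 2 * (2 * Real.exp s / u ^ 2)))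
        have h2 := integral_add (integrable_const (μ := P) 1) (hYi.const_mul t)
        simp only [Pi.add_apply] at h1
        rw [h1, h2, integral_const_mul, integral_const_mul]
        simp
    _ ≤ 1 + t * ∫ ω, Y ω ∂P + t ^ 2 * (2 * Real.exp s / u ^ 2) * 2 := by gcongr
    _ = (t * ∫ ω, Y ω ∂P + t ^ 2 * (4 * Real.exp s / u ^ 2)) + 1 := by ring
    _ ≤ _ := Real.add_one_le_exp _

/-- Chernoff bound for sums of independent variables dominated by variables with a common
exponential moment. -/
theorem exists_chernoff_rate (hs : 0 < s) (hH : 0 < H) {τ : ℝ} (hτ : 0 < τ) :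
    ∃ C > 0, ∀ {Ω : Type*} [MeasurableSpace Ω] {P : Measure Ω} [IsProbabilityMeasure P]
      {ι : Type} {N Y : ι → Ω → ℝ} (E : Finset ι), (∀ e, Measurable (N e)) →
      (∀ e, Measurable (Y e)) → iIndepFun Y P →
      (∀ e, ∫⁻ ω, ENNReal.ofReal (Real.exp (s * N e ω)) ∂P ≤ 2) →
      (∀ e ω, |Y e ω| ≤ H * (N e ω + 1)) →
      P {ω | ∑ e ∈ E, ∫ ω, Y e ω ∂P + τ * E.card ≤ ∑ e ∈ E, Y e ω} ≤
        ENNReal.ofReal (Real.exp (-C * E.card)) := by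
  set R := 4 * Real.exp s / (s / (2 * H)) ^ 2 with hR
  have hR0 : 0 < R := by positivity
  -- The first entry keeps `t` in the range of the moment bound. The second makes the quadratic term
  -- `t ^ 2 * R` at most half of the gain `t * τ`.
  set t := min (s / (2 * H)) (τ / (2 * R)) with htdef
  have ht0 : 0 < t := by positivity
  have ht1 : t ≤ s / (2 * H) := min_le_left _ _
  have ht2 : t * R ≤ τ / 2 := by
    have : t ≤ τ / (2 * R) := min_le_right _ _
    rw [le_div_iff₀ (by positivity)] at this
    linarith
  refine ⟨t * τ / 2, by positivity, ?_⟩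
  intro Ω _ P _ ι N Y E hN hY hind hexp hYN
  have hmgf : mgf (∑ e ∈ E, Y e) P t ≤
      Real.exp (t * ∑ e ∈ E, ∫ ω, Y e ω ∂P + t ^ 2 * R * E.card) := by
    rw [hind.mgf_sum hY]
    calc ∏ e ∈ E, mgf (Y e) P t ≤ ∏ e ∈ E, Real.exp (t * ∫ ω, Y e ω ∂P + t ^ 2 * R) :=
          Finset.prod_le_prod (fun e _ => mgf_nonneg) fun e _ =>
            mgf_le_of_dominated (hN e) (hY e) (hexp e) hs hH (hYN e) ht0.le ht1
      _ = _ := by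
          rw [← Real.exp_sum, Finset.sum_add_distrib, ← Finset.mul_sum]
          simp [mul_comm]
  have hch := measure_ge_le_exp_mul_mgf (X := ∑ e ∈ E, Y e) (μ := P)
    (∑ e ∈ E, ∫ ω, Y e ω ∂P + τ * E.card) ht0.le
    (hind.integrable_exp_mul_sum hY fun e _ =>
      integrable_exp_mul_of_dominated (hN e) (hY e) (hexp e) hs hH (hYN e) ht0.le ht1)
  have hset : {ω | ∑ e ∈ E, ∫ ω, Y e ω ∂P + τ * E.card ≤ ∑ e ∈ E, Y e ω} =
      {ω | ∑ e ∈ E, ∫ ω, Y e ω ∂P + τ * E.card ≤ (∑ e ∈ E, Y e) ω} := by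
    simp only [Finset.sum_apply]
  rw [hset, ← ofReal_measureReal]
  refine ENNReal.ofReal_le_ofReal (hch.trans ?_)
  calc _ ≤ Real.exp (-t * (∑ e ∈ E, ∫ ω, Y e ω ∂P + τ * E.card)) *
        Real.exp (t * ∑ e ∈ E, ∫ ω, Y e ω ∂P + t ^ 2 * R * E.card) := by gcongr
    _ = Real.exp (t * (t * R - τ) * E.card) := by rw [← Real.exp_add]; ring_nf
    _ ≤ _ := by
        rw [Real.exp_le_exp]
        gcongr
        nlinarith

/-- An exponential Markov bound for sums of independent variables. -/
theorem measure_sum_gt_le [IsProbabilityMeasure P] (hs : 0 < s) {ι : Type} {N : ι → Ω → ℝ}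
    (E : Finset ι) (hN : ∀ e, Measurable (N e)) (hind : iIndepFun N P)
    (hexp : ∀ e, ∫⁻ ω, ENNReal.ofReal (Real.exp (s * N e ω)) ∂P ≤ 2) (y : ℝ) :
    P {ω | y < ∑ e ∈ E, N e ω} ≤ ENNReal.ofReal (Real.exp (E.card - s * y)) := by
  have hch := measure_ge_le_exp_mul_mgf (X := ∑ e ∈ E, N e) (μ := P) y hs.le
    (hind.integrable_exp_mul_sum hN fun e _ => (integrable_exp_of_lintegral_le (hN e) (hexp e)).1)
  calc P {ω | y < ∑ e ∈ E, N e ω} ≤ P {ω | y ≤ (∑ e ∈ E, N e) ω} := by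
        refine measure_mono fun ω hω => ?_
        simpa using (show y < _ from hω).le
    _ = ENNReal.ofReal (P.real {ω | y ≤ (∑ e ∈ E, N e) ω}) := by
        rw [ofReal_measureReal]
    _ ≤ _ := by
        refine ENNReal.ofReal_le_ofReal (hch.trans ?_)
        rw [hind.mgf_sum hN]
        -- Each moment generating function is at most `2 ≤ exp 1`, so each edge costs one unit in
        -- the exponent.
        calc _ ≤ Real.exp (-s * y) * ∏ e ∈ E, Real.exp 1 := by
              gcongr with e he
              · exact fun e _ => mgf_nonneg
              · exact (integrable_exp_of_lintegral_le (hN e) (hexp e)).2.trans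
                  (by linarith [Real.add_one_le_exp 1])
          _ = _ := by
              rw [← Real.exp_sum, ← Real.exp_add]
              simp
              ring

end Moments

/-! ### Means over product distributions on the labels. -/

section MeanOver

variable {K m : ℕ} {q : Fin m → Fin K → ℝ} {g h : (Fin m → Fin K) → ℝ}

theorem sum_prod_eq_prod_sum (q : Fin m → Fin K → ℝ) :
    ∑ z : Fin m → Fin K, ∏ i, q i (z i) = ∏ i, ∑ k, q i k := by
  rw [Finset.prod_univ_sum]
  simp

theorem meanOver_const (hq : ∀ i, ∑ k, q i k = 1) (a : ℝ) : meanOver q (fun _ => a) = a := by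
  simp only [meanOver]
  rw [← Finset.sum_mul, sum_prod_eq_prod_sum]
  simp [hq]

theorem meanOver_sub : meanOver q (fun z => g z - h z) = meanOver q g - meanOver q h := by
  simp [meanOver, mul_sub]

theorem meanOver_const_mul (a : ℝ) : meanOver q (fun z => a * g z) = a * meanOver q g := by
  simp only [meanOver, Finset.mul_sum]
  exact Finset.sum_congr rfl fun z _ => by ring

theorem meanOver_sum {ι : Type*} (s : Finset ι) (f : ι → (Fin m → Fin K) → ℝ) :
    meanOver q (fun z => ∑ e ∈ s, f e z) = ∑ e ∈ s, meanOver q (f e) := by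
  simp only [meanOver, Finset.mul_sum]
  rw [Finset.sum_comm]

theorem abs_meanOver_le (hq : ∀ i k, 0 ≤ q i k) (hgh : ∀ z, |g z| ≤ h z) :
    |meanOver q g| ≤ meanOver q h := by
  refine (Finset.abs_sum_le_sum_abs _ _).trans (Finset.sum_le_sum fun z _ => ?_)
  have h0 : 0 ≤ ∏ i, q i (z i) := Finset.prod_nonneg fun i _ => hq i _
  rw [abs_mul, abs_of_nonneg h0]
  exact mul_le_mul_of_nonneg_left (hgh z) h0

/-- The factor `φ (z j)` is absorbed into the `j`-th marginal, after which the sum factorizes and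
the other factors are `1`. -/
theorem meanOver_coord (hq : ∀ i, ∑ k, q i k = 1) (j : Fin m) (φ : Fin K → ℝ) :
    meanOver q (fun z => φ (z j)) = ∑ k, q j k * φ k := by
  have h1 : ∀ z : Fin m → Fin K, (∏ i, q i (z i)) * φ (z j) =
      ∏ i, Function.update q j (fun k => q j k * φ k) i (z i) := fun z => by
    have h2 : ∏ i ∈ Finset.univ.erase j, Function.update q j (fun k => q j k * φ k) i (z i) =
        ∏ i ∈ Finset.univ.erase j, q i (z i) := Finset.prod_congr rfl fun i hi => by
      rw [Function.update_of_ne (Finset.ne_of_mem_erase hi)]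
    rw [← Finset.mul_prod_erase _ (fun i => q i (z i)) (Finset.mem_univ j),
      ← Finset.mul_prod_erase _ (fun i => Function.update q j _ i (z i)) (Finset.mem_univ j),
      Function.update_self, h2]
    ring
  simp only [meanOver, h1]
  rw [sum_prod_eq_prod_sum, ← Finset.mul_prod_erase _ _ (Finset.mem_univ j), Function.update_self,
    Finset.prod_congr rfl (g := fun _ => (1 : ℝ)) fun i hi => by
      rw [Function.update_of_ne (Finset.ne_of_mem_erase hi), hq]]
  simp

/-- The label is changed inside the mean instead of in `q`, so that two labels of node `i` can be
compared under one and the same average. -/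
theorem meanOverOthers_eq (hq : ∀ i, ∑ k, q i k = 1) (i : Fin m) (k : Fin K) :
    meanOverOthers q i k g = meanOver q (fun z => g (Function.update z i k)) := by
  classical
  have hu : ∀ (a b : Fin K) (w : {j // j ≠ i} → Fin K),
      Function.update ((Equiv.funSplitAt i (Fin K)).symm (a, w)) i b =
        (Equiv.funSplitAt i (Fin K)).symm (b, w) := fun a b w => by
    ext j
    by_cases hj : j = i
    · subst hj; simp [Equiv.funSplitAt, Equiv.piSplitAt]
    · simp [Equiv.funSplitAt, Equiv.piSplitAt, hj]
  have hp : ∀ (r : Fin m → Fin K → ℝ) (a : Fin K) (w : {j // j ≠ i} → Fin K),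
      ∏ j, r j ((Equiv.funSplitAt i (Fin K)).symm (a, w) j) =
        r i a * ∏ j : {j // j ≠ i}, r j (w j) :=
    fun r a w => by
      rw [Fintype.prod_eq_mul_prod_subtype_ne _ i]
      congr 1
      · simp [Equiv.funSplitAt, Equiv.piSplitAt]
      · refine Finset.prod_congr rfl fun j _ => ?_
        simp [Equiv.funSplitAt, Equiv.piSplitAt, j.2]
  unfold meanOverOthers meanOver
  rw [← (Equiv.funSplitAt i (Fin K)).symm.sum_comp, ← (Equiv.funSplitAt i (Fin K)).symm.sum_comp,
    Fintype.sum_prod_type_right, Fintype.sum_prod_type_right]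
  refine Finset.sum_congr rfl fun w _ => ?_
  simp only [hp, hu, Function.update_self]
  have hw : ∏ j : {j // j ≠ i}, Function.update q i (Pi.single k 1) j (w j) =
      ∏ j : {j // j ≠ i}, q j (w j) :=
    Finset.prod_congr rfl fun j _ => by rw [Function.update_of_ne j.2]
  simp only [hw, mul_assoc]
  rw [← Finset.sum_mul, hq, one_mul, Finset.sum_eq_single k]
  · simp
  · intro b _ hb
    simp [hb]
  · simp

theorem isProductDist_single (zs : Fin m → Fin K) :
    IsProductDist fun i => (Pi.single (zs i) 1 : Fin K → ℝ) :=
  fun i => single_mem_stdSimplex ℝ (zs i)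

theorem meanOver_single (zs : Fin m → Fin K) :
    meanOver (fun i => (Pi.single (zs i) 1 : Fin K → ℝ)) g = g zs := by
  unfold meanOver
  rw [Finset.sum_eq_single zs]
  · simp
  · intro z _ hz
    obtain ⟨i, hi⟩ := Function.ne_iff.1 hz
    rw [Finset.prod_eq_zero (Finset.mem_univ i) (by simp [hi]), zero_mul]
  · simp

theorem labelDist_single (G : LabelledNetwork K m) :
    labelDist G (fun i => (Pi.single (G.zs i) 1 : Fin K → ℝ)) = 0 := by
  simp [labelDist, tvDist]

/-- The error of replacing `z ∼ q` by `zs` in the mean of a function of two labels. -/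
theorem abs_meanOver_sub_le (hq : IsProductDist q) (zs : Fin m → Fin K) (i j : Fin m) {H : ℝ}
    (hg : ∀ z, |g z - g zs| ≤
      H * ((if z i = zs i then 0 else 1) + (if z j = zs j then 0 else 1))) :
    |meanOver q g - g zs| ≤ H * ((1 - q i (zs i)) + (1 - q j (zs j))) := by
  have hq1 : ∀ i, ∑ k, q i k = 1 := fun i => (hq i).2
  have hc : ∀ j, meanOver q (fun z => if z j = zs j then (0 : ℝ) else 1) = 1 - q j (zs j) := by
    intro j
    have h1 : ∀ k, q j k * (if k = zs j then (0 : ℝ) else 1) =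
        q j k - if k = zs j then q j k else 0 := fun k => by split_ifs <;> simp
    rw [meanOver_coord hq1 j fun k => if k = zs j then (0 : ℝ) else 1,
      Finset.sum_congr rfl fun k _ => h1 k, Finset.sum_sub_distrib, hq1]
    simp
  calc |meanOver q g - g zs| = |meanOver q (fun z => g z - g zs)| := by
        rw [meanOver_sub, meanOver_const hq1]
    _ ≤ meanOver q (fun z =>
          H * ((if z i = zs i then 0 else 1) + (if z j = zs j then 0 else 1))) :=
        abs_meanOver_le (fun i k => (hq i).1 k) hg
    _ = _ := by
        rw [meanOver_const_mul, ← hc i, ← hc j]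
        congr 1
        simp only [meanOver, mul_add, Finset.sum_add_distrib]

end MeanOver

/-! ### Edge counts at a node and outside the well-connected nodes. -/

namespace LabelledNetwork

variable {K m : ℕ} (G : LabelledNetwork K m)

/-- The edges at the node `i`. -/
def edgesAt (i : Fin m) : Finset (Fin m × Fin m) := G.A.filter fun e => e.1 = i ∨ e.2 = i

/-- The edges with an end outside `Nu`. -/
def edgesOff (Nu : Finset (Fin m)) : Finset (Fin m × Fin m) :=
  G.A.filter fun e => e.1 ∉ Nu ∨ e.2 ∉ Nu

/-- The edges at the node `i` with an end outside `Nu`. -/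
def edgesAtOff (Nu : Finset (Fin m)) (i : Fin m) : Finset (Fin m × Fin m) :=
  (G.edgesAt i).filter fun e => e.1 ∉ Nu ∨ e.2 ∉ Nu

theorem edgesAt_subset (i : Fin m) : G.edgesAt i ⊆ G.A := Finset.filter_subset _ _

theorem edgesOff_subset (Nu : Finset (Fin m)) : G.edgesOff Nu ⊆ G.A := Finset.filter_subset _ _

theorem edgesAtOff_subset (Nu : Finset (Fin m)) (i : Fin m) : G.edgesAtOff Nu i ⊆ G.A :=
  (Finset.filter_subset _ _).trans (G.edgesAt_subset i)

/-- The factor `2` accounts for the two orientations of a pair. -/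
theorem card_filter_edgesAt_le (i : Fin m) (s : Finset (Fin m))
    (E : Finset (Fin m × Fin m)) (hE : ∀ e ∈ E, (e.1 = i ∧ e.2 ∈ s) ∨ (e.2 = i ∧ e.1 ∈ s)) :
    E.card ≤ 2 * s.card := by
  have h : E ⊆ s.image (fun j => (i, j)) ∪ s.image (fun j => (j, i)) := fun e he => by
    simp only [Finset.mem_union, Finset.mem_image]
    rcases hE e he with ⟨h1, h2⟩ | ⟨h1, h2⟩
    · exact Or.inl ⟨e.2, h2, by rw [← h1]⟩
    · exact Or.inr ⟨e.1, h2, by rw [← h1]⟩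
  refine (Finset.card_le_card h).trans ((Finset.card_union_le _ _).trans ?_)
  have h1 : (s.image (fun j => (i, j))).card ≤ s.card := Finset.card_image_le
  have h2 : (s.image (fun j => (j, i))).card ≤ s.card := Finset.card_image_le
  omega

theorem mem_nbr {i j : Fin m} : j ∈ G.nbr i ↔ (i, j) ∈ G.A ∨ (j, i) ∈ G.A := by simp [nbr]

theorem nbr_of_mem_edgesAt {i : Fin m} {e : Fin m × Fin m} (he : e ∈ G.edgesAt i) :
    (e.1 = i ∧ e.2 ∈ G.nbr i) ∨ (e.2 = i ∧ e.1 ∈ G.nbr i) := by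
  obtain ⟨h1, h2⟩ := Finset.mem_filter.1 he
  rcases h2 with rfl | rfl
  · exact Or.inl ⟨rfl, G.mem_nbr.2 (Or.inl h1)⟩
  · exact Or.inr ⟨rfl, G.mem_nbr.2 (Or.inr h1)⟩

theorem card_edgesAt_le (i : Fin m) : (G.edgesAt i).card ≤ 2 * G.deg i :=
  card_filter_edgesAt_le i _ _ fun _ he => G.nbr_of_mem_edgesAt he

theorem deg_le_card_edgesAt (i : Fin m) : G.deg i ≤ (G.edgesAt i).card := by
  have h : G.nbr i ⊆ (G.edgesAt i).image fun e => if e.1 = i then e.2 else e.1 := fun j hj => by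
    rw [Finset.mem_image]
    rcases G.mem_nbr.1 hj with h | h
    · exact ⟨(i, j), Finset.mem_filter.2 ⟨h, Or.inl rfl⟩, if_pos rfl⟩
    · refine ⟨(j, i), Finset.mem_filter.2 ⟨h, Or.inr rfl⟩, ?_⟩
      dsimp only
      split_ifs with h1
      exacts [h1.symm, rfl]
  exact (Finset.card_le_card h).trans Finset.card_image_le

theorem card_edgesAtOff_le {Nu : Finset (Fin m)} {i : Fin m} (hi : i ∈ Nu) {D : ℕ}
    (hD : ((G.nbr i).filter fun j => j ∉ Nu).card ≤ D) : (G.edgesAtOff Nu i).card ≤ 2 * D := by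
  refine (card_filter_edgesAt_le i _ _ fun e he => ?_).trans (Nat.mul_le_mul_left 2 hD)
  obtain ⟨h1, h2⟩ := Finset.mem_filter.1 he
  rcases G.nbr_of_mem_edgesAt h1 with ⟨h3, h4⟩ | ⟨h3, h4⟩
  · refine Or.inl ⟨h3, Finset.mem_filter.2 ⟨h4, ?_⟩⟩
    rw [h3] at h2
    tauto
  · refine Or.inr ⟨h3, Finset.mem_filter.2 ⟨h4, ?_⟩⟩
    rw [h3] at h2
    tauto

theorem card_edgesOff_le {Nu : Finset (Fin m)} {D : ℕ} (hD : ∀ i ∉ Nu, G.deg i ≤ D) :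
    (G.edgesOff Nu).card ≤ 2 * D * Nuᶜ.card := by
  have h : G.edgesOff Nu ⊆ Nuᶜ.biUnion G.edgesAt := fun e he => by
    obtain ⟨h1, h2⟩ := Finset.mem_filter.1 he
    rw [Finset.mem_biUnion]
    rcases h2 with h2 | h2
    · exact ⟨e.1, Finset.mem_compl.2 h2, Finset.mem_filter.2 ⟨h1, Or.inl rfl⟩⟩
    · exact ⟨e.2, Finset.mem_compl.2 h2, Finset.mem_filter.2 ⟨h1, Or.inr rfl⟩⟩
  refine (Finset.card_le_card h).trans (Finset.card_biUnion_le.trans ?_)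
  calc ∑ i ∈ Nuᶜ, (G.edgesAt i).card ≤ ∑ _i ∈ Nuᶜ, 2 * D :=
        Finset.sum_le_sum fun i hi => (G.card_edgesAt_le i).trans
          (Nat.mul_le_mul_left 2 (hD i (Finset.mem_compl.1 hi)))
    _ = _ := by rw [Finset.sum_const, smul_eq_mul, mul_comm]

end LabelledNetwork

/-! ### Uniform control of the intensities and of their difference quotients. -/

section Smooth

theorem IsCompact.exists_forall_dist_lt_of_equicontinuousOn {ι α β : Type*}
    [PseudoMetricSpace α] [PseudoMetricSpace β] {F : ι → α → β} {K : Set α} (hK : IsCompact K)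
    (hF : EquicontinuousOn F K) {ε : ℝ} (hε : 0 < ε) :
    ∃ ρ > 0, ∀ x ∈ K, ∀ y ∈ K, dist x y < ρ → ∀ i, dist (F i x) (F i y) < ε := by
  have : CompactSpace K := isCompact_iff_compactSpace.1 hK
  have h : UniformEquicontinuous (K.domRestrict ∘ F) :=
    CompactSpace.uniformEquicontinuous_of_equicontinuous
      (equicontinuous_restrict_iff F |>.2 hF)
  obtain ⟨ρ, hρ, h⟩ := Metric.uniformEquicontinuous_iff.1 h ε hε
  exact ⟨ρ, hρ, fun x hx y hy hxy i => h ⟨x, hx⟩ ⟨y, hy⟩ hxy i⟩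

variable {p : ℕ} {U : Set (Param p)} {M R : ℝ} {f : Param p → ℝ → EventStream → ℝ}
  {θs : Param p}

theorem IsBoundedSmooth.abs_sub_le (hf : IsBoundedSmooth U M f)
    (hR : Metric.closedBall θs R ⊆ U) {θ θ' : Param p} (hθ : θ ∈ Metric.closedBall θs R)
    (hθ' : θ' ∈ Metric.closedBall θs R) (t : ℝ) (h : EventStream) :
    |f θ t h - f θ' t h| ≤ M * ‖θ - θ'‖ := by
  refine (convex_closedBall θs R).norm_image_sub_le_of_norm_fderiv_le (𝕜 := ℝ)
    (f := fun θ => f θ t h) (fun x hx => hf.differentiable x (hR hx) t h) (fun x hx => ?_) hθ' hθ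
  have := hf.gradient_bound x (hR hx) t h
  rwa [gradient, LinearIsometryEquiv.norm_map] at this

theorem hasDerivAt_comp_line {F : Param p → ℝ} {θ v : Param p} {u : ℝ}
    (h : DifferentiableAt ℝ F (θ + u • v)) :
    HasDerivAt (fun s : ℝ => F (θ + s • v)) (inner ℝ (gradient F (θ + u • v)) v) u := by
  have h1 := h.hasGradientAt.hasFDerivAt
  have h2 : HasDerivAt (fun s : ℝ => θ + s • v) v u := by
    simpa using ((hasDerivAt_id u).smul_const v).const_add θ
  have h3 := h1.comp_hasDerivAt u h2
  exact h3

/-- Moving away from `θs` by at most the distance already reached at most doubles that distance.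
This is why the ball of radius `2 * R` has to lie in the parameter space. -/
theorem add_smul_sub_mem_closedBall {θ : Param p} {s : ℝ} (hθ : θ ∈ Metric.closedBall θs R)
    (hs0 : 0 ≤ s) (hs : s ≤ 1) : θ + s • (θ - θs) ∈ Metric.closedBall θs (2 * R) := by
  rw [mem_closedBall_iff_norm] at hθ ⊢
  calc ‖θ + s • (θ - θs) - θs‖ = ‖(1 + s) • (θ - θs)‖ := by congr 1; module
    _ = (1 + s) * ‖θ - θs‖ := by rw [norm_smul, Real.norm_of_nonneg (by linarith)]
    _ ≤ 2 * R := mul_le_mul (by linarith) hθ (norm_nonneg _) (by norm_num)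

/-- By the mean value theorem a difference quotient is a directional derivative at an intermediate
point, which lets the equicontinuity of the gradient act on it. -/
theorem IsBoundedSmooth.exists_slope_eq (hf : IsBoundedSmooth U M f)
    (hR : Metric.closedBall θs (2 * R) ⊆ U) {θ : Param p} (hθ : θ ∈ Metric.closedBall θs R)
    {s : ℝ} (hs0 : 0 < s) (hs : s ≤ 1) (t : ℝ) (h : EventStream) :
    ∃ u, 0 ≤ u ∧ u ≤ s ∧ (f (θ + s • (θ - θs)) t h - f θ t h) / s =
      inner ℝ (gradient (fun θ => f θ t h) (θ + u • (θ - θs))) (θ - θs) := by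
  have hd : ∀ u ∈ Set.Icc 0 s, HasDerivAt (fun u : ℝ => f (θ + u • (θ - θs)) t h)
      (inner ℝ (gradient (fun θ => f θ t h) (θ + u • (θ - θs))) (θ - θs)) u := fun u hu =>
    hasDerivAt_comp_line (F := fun θ => f θ t h)
      (hf.differentiable _ (hR (add_smul_sub_mem_closedBall hθ hu.1 (hu.2.trans hs))) t h)
  obtain ⟨u, hu, he⟩ := exists_hasDerivAt_eq_slope (fun u : ℝ => f (θ + u • (θ - θs)) t h)
    (fun u => inner ℝ (gradient (fun θ => f θ t h) (θ + u • (θ - θs))) (θ - θs)) hs0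
    (fun u hu => (hd u hu).continuousAt.continuousWithinAt)
    (fun u hu => hd u (Set.Ioo_subset_Icc_self hu))
  refine ⟨u, hu.1.le, hu.2.le, ?_⟩
  rw [he]
  simp

/-- Difference quotients in the direction of `θ - θs` depend on `θ` and on the step uniformly
continuously, uniformly in time and history. -/
theorem IsBoundedSmooth.exists_slope_sub_le (hf : IsBoundedSmooth U M f) (hM : 0 < M)
    (hR0 : 0 < R) (hR : Metric.closedBall θs (2 * R) ⊆ U) {ε : ℝ} (hε : 0 < ε) :
    ∃ ρ > 0, ∀ r, 0 < r → r ≤ ρ → ∀ θ ∈ Metric.closedBall θs R, ∀ θ' ∈ Metric.closedBall θs R,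
      ‖θ - θ'‖ ≤ r → ∀ s s', 0 < s → s ≤ r → 0 < s' → s' ≤ r → ∀ t h,
      |(f (θ + s • (θ - θs)) t h - f θ t h) / s -
        (f (θ' + s' • (θ' - θs)) t h - f θ' t h) / s'| ≤ ε := by
  obtain ⟨ρ, hρ, hρe⟩ := (isCompact_closedBall θs (2 * R)).exists_forall_dist_lt_of_equicontinuousOn
    (hf.gradient_continuous.mono hR) (ε := ε / (2 * R)) (by positivity)
  -- The entry `1` keeps the shifted points in the doubled ball, the second brings the two
  -- intermediate points within the modulus of the gradient, and the third bounds the effect of the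
  -- change of direction by `ε / 2`.
  refine ⟨min 1 (min (ρ / (2 * (1 + 2 * R))) (ε / (2 * M))), by positivity, ?_⟩
  intro r hr0 hr θ hθ θ' hθ' hθθ s s' hs0 hs hs'0 hs' t h
  have hr1 : r ≤ 1 := hr.trans (min_le_left _ _)
  have hr2 : r * (2 * (1 + 2 * R)) ≤ ρ := by
    rw [← le_div_iff₀ (by positivity)]
    exact hr.trans ((min_le_right _ _).trans (min_le_left _ _))
  have hr3 : r * (2 * M) ≤ ε := by
    rw [← le_div_iff₀ (by positivity)]
    exact hr.trans ((min_le_right _ _).trans (min_le_right _ _))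
  obtain ⟨u, hu0, hu, e⟩ := hf.exists_slope_eq hR hθ hs0 (hs.trans hr1) t h
  obtain ⟨u', hu'0, hu', e'⟩ := hf.exists_slope_eq hR hθ' hs'0 (hs'.trans hr1) t h
  rw [e, e']
  have hv : ‖θ - θs‖ ≤ R := mem_closedBall_iff_norm.1 hθ
  have hv' : ‖θ' - θs‖ ≤ R := mem_closedBall_iff_norm.1 hθ'
  have hx := add_smul_sub_mem_closedBall hθ hu0 ((hu.trans hs).trans hr1)
  have hx' := add_smul_sub_mem_closedBall hθ' hu'0 ((hu'.trans hs').trans hr1)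
  set x := θ + u • (θ - θs)
  set x' := θ' + u' • (θ' - θs)
  set g := gradient (fun θ => f θ t h) x
  set g' := gradient (fun θ => f θ t h) x'
  have hd : dist x x' < ρ := by
    rw [dist_eq_norm]
    calc ‖x - x'‖ = ‖(θ - θ') + u • (θ - θs) - u' • (θ' - θs)‖ := by
          congr 1
          simp only [x, x']
          abel
      _ ≤ ‖θ - θ'‖ + ‖u • (θ - θs)‖ + ‖u' • (θ' - θs)‖ :=
          (norm_sub_le _ _).trans (by gcongr; exact norm_add_le _ _)
      _ ≤ r + r * R + r * R := by
          rw [norm_smul, norm_smul, Real.norm_of_nonneg hu0, Real.norm_of_nonneg hu'0]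
          have := hu.trans hs
          have := hu'.trans hs'
          gcongr
      _ = r * (1 + 2 * R) := by ring
      _ < r * (2 * (1 + 2 * R)) := by
          have : 0 < r * (1 + 2 * R) := by positivity
          linarith
      _ ≤ ρ := hr2
  have hg : ‖g - g'‖ ≤ ε / (2 * R) := by
    rw [← dist_eq_norm]
    exact (hρe x hx x' hx' hd (t, h)).le
  have hg' : ‖g'‖ ≤ M := hf.gradient_bound x' (hR hx') t h
  calc |inner ℝ g (θ - θs) - inner ℝ g' (θ' - θs)|
      = |inner ℝ (g - g') (θ - θs) + inner ℝ g' (θ - θ')| := by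
        congr 1
        rw [show θ - θ' = (θ - θs) - (θ' - θs) by abel, inner_sub_left,
          inner_sub_right g' (θ - θs)]
        ring
    _ ≤ |inner ℝ (g - g') (θ - θs)| + |inner ℝ g' (θ - θ')| := abs_add_le _ _
    _ ≤ ‖g - g'‖ * ‖θ - θs‖ + ‖g'‖ * ‖θ - θ'‖ :=
        add_le_add (abs_real_inner_le_norm _ _) (abs_real_inner_le_norm _ _)
    _ ≤ ε / (2 * R) * R + M * r := by gcongr
    _ ≤ ε := by
        have : ε / (2 * R) * R = ε / 2 := by field_simp
        linarith

end Smooth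

/-- The number of events of `x` in the window plus the length of the window. -/
def windowWeight (x : EventStream) (a b : ℝ) : ℝ := (x.window a b).card + (b - a)

theorem windowWeight_nonneg (x : EventStream) {a b : ℝ} (hab : a ≤ b) : 0 ≤ windowWeight x a b := by
  unfold windowWeight
  have := sub_nonneg.2 hab
  positivity

/-! ### The log-likelihood of a single edge. -/

section Edge

variable {K p : ℕ} {B : BlockModel K p} {M R a b : ℝ} {k l : Fin K} {x : EventStream}

theorem CondBounded.intervalIntegrable_lam (hB : CondBounded B M) {θ : Param p}
    (hθ : θ ∈ B.paramSpace) :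
    IntervalIntegrable (fun t => B.lam k l θ t (x.before t)) volume a b := by
  refine (intervalIntegrable_const (c := M)).mono_fun ?_ (ae_of_all _ fun t => ?_)
  · exact ((measurable_uncurry_before (hB.measurable k l θ hθ)).comp
      measurable_prodMk_right).aestronglyMeasurable
  · exact ((hB.lam_smooth k l).bound θ hθ t _).trans (le_abs_self M)

/-- Pointwise bounds on a linear combination of intensities and of log-intensities carry over to
the log-likelihood of an edge. -/
theorem CondBounded.abs_sum_edgeLogLik_le (hB : CondBounded B M) (hab : a ≤ b) {ι : Type*}
    (s : Finset ι) (c : ι → ℝ) (θ : ι → Param p) (hθ : ∀ i ∈ s, θ i ∈ B.paramSpace) {H : ℝ}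
    (h1 : ∀ t h, |∑ i ∈ s, c i * B.lam k l (θ i) t h| ≤ H)
    (h2 : ∀ t h, |∑ i ∈ s, c i * Real.log (B.lam k l (θ i) t h)| ≤ H) :
    |∑ i ∈ s, c i * edgeLogLik B k l (θ i) a b x| ≤ H * windowWeight x a b := by
  have e : ∑ i ∈ s, c i * edgeLogLik B k l (θ i) a b x =
      ∑ t ∈ x.window a b, ∑ i ∈ s, c i * Real.log (B.lam k l (θ i) t (x.before t)) -
        ∫ t in a..b, ∑ i ∈ s, c i * B.lam k l (θ i) t (x.before t) := by
    rw [Finset.sum_comm, intervalIntegral.integral_finsetSum fun i hi =>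
      (hB.intervalIntegrable_lam (hθ i hi)).const_mul (c i), ← Finset.sum_sub_distrib]
    refine Finset.sum_congr rfl fun i _ => ?_
    rw [← Finset.mul_sum, intervalIntegral.integral_const_mul, edgeLogLik, mul_sub]
  have e1 : |∑ t ∈ x.window a b, ∑ i ∈ s, c i * Real.log (B.lam k l (θ i) t (x.before t))| ≤
      (x.window a b).card * H := by
    refine (Finset.abs_sum_le_sum_abs _ _).trans ?_
    rw [← nsmul_eq_mul]
    exact Finset.sum_le_card_nsmul _ _ _ fun t _ => h2 t _
  have e2 : |∫ t in a..b, ∑ i ∈ s, c i * B.lam k l (θ i) t (x.before t)| ≤ H * (b - a) := by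
    have := intervalIntegral.norm_integral_le_of_norm_le_const (a := a) (b := b) (C := H)
      (f := fun t => ∑ i ∈ s, c i * B.lam k l (θ i) t (x.before t)) fun t _ => h1 t _
    rwa [abs_of_nonneg (sub_nonneg.2 hab)] at this
  rw [e, windowWeight]
  refine (abs_sub _ _).trans ?_
  linarith

theorem CondBounded.abs_edgeLogLik_le (hB : CondBounded B M) (hab : a ≤ b) {θ : Param p}
    (hθ : θ ∈ B.paramSpace) : |edgeLogLik B k l θ a b x| ≤ M * windowWeight x a b := by
  simpa using hB.abs_sum_edgeLogLik_le (k := k) (l := l) (x := x) hab {()} (fun _ => 1)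
    (fun _ => θ) (fun _ _ => hθ) (H := M)
    (fun t h => by simpa using (hB.lam_smooth k l).bound θ hθ t h)
    (fun t h => by simpa using (hB.log_smooth k l).bound θ hθ t h)

theorem CondBounded.abs_edgeLogLik_sub_le (hB : CondBounded B M) (hab : a ≤ b)
    (hR : Metric.closedBall B.θs R ⊆ B.paramSpace) {θ θ' : Param p}
    (hθ : θ ∈ Metric.closedBall B.θs R) (hθ' : θ' ∈ Metric.closedBall B.θs R) :
    |edgeLogLik B k l θ a b x - edgeLogLik B k l θ' a b x| ≤
      M * ‖θ - θ'‖ * windowWeight x a b := by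
  have := hB.abs_sum_edgeLogLik_le (k := k) (l := l) (x := x) hab Finset.univ ![1, -1]
    ![θ, θ'] (by simpa using ⟨hR hθ, hR hθ'⟩) (H := M * ‖θ - θ'‖)
    (fun t h => by
      simpa [Fin.sum_univ_two, sub_eq_add_neg] using (hB.lam_smooth k l).abs_sub_le hR hθ hθ' t h)
    (fun t h => by
      simpa [Fin.sum_univ_two, sub_eq_add_neg] using (hB.log_smooth k l).abs_sub_le hR hθ hθ' t h)
  simpa [Fin.sum_univ_two, sub_eq_add_neg] using this

/-- The difference quotient of `F` at `θ`, in the direction of `θ - θs`. -/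
def slopeFrom (θs : Param p) (F : Param p → ℝ) (s : ℝ) (θ : Param p) : ℝ :=
  (F (θ + s • (θ - θs)) - F θ) / s

/-- Difference quotients avoid differentiating under sums and integrals of the data. One `ρ`, common
to the finitely many pairs of classes, serves both as mesh of the net and as largest step. The bound
`ρ ≤ ε` later controls the change of `‖θ - θs‖` between a point and its neighbour in the net. -/
theorem CondBounded.exists_slope_edgeLogLik_le (hB : CondBounded B M) (hM : 0 < M) (hR0 : 0 < R)
    (hR : Metric.closedBall B.θs (2 * R) ⊆ B.paramSpace) {ε : ℝ} (hε : 0 < ε) :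
    ∃ ρ > 0, ρ ≤ 1 ∧ ρ ≤ ε ∧ ∀ θ ∈ Metric.closedBall B.θs R, ∀ θ' ∈ Metric.closedBall B.θs R,
      ‖θ - θ'‖ ≤ ρ → ∀ s s', 0 < s → s ≤ ρ → 0 < s' → s' ≤ ρ → ∀ k l a b x, a ≤ b →
      |slopeFrom B.θs (fun θ => edgeLogLik B k l θ a b x) s θ -
        slopeFrom B.θs (fun θ => edgeLogLik B k l θ a b x) s' θ'| ≤ ε * windowWeight x a b := by
  have h1 := fun u : Fin K × Fin K =>
    (hB.lam_smooth u.1 u.2).exists_slope_sub_le hM hR0 hR hε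
  have h2 := fun u : Fin K × Fin K =>
    (hB.log_smooth u.1 u.2).exists_slope_sub_le hM hR0 hR hε
  choose ρ₁ hρ₁ h1 using h1
  choose ρ₂ hρ₂ h2 using h2
  obtain ⟨ρ, hρ, hle⟩ : ∃ ρ > 0, ∀ u, ρ ≤ ρ₁ u ∧ ρ ≤ ρ₂ u := by
    have : ∀ᶠ ρ in 𝓝[>] (0 : ℝ), ∀ u, ρ ≤ ρ₁ u ∧ ρ ≤ ρ₂ u :=
      eventually_all.2 fun u => nhdsWithin_le_nhds
        ((eventually_le_nhds (hρ₁ u)).and (eventually_le_nhds (hρ₂ u)))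
    obtain ⟨ρ, h3, h4⟩ := (this.and self_mem_nhdsWithin).exists
    exact ⟨ρ, h4, h3⟩
  refine ⟨min ρ (min 1 ε), by positivity, (min_le_right _ _).trans (min_le_left _ _),
    (min_le_right _ _).trans (min_le_right _ _), ?_⟩
  intro θ hθ θ' hθ' hθθ s s' hs0 hs hs'0 hs' k l a b x hab
  have hm : 0 < min ρ (min 1 ε) := by positivity
  have hm1 : min ρ (min 1 ε) ≤ 1 := (min_le_right _ _).trans (min_le_left _ _)
  have e1 := h1 (k, l) _ hm ((min_le_left _ _).trans (hle (k, l)).1) θ hθ θ' hθ' hθθ s s' hs0 hs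
    hs'0 hs'
  have e2 := h2 (k, l) _ hm ((min_le_left _ _).trans (hle (k, l)).2) θ hθ θ' hθ' hθθ s s' hs0 hs
    hs'0 hs'
  have hb : Metric.closedBall B.θs R ⊆ Metric.closedBall B.θs (2 * R) :=
    Metric.closedBall_subset_closedBall (by linarith)
  -- The difference of two quotients is one linear combination of four values, the form that passes
  -- from intensities to the likelihood.
  have expand : ∀ A A' C C' : ℝ, (A - A') / s - (C - C') / s' =
      ∑ i, ![1 / s, -(1 / s), -(1 / s'), 1 / s'] i * ![A, A', C, C'] i := fun A A' C C' => by
    simp [Fin.sum_univ_four]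
    ring
  have := hB.abs_sum_edgeLogLik_le (k := k) (l := l) (x := x) hab Finset.univ
    ![1 / s, -(1 / s), -(1 / s'), 1 / s']
    ![θ + s • (θ - B.θs), θ, θ' + s' • (θ' - B.θs), θ'] (H := ε) (fun i _ => by
      fin_cases i
      · exact hR (add_smul_sub_mem_closedBall hθ hs0.le (hs.trans hm1))
      · exact hR (hb hθ)
      · exact hR (add_smul_sub_mem_closedBall hθ' hs'0.le (hs'.trans hm1))
      · exact hR (hb hθ')) (fun t h => by
      have := e1 t h
      rw [expand] at this
      simpa [Fin.sum_univ_four] using this) (fun t h => by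
      have := e2 t h
      rw [expand] at this
      simpa [Fin.sum_univ_four] using this)
  simp only [slopeFrom]
  rw [expand]
  simpa [Fin.sum_univ_four] using this

end Edge

/-! ### The log-likelihood of a window and its dependence on labels and parameter. -/

section Window

variable {K p m : ℕ} (B : BlockModel K p) (G : LabelledNetwork K m)
  (x : Fin m × Fin m → EventStream) (n : ℕ)

/-- The log-likelihood of the edge `e` in the `n`-th window. -/
def edgeWindowLogLik (e : Fin m × Fin m) (θ : Param p) (z : Fin m → Fin K) : ℝ :=
  edgeLogLik B (z e.1) (z e.2) θ (((n : ℝ) - 1) * B.dT) ((n : ℝ) * B.dT) (x e)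

/-- The number of events on the edge `e` in the `n`-th window plus the length of the window. -/
def edgeWeight (e : Fin m × Fin m) : ℝ :=
  windowWeight (x e) (((n : ℝ) - 1) * B.dT) ((n : ℝ) * B.dT)

/-- The expected log-likelihood gained by changing the label of the node `i` from its true value
to `k`, the other labels having the distribution `q`. -/
def labelGain (q : Fin m → Fin K → ℝ) (θ : Param p) (i : Fin m) (k : Fin K) : ℝ :=
  meanOverOthers q i k (windowLogLik B G x n θ) -
    meanOverOthers q i (G.zs i) (windowLogLik B G x n θ)

variable {B} {M R : ℝ} {q : Fin m → Fin K → ℝ}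

theorem CondBounded.window_le (hB : CondBounded B M) :
    ((n : ℝ) - 1) * B.dT ≤ (n : ℝ) * B.dT := by nlinarith [hB.dT_pos]

theorem CondBounded.edgeWeight_nonneg (hB : CondBounded B M) (e : Fin m × Fin m) :
    0 ≤ edgeWeight B x n e := windowWeight_nonneg _ (hB.window_le n)

variable (B) in
-- Edges that do not touch `i` do not see its label and cancel.
theorem labelGain_eq_sum (hq : ∀ i, ∑ k, q i k = 1) (θ : Param p) (i : Fin m) (k : Fin K) :
    labelGain B G x n q θ i k = ∑ e ∈ G.edgesAt i, meanOver q fun z =>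
      edgeWindowLogLik B x n e θ (Function.update z i k) -
        edgeWindowLogLik B x n e θ (Function.update z i (G.zs i)) := by
  rw [labelGain, meanOverOthers_eq hq, meanOverOthers_eq hq, ← meanOver_sub, ← meanOver_sum]
  congr 1
  funext z
  simp only [windowLogLik, LabelledNetwork.edgesAt]
  rw [← Finset.sum_sub_distrib, Finset.sum_filter_of_ne]
  · rfl
  · intro e _ hne
    contrapose! hne
    simp only [edgeWindowLogLik]
    rw [Function.update_of_ne hne.1, Function.update_of_ne hne.2, Function.update_of_ne hne.1,
      Function.update_of_ne hne.2, sub_self]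

/-- The current parameter is random; this replaces it by `θs` at a cost proportional to the radius.
The factor `2` comes from the two labels compared. -/
theorem CondBounded.abs_labelGain_sub_le (hB : CondBounded B M) (hM : 0 ≤ M)
    (hR : Metric.closedBall B.θs R ⊆ B.paramSpace) (hq : IsProductDist q) {θ : Param p}
    (hθ : θ ∈ Metric.closedBall B.θs R) (i : Fin m) (k : Fin K) :
    |labelGain B G x n q θ i k - labelGain B G x n q B.θs i k| ≤
      2 * M * R * ∑ e ∈ G.edgesAt i, edgeWeight B x n e := by
  have hq1 : ∀ i, ∑ k, q i k = 1 := fun i => (hq i).2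
  have hd : ‖θ - B.θs‖ ≤ R := mem_closedBall_iff_norm.1 hθ
  have hs : B.θs ∈ Metric.closedBall B.θs R :=
    Metric.mem_closedBall_self ((norm_nonneg _).trans hd)
  rw [labelGain_eq_sum B G x n hq1, labelGain_eq_sum B G x n hq1, ← Finset.sum_sub_distrib,
    Finset.mul_sum]
  refine (Finset.abs_sum_le_sum_abs _ _).trans (Finset.sum_le_sum fun e _ => ?_)
  rw [← meanOver_sub, ← meanOver_const hq1 (2 * M * R * edgeWeight B x n e)]
  refine abs_meanOver_le (fun i k => (hq i).1 k) fun z => ?_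
  have hw := hB.edgeWeight_nonneg x n e
  have h : ∀ z, |edgeWindowLogLik B x n e θ z - edgeWindowLogLik B x n e B.θs z| ≤
      M * R * edgeWeight B x n e := fun z =>
    (hB.abs_edgeLogLik_sub_le (hB.window_le n) hR hθ hs).trans
      (mul_le_mul_of_nonneg_right (mul_le_mul_of_nonneg_left hd hM) hw)
  have h1 := abs_le.1 (h (Function.update z i k))
  have h2 := abs_le.1 (h (Function.update z i (G.zs i)))
  rw [abs_le]
  constructor <;> linarith

/-- The error of replacing the label distribution `q` by the true labels in a sum over edges. -/
theorem abs_sum_meanOver_sub_le (hq : IsProductDist q) {Nu : Finset (Fin m)} {ξ H : ℝ}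
    (hH : 0 ≤ H) (hξ0 : 0 ≤ ξ) (hξ : ∀ j ∈ Nu, 1 - q j (G.zs j) ≤ ξ) (E : Finset (Fin m × Fin m))
    {w : Fin m × Fin m → ℝ} (hw : ∀ e, 0 ≤ w e) (h : Fin m × Fin m → (Fin m → Fin K) → ℝ)
    (hb : ∀ e z, |h e z| ≤ H * w e)
    (hloc : ∀ e z, z e.1 = G.zs e.1 → z e.2 = G.zs e.2 → h e z = h e G.zs) :
    |∑ e ∈ E, meanOver q (h e) - ∑ e ∈ E, h e G.zs| ≤
      4 * H * (ξ * ∑ e ∈ E, w e + ∑ e ∈ E.filter (fun e => e.1 ∉ Nu ∨ e.2 ∉ Nu), w e) := by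
  have hq1 : ∀ i, 0 ≤ q i (G.zs i) := fun i => (hq i).1 _
  rw [← Finset.sum_sub_distrib, Finset.sum_filter, Finset.mul_sum, ← Finset.sum_add_distrib,
    Finset.mul_sum]
  refine (Finset.abs_sum_le_sum_abs _ _).trans (Finset.sum_le_sum fun e _ => ?_)
  have hHw : 0 ≤ H * w e := mul_nonneg hH (hw e)
  -- The two values differ by at most `2 * (H * w e)`, and not at all unless an end of the edge is
  -- mislabelled.
  have h1 := abs_meanOver_sub_le (g := h e) hq G.zs e.1 e.2 (H := 2 * (H * w e)) fun z => by
    have hz : |h e z - h e G.zs| ≤ 2 * (H * w e) :=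
      (abs_sub _ _).trans (by linarith [hb e z, hb e G.zs])
    by_cases e1 : z e.1 = G.zs e.1 <;> by_cases e2 : z e.2 = G.zs e.2
    · rw [hloc e z e1 e2]
      simp [e1, e2]
    all_goals simp only [e1, e2, if_true, if_false]; linarith
  refine h1.trans ?_
  -- An end outside `Nu` forces the trivial bound `1` on both error probabilities. Otherwise both
  -- are at most `ξ`.
  split_ifs with he
  · have : 0 ≤ ξ * (H * w e) := mul_nonneg hξ0 hHw
    nlinarith [hq1 e.1, hq1 e.2]
  · push Not at he
    nlinarith [hξ _ he.1, hξ _ he.2]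

/-- Passing to the point mass at the true labels removes the dependence of `q` on earlier data.
Labels outside `Nu` may be arbitrary, at the price of the weight of their edges. -/
theorem CondBounded.abs_labelGain_sub_single_le (hB : CondBounded B M) (hM : 0 ≤ M)
    (hq : IsProductDist q) {Nu : Finset (Fin m)} {ξ : ℝ}
    (hξ0 : 0 ≤ ξ) (hξ : ∀ j ∈ Nu, 1 - q j (G.zs j) ≤ ξ) (i : Fin m) (k : Fin K) :
    |labelGain B G x n q B.θs i k -
        labelGain B G x n (fun i => Pi.single (G.zs i) 1) B.θs i k| ≤
      8 * M * (ξ * ∑ e ∈ G.edgesAt i, edgeWeight B x n e +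
        ∑ e ∈ G.edgesAtOff Nu i, edgeWeight B x n e) := by
  have h1 := abs_sum_meanOver_sub_le G hq (H := 2 * M) (by positivity) hξ0 hξ (G.edgesAt i)
    (hB.edgeWeight_nonneg x n)
    (fun e z => edgeWindowLogLik B x n e B.θs (Function.update z i k) -
        edgeWindowLogLik B x n e B.θs (Function.update z i (G.zs i)))
    (fun e z => ?_) (fun e z h1 h2 => ?_)
  · rw [labelGain_eq_sum B G x n fun i => (hq i).2,
      labelGain_eq_sum B G x n fun i => (isProductDist_single G.zs i).2]
    simp only [meanOver_single]
    refine h1.trans_eq ?_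
    rw [LabelledNetwork.edgesAtOff]
    ring
  · have h : ∀ z, |edgeWindowLogLik B x n e B.θs z| ≤ M * edgeWeight B x n e := fun z =>
      hB.abs_edgeLogLik_le (hB.window_le n) hB.true_mem
    refine (abs_sub _ _).trans ?_
    linarith [h (Function.update z i k), h (Function.update z i (G.zs i))]
  · have h : ∀ j l, z j = G.zs j → Function.update z i l j = Function.update G.zs i l j :=
      fun j l hj => by
        by_cases hji : j = i
        · subst hji; simp
        · simp [hji, hj]
    simp only [edgeWindowLogLik]
    rw [h _ _ h1, h _ _ h1, h _ _ h2, h _ _ h2]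

theorem windowLogLik_eq_sum (θ : Param p) (z : Fin m → Fin K) :
    windowLogLik B G x n θ z = ∑ e ∈ G.A, edgeWindowLogLik B x n e θ z := rfl

theorem slopeFrom_sum {ι : Type*} (s : Finset ι) (θs : Param p) (F : ι → Param p → ℝ) (r : ℝ)
    (θ : Param p) :
    slopeFrom θs (fun θ => ∑ e ∈ s, F e θ) r θ = ∑ e ∈ s, slopeFrom θs (F e) r θ := by
  simp only [slopeFrom]
  rw [← Finset.sum_sub_distrib, Finset.sum_div]

theorem slopeFrom_meanOver (θs : Param p) (F : Param p → (Fin m → Fin K) → ℝ) (r : ℝ)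
    (θ : Param p) :
    slopeFrom θs (fun θ => meanOver q (F θ)) r θ =
      meanOver q fun z => slopeFrom θs (fun θ => F θ z) r θ := by
  simp only [slopeFrom]
  rw [← meanOver_sub, div_eq_inv_mul, ← meanOver_const_mul]
  simp only [div_eq_inv_mul]

/-- The displacement has length at most `s * R`, so the bound does not depend on the step. -/
theorem CondBounded.abs_slope_edge_le (hB : CondBounded B M) (hM : 0 ≤ M)
    (hR : Metric.closedBall B.θs (2 * R) ⊆ B.paramSpace) {θ : Param p}
    (hθ : θ ∈ Metric.closedBall B.θs R) {s : ℝ} (hs0 : 0 < s) (hs : s ≤ 1)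
    (e : Fin m × Fin m) (z : Fin m → Fin K) :
    |slopeFrom B.θs (fun θ => edgeWindowLogLik B x n e θ z) s θ| ≤ M * R * edgeWeight B x n e := by
  have hd : ‖θ - B.θs‖ ≤ R := mem_closedBall_iff_norm.1 hθ
  have hR0 : 0 ≤ R := (norm_nonneg _).trans hd
  have hw := hB.edgeWeight_nonneg x n e
  have h := hB.abs_edgeLogLik_sub_le (k := z e.1) (l := z e.2) (x := x e) (hB.window_le n) hR
    (add_smul_sub_mem_closedBall hθ hs0.le hs)
    (Metric.closedBall_subset_closedBall (by linarith) hθ)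
  rw [slopeFrom, abs_div, abs_of_pos hs0, div_le_iff₀ hs0]
  refine h.trans ?_
  rw [add_sub_cancel_left, norm_smul, Real.norm_of_nonneg hs0.le]
  change M * (s * ‖θ - B.θs‖) * edgeWeight B x n e ≤ _
  have : M * (s * ‖θ - B.θs‖) * edgeWeight B x n e ≤ M * (s * R) * edgeWeight B x n e := by gcongr
  linarith

/-- In the gradient step `q` already depends on the events of the same window, so the comparison has
to be pathwise and uniform over all nearby `q`. -/
theorem CondBounded.abs_slope_meanOver_sub_le (hB : CondBounded B M) (hM : 0 ≤ M)
    (hR : Metric.closedBall B.θs (2 * R) ⊆ B.paramSpace) (hq : IsProductDist q)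
    {Nu : Finset (Fin m)} {ξ : ℝ} (hξ0 : 0 ≤ ξ) (hξ : ∀ j ∈ Nu, 1 - q j (G.zs j) ≤ ξ)
    {θ : Param p} (hθ : θ ∈ Metric.closedBall B.θs R) {s : ℝ} (hs0 : 0 < s) (hs : s ≤ 1) :
    |slopeFrom B.θs (fun θ => meanOver q (windowLogLik B G x n θ)) s θ -
        slopeFrom B.θs (fun θ => windowLogLik B G x n θ G.zs) s θ| ≤
      4 * M * R * (ξ * ∑ e ∈ G.A, edgeWeight B x n e +
        ∑ e ∈ G.edgesOff Nu, edgeWeight B x n e) := by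
  have hR0 : 0 ≤ R := (norm_nonneg _).trans (mem_closedBall_iff_norm.1 hθ)
  have h1 := abs_sum_meanOver_sub_le G hq (H := M * R) (by positivity) hξ0 hξ G.A
    (hB.edgeWeight_nonneg x n)
    (fun e z => slopeFrom B.θs (fun θ => edgeWindowLogLik B x n e θ z) s θ)
    (fun e z => hB.abs_slope_edge_le x n hM hR hθ hs0 hs e z)
    (fun e z h1 h2 => by simp only [edgeWindowLogLik, h1, h2])
  rw [slopeFrom_meanOver]
  simp only [windowLogLik_eq_sum, slopeFrom_sum]
  rw [meanOver_sum]
  refine h1.trans_eq ?_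
  rw [LabelledNetwork.edgesOff]
  ring

/-- A local Lipschitz bound controls the gradient without any differentiability of the sample
likelihood. -/
theorem CondBounded.norm_gradient_meanOver_le (hB : CondBounded B M) (hM : 0 ≤ M) (hR0 : 0 < R)
    (hR : Metric.closedBall B.θs (2 * R) ⊆ B.paramSpace) (hq : IsProductDist q)
    {θ : Param p} (hθ : θ ∈ Metric.closedBall B.θs R) :
    ‖gradient (fun θ => meanOver q (windowLogLik B G x n θ)) θ‖ ≤
      M * ∑ e ∈ G.A, edgeWeight B x n e := by
  have hq1 : ∀ i, ∑ k, q i k = 1 := fun i => (hq i).2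
  rw [gradient, LinearIsometryEquiv.norm_map]
  refine norm_fderiv_le_of_lip' ℝ (mul_nonneg hM (Finset.sum_nonneg fun e _ =>
    hB.edgeWeight_nonneg x n e)) ?_
  have hnhds : Metric.closedBall B.θs (2 * R) ∈ 𝓝 θ :=
    Metric.closedBall_mem_nhds_of_mem (Metric.closedBall_subset_ball (by linarith) hθ)
  have hθ2 : θ ∈ Metric.closedBall B.θs (2 * R) := mem_of_mem_nhds hnhds
  filter_upwards [hnhds] with θ' hθ'
  rw [Real.norm_eq_abs, ← meanOver_sub, ← meanOver_const hq1 (_ * ‖θ' - θ‖)]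
  refine abs_meanOver_le (fun i k => (hq i).1 k) fun z => ?_
  rw [windowLogLik_eq_sum, windowLogLik_eq_sum, ← Finset.sum_sub_distrib, mul_assoc,
    Finset.sum_mul, Finset.mul_sum]
  refine (Finset.abs_sum_le_sum_abs _ _).trans (Finset.sum_le_sum fun e _ => ?_)
  refine (hB.abs_edgeLogLik_sub_le (hB.window_le n) hR hθ' hθ2).trans_eq ?_
  rw [edgeWeight]
  ring

theorem CondBounded.abs_slope_sub_le (hB : CondBounded B M) {ε : ℝ} {θ θ' : Param p} {s s' : ℝ}
    (h : ∀ k l a b x, a ≤ b → |slopeFrom B.θs (fun θ => edgeLogLik B k l θ a b x) s θ -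
        slopeFrom B.θs (fun θ => edgeLogLik B k l θ a b x) s' θ'| ≤ ε * windowWeight x a b)
    (z : Fin m → Fin K) :
    |slopeFrom B.θs (fun θ => windowLogLik B G x n θ z) s θ -
        slopeFrom B.θs (fun θ => windowLogLik B G x n θ z) s' θ'| ≤
      ε * ∑ e ∈ G.A, edgeWeight B x n e := by
  simp only [windowLogLik_eq_sum, slopeFrom_sum]
  rw [← Finset.sum_sub_distrib, Finset.mul_sum]
  exact (Finset.abs_sum_le_sum_abs _ _).trans
    (Finset.sum_le_sum fun e _ => h _ _ _ _ _ (hB.window_le n))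

end Window

/-- A difference quotient bound passes to the directional derivative; the gradient of a function
that is not differentiable is zero by convention. -/
theorem inner_gradient_le_or_gradient_eq_zero {p : ℕ} {θs θ : Param p} {F : Param p → ℝ} {H ρ : ℝ}
    (hρ : 0 < ρ) (h : ∀ s, 0 < s → s ≤ ρ → slopeFrom θs F s θ ≤ H) :
    inner ℝ (gradient F θ) (θ - θs) ≤ H ∨ gradient F θ = 0 := by
  by_cases hd : DifferentiableAt ℝ F θ
  · left
    have h1 : HasDerivAt (fun s : ℝ => F (θ + s • (θ - θs)))
        (inner ℝ (gradient F θ) (θ - θs)) 0 := by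
      have := hasDerivAt_comp_line (F := F) (θ := θ) (v := θ - θs) (u := 0) (by simpa using hd)
      simpa using this
    have h2 := h1.tendsto_slope_zero_right
    refine le_of_tendsto h2 ?_
    filter_upwards [Ioc_mem_nhdsGT hρ] with s hs
    refine le_trans (le_of_eq ?_) (h s hs.1 hs.2)
    simp [slopeFrom, div_eq_inv_mul]
  · right
    simp [gradient, fderiv_zero_of_not_differentiableAt hd]

/-- The squared distance becomes at most `(1 - 2 * c * η) * R ^ 2` plus two errors of `η * c * R ^ 2
/ 2`, one from the slack in the inner product and one from the squared step. -/
theorem norm_add_smul_sub_le {E : Type*} [NormedAddCommGroup E] [InnerProductSpace ℝ E]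
    {θ θs g : E} {R c H η : ℝ} (hR : ‖θ - θs‖ ≤ R) (hR0 : 0 ≤ R) (hη : 0 ≤ η)
    (hg : ‖g‖ ≤ H) (hη1 : 2 * c * η ≤ 1) (hη2 : η * H ^ 2 ≤ c * R ^ 2 / 2)
    (hin : inner ℝ g (θ - θs) ≤ -c * ‖θ - θs‖ ^ 2 + c * R ^ 2 / 4) :
    ‖θ + η • g - θs‖ ≤ R := by
  have e : θ + η • g - θs = (θ - θs) + η • g := by abel
  rw [e, ← sq_le_sq₀ (norm_nonneg _) hR0, norm_add_sq_real, inner_smul_right, real_inner_comm,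
    norm_smul, Real.norm_of_nonneg hη, mul_pow]
  have h1 : ‖g‖ ^ 2 ≤ H ^ 2 := by gcongr
  have h2 : ‖θ - θs‖ ^ 2 ≤ R ^ 2 := by gcongr
  have h3 : η * (η * ‖g‖ ^ 2) ≤ η * (c * R ^ 2 / 2) := by
    have : η * ‖g‖ ^ 2 ≤ η * H ^ 2 := by gcongr
    gcongr
    linarith
  have h4 : η * inner ℝ g (θ - θs) ≤ η * (-c * ‖θ - θs‖ ^ 2 + c * R ^ 2 / 4) := by gcongr
  have h5 : (1 - 2 * c * η) * ‖θ - θs‖ ^ 2 ≤ (1 - 2 * c * η) * R ^ 2 :=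
    mul_le_mul_of_nonneg_left h2 (by linarith)
  nlinarith [sq_nonneg ‖θ - θs‖, mul_nonneg hη (sq_nonneg R)]

/-! ### One step of the algorithm on a good window. -/

section Deterministic

variable {K p m : ℕ}

/-- The event on which the `n`-th window behaves as in the mean: the edge weights are bounded on
average and small on the edges with an end outside `Nu`, the evidence for the true labels is
large under `q0` and under the true labels, and at the points of `T` the likelihood has a slope
towards the true parameter. -/
structure GoodWindow (B : BlockModel K p) (G : LabelledNetwork K m) (Nu : Finset (Fin m))
    (c W ε ρ τ : ℝ) (T : Set (Param p)) (q0 : Fin m → Fin K → ℝ)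
    (x : Fin m × Fin m → EventStream) (n : ℕ) : Prop where
  weight_at : ∀ i ∈ Nu, ∑ e ∈ G.edgesAt i, edgeWeight B x n e ≤ W * G.deg i
  weight_atOff : ∀ i ∈ Nu, ∑ e ∈ G.edgesAtOff Nu i, edgeWeight B x n e ≤ ε * G.deg i
  weight : ∑ e ∈ G.A, edgeWeight B x n e ≤ W * G.A.card
  weight_off : ∑ e ∈ G.edgesOff Nu, edgeWeight B x n e ≤ ε * G.A.card
  gain_init : ∀ i ∈ Nu, ∀ k ≠ G.zs i, labelGain B G x n q0 B.θs i k ≤ -(c / 2) * G.deg i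
  gain_true : ∀ i ∈ Nu, ∀ k ≠ G.zs i,
    labelGain B G x n (fun i => Pi.single (G.zs i) 1) B.θs i k ≤ -(c / 2) * G.deg i
  slope : ∀ θ ∈ T, slopeFrom B.θs (fun θ => windowLogLik B G x n θ G.zs) ρ θ ≤
    (-c * ‖θ - B.θs‖ ^ 2 + τ) * G.A.card

variable {B : BlockModel K p} {G : LabelledNetwork K m} {Nu : Finset (Fin m)}
  {c W ε ρ τ M R ξ : ℝ} {T : Set (Param p)} {q0 q : Fin m → Fin K → ℝ}
  {x : Fin m × Fin m → EventStream} {n : ℕ}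

/-- The reference distributions give `-c / 2`. Moving `θ` costs `c / 8`, moving `q` another `c / 8`,
and `-c / 4` remains. In the first window `q = q0` need not be near the truth and no move of `q` is
needed. -/
theorem GoodWindow.labelGain_le (hg : GoodWindow B G Nu c W ε ρ τ T q0 x n)
    (hB : CondBounded B M) (hM : 0 ≤ M) (hR0 : 0 ≤ R)
    (hR : Metric.closedBall B.θs R ⊆ B.paramSpace)
    (hq : IsProductDist q) (hξ0 : 0 ≤ ξ) (hξ : q = q0 ∨ ∀ j ∈ Nu, 1 - q j (G.zs j) ≤ ξ)
    (hRc : 2 * M * R * W ≤ c / 8) (hεc : 8 * M * (ξ * W + ε) ≤ c / 8)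
    (hc : 0 ≤ c) {θ : Param p} (hθ : θ ∈ Metric.closedBall B.θs R) {i : Fin m} (hi : i ∈ Nu)
    {k : Fin K} (hk : k ≠ G.zs i) :
    labelGain B G x n q θ i k ≤ -(c / 4) * G.deg i := by
  have hd : (0 : ℝ) ≤ G.deg i := by positivity
  have h1 := (abs_le.1 (hB.abs_labelGain_sub_le G x n hM hR hq hθ i k)).2
  have h2 : 2 * M * R * ∑ e ∈ G.edgesAt i, edgeWeight B x n e ≤ c / 8 * G.deg i := by
    calc _ ≤ 2 * M * R * (W * G.deg i) :=
          mul_le_mul_of_nonneg_left (hg.weight_at i hi) (by positivity)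
      _ = 2 * M * R * W * G.deg i := by ring
      _ ≤ _ := by gcongr
  have h3 : labelGain B G x n q B.θs i k ≤ -(c / 2) * G.deg i + c / 8 * G.deg i := by
    rcases hξ with rfl | hξ
    · have := hg.gain_init i hi k hk
      have : 0 ≤ c / 8 * G.deg i := by positivity
      linarith
    · have h4 := (abs_le.1 (hB.abs_labelGain_sub_single_le G x n hM hq hξ0 hξ i k)).2
      have h5 : 8 * M * (ξ * ∑ e ∈ G.edgesAt i, edgeWeight B x n e +
          ∑ e ∈ G.edgesAtOff Nu i, edgeWeight B x n e) ≤ c / 8 * G.deg i := by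
        calc _ ≤ 8 * M * (ξ * (W * G.deg i) + ε * G.deg i) := by
              gcongr
              · exact hg.weight_at i hi
              · exact hg.weight_atOff i hi
          _ = 8 * M * (ξ * W + ε) * G.deg i := by ring
          _ ≤ _ := by gcongr
      linarith [hg.gain_true i hi k hk]
  linarith

/-- The slope at `θ` under `q` is compared with the slope under the true labels, then with the slope
of step `ρ` at a neighbour `θ'` in `T`. Returning from `‖θ' - θs‖ ^ 2` to `‖θ - θs‖ ^ 2` costs the
term with `2 * c * R * ε₁`. The total error is at most `c * R ^ 2 / 4`. -/
theorem GoodWindow.norm_step_le (hg : GoodWindow B G Nu c W ε ρ τ T q0 x n)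
    (hB : CondBounded B M) (hM : 0 ≤ M) (hR0 : 0 < R)
    (hR : Metric.closedBall B.θs (2 * R) ⊆ B.paramSpace)
    (hT : ∀ θ ∈ Metric.closedBall B.θs R, ∃ θ' ∈ T, θ' ∈ Metric.closedBall B.θs R ∧ ‖θ - θ'‖ ≤ ρ)
    {ε₁ : ℝ} (hρ0 : 0 < ρ) (hρ1 : ρ ≤ 1) (hρε : ρ ≤ ε₁)
    (hsl : ∀ θ ∈ Metric.closedBall B.θs R, ∀ θ' ∈ Metric.closedBall B.θs R,
      ‖θ - θ'‖ ≤ ρ → ∀ s s', 0 < s → s ≤ ρ → 0 < s' → s' ≤ ρ → ∀ k l a b x, a ≤ b →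
      |slopeFrom B.θs (fun θ => edgeLogLik B k l θ a b x) s θ -
        slopeFrom B.θs (fun θ => edgeLogLik B k l θ a b x) s' θ'| ≤ ε₁ * windowWeight x a b)
    (hA : 0 < G.A.card) (hq : IsProductDist q) (hξ0 : 0 ≤ ξ)
    (hξ : ∀ j ∈ Nu, 1 - q j (G.zs j) ≤ ξ) (hc : 0 ≤ c)
    (hsmall : τ + ε₁ * W + 2 * c * R * ε₁ + 4 * M * R * (ξ * W + ε) ≤ c * R ^ 2 / 4)
    {η : ℝ} (hη0 : 0 ≤ η) (hη1 : 2 * c * η ≤ 1) (hη2 : η * (M * W) ^ 2 ≤ c * R ^ 2 / 2)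
    {θ : Param p} (hθ : θ ∈ Metric.closedBall B.θs R) :
    θ + η • ((1 / (G.A.card : ℝ)) •
      gradient (fun θ => meanOver q (windowLogLik B G x n θ)) θ) ∈ Metric.closedBall B.θs R := by
  have hA' : (0 : ℝ) < G.A.card := by exact_mod_cast hA
  have hε₁ : 0 ≤ ε₁ := hρ0.le.trans hρε
  obtain ⟨θ', hθ'T, hθ', hθθ⟩ := hT θ hθ
  have hv : ‖θ - B.θs‖ ≤ R := mem_closedBall_iff_norm.1 hθ
  have hv' : ‖θ' - B.θs‖ ≤ R := mem_closedBall_iff_norm.1 hθ'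
  have hvv : ‖θ - B.θs‖ ≤ ‖θ' - B.θs‖ + ε₁ := by
    calc ‖θ - B.θs‖ = ‖(θ' - B.θs) + (θ - θ')‖ := by congr 1; abel
      _ ≤ _ := (norm_add_le _ _).trans (by linarith)
  have hsq : ‖θ - B.θs‖ ^ 2 - ‖θ' - B.θs‖ ^ 2 ≤ 2 * R * ε₁ := by
    have h1 : (‖θ - B.θs‖ - ‖θ' - B.θs‖) * (‖θ - B.θs‖ + ‖θ' - B.θs‖) ≤
        ε₁ * (‖θ - B.θs‖ + ‖θ' - B.θs‖) :=
      mul_le_mul_of_nonneg_right (by linarith) (by positivity)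
    have h2 : ε₁ * (‖θ - B.θs‖ + ‖θ' - B.θs‖) ≤ ε₁ * (R + R) := by gcongr
    nlinarith
  have hsum : ξ * ∑ e ∈ G.A, edgeWeight B x n e + ∑ e ∈ G.edgesOff Nu, edgeWeight B x n e ≤
      (ξ * W + ε) * G.A.card := by
    have := mul_le_mul_of_nonneg_left hg.weight hξ0
    linarith [hg.weight_off]
  have hslope : ∀ s, 0 < s → s ≤ ρ →
      slopeFrom B.θs (fun θ => meanOver q (windowLogLik B G x n θ)) s θ ≤
        (-c * ‖θ - B.θs‖ ^ 2 + c * R ^ 2 / 4) * G.A.card := fun s hs0 hs => by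
    have h1 := (abs_le.1 (hB.abs_slope_meanOver_sub_le G x n hM hR hq hξ0 hξ hθ hs0
      (hs.trans hρ1))).2
    have h2 := (abs_le.1 (hB.abs_slope_sub_le G x n
      (hsl θ hθ θ' hθ' hθθ s ρ hs0 hs hρ0 le_rfl) G.zs)).2
    have h3 := hg.slope θ' hθ'T
    have h4 := mul_le_mul_of_nonneg_left hsum (show 0 ≤ 4 * M * R by positivity)
    have h5 := mul_le_mul_of_nonneg_left hg.weight hε₁
    have h6 : (-c * ‖θ' - B.θs‖ ^ 2 + τ + ε₁ * W + 4 * M * R * (ξ * W + ε)) * G.A.card ≤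
        (-c * ‖θ - B.θs‖ ^ 2 + c * R ^ 2 / 4) * G.A.card := by
      refine mul_le_mul_of_nonneg_right ?_ hA'.le
      have := mul_le_mul_of_nonneg_left hsq hc
      linarith
    linarith
  rcases inner_gradient_le_or_gradient_eq_zero hρ0 hslope with h | h
  · rw [mem_closedBall_iff_norm]
    refine norm_add_smul_sub_le (c := c) (H := M * W) hv hR0.le hη0 ?_ hη1 hη2 ?_
    · rw [norm_smul, Real.norm_of_nonneg (by positivity), one_div, inv_mul_le_iff₀ hA']
      refine (hB.norm_gradient_meanOver_le G x n hM hR0 hR hq hθ).trans ?_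
      have := mul_le_mul_of_nonneg_left hg.weight hM
      linarith
    · rw [inner_smul_left, one_div]
      simp only [map_inv₀, conj_trivial]
      rw [inv_mul_le_iff₀ hA']
      linarith
  -- With gradient zero the step leaves `θ` where it is.
  · rwa [h, smul_zero, smul_zero, add_zero]

/-- The updated label distribution of one node. -/
theorem normalize_mem_stdSimplex {π S : Fin K → ℝ} (hπ : π ∈ stdSimplex ℝ (Fin K))
    (hS : ∀ k, 0 < S k) : (fun k => π k * S k / ∑ l, π l * S l) ∈ stdSimplex ℝ (Fin K) := by
  have h0 : ∀ k, 0 ≤ π k * S k := fun k => mul_nonneg (hπ.1 k) (hS k).le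
  have hpos : 0 < ∑ l, π l * S l := by
    refine lt_of_le_of_ne (Finset.sum_nonneg fun k _ => h0 k) fun h => ?_
    have h1 := (Finset.sum_eq_zero_iff_of_nonneg fun k _ => h0 k).1 h.symm
    have h2 : ∑ k, π k = 0 := Finset.sum_eq_zero fun k hk =>
      (mul_eq_zero.1 (h1 k hk)).resolve_right (hS k).ne'
    rw [hπ.2] at h2
    exact one_ne_zero h2
  refine ⟨fun k => div_nonneg (h0 k) hpos.le, ?_⟩
  rw [← Finset.sum_div, div_self hpos.ne']

/-- The normalizing sum is at least `κ * S z`, so each of the fewer than `K` wrong classes has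
weight at most `r / κ`. -/
theorem one_sub_normalize_le {π S : Fin K → ℝ} (hπ : π ∈ stdSimplex ℝ (Fin K))
    (hS : ∀ k, 0 < S k) {z : Fin K} {κ r : ℝ} (hκ : 0 < κ) (hκz : κ ≤ π z) (hr : 0 ≤ r)
    (hSz : ∀ k ≠ z, S k ≤ S z * r) :
    1 - π z * S z / ∑ l, π l * S l ≤ K * (r / κ) := by
  have hq := normalize_mem_stdSimplex hπ hS
  have h0 : ∀ k, 0 ≤ π k * S k := fun k => mul_nonneg (hπ.1 k) (hS k).le
  have hz : κ * S z ≤ ∑ l, π l * S l :=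
    (mul_le_mul_of_nonneg_right hκz (hS z).le).trans
      (Finset.single_le_sum (f := fun k => π k * S k) (fun k _ => h0 k) (Finset.mem_univ z))
  have hκS : 0 < κ * S z := mul_pos hκ (hS z)
  have hle : ∀ k ∈ Finset.univ.erase z, π k * S k / ∑ l, π l * S l ≤ r / κ := fun k hk => by
    have h1 : π k ≤ 1 := by
      rw [← hπ.2]
      exact Finset.single_le_sum (fun k _ => hπ.1 k) (Finset.mem_univ k)
    calc π k * S k / ∑ l, π l * S l ≤ (1 * (S z * r)) / (κ * S z) := by
          have := hSz k (Finset.ne_of_mem_erase hk)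
          have := (hS k).le
          gcongr
          exact mul_nonneg zero_le_one (mul_nonneg (hS z).le hr)
      _ = r / κ := by
          have := (hS z).ne'
          field_simp
  have hsum := hq.2
  rw [← Finset.add_sum_erase _ _ (Finset.mem_univ z)] at hsum
  have h3 := Finset.sum_le_card_nsmul _ _ _ hle
  rw [nsmul_eq_mul] at h3
  have h4 : ((Finset.univ.erase z).card : ℝ) * (r / κ) ≤ K * (r / κ) := by
    have : ((Finset.univ.erase z).card : ℝ) ≤ K := by
      exact_mod_cast (Finset.card_le_univ _).trans (by simp)
    gcongr
  linarith

/-- The invariant of the algorithm. -/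
structure GoodState (B : BlockModel K p) (G : LabelledNetwork K m) (Nu : Finset (Fin m))
    (R κ ξ : ℝ) (q0 : Fin m → Fin K → ℝ) (s : OnlineState K p m) : Prop where
  θ_mem : s.θ ∈ Metric.closedBall B.θs R
  q_mem : IsProductDist s.q
  π_mem : s.π ∈ stdSimplex ℝ (Fin K)
  S_pos : ∀ i k, 0 < s.S i k
  S_le : ∀ i ∈ Nu, ∀ k, s.S i k ≤ s.S i (G.zs i)
  π_ge : ∀ i ∈ Nu, κ ≤ s.π (G.zs i)
  q_near : s.q = q0 ∨ ∀ i ∈ Nu, 1 - s.q i (G.zs i) ≤ ξ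

/-- The evidence comes first: it makes the new `q` near the truth even if the old one was not, and
the new `q` then controls both the gradient step and the class proportions. -/
theorem GoodState.step {s : OnlineState K p m} {κ d : ℝ} (hs : GoodState B G Nu R κ ξ q0 s)
    (hg : GoodWindow B G Nu c W ε ρ τ T q0 x n)
    (hB : CondBounded B M) (hM : 0 ≤ M) (hR0 : 0 < R)
    (hR : Metric.closedBall B.θs (2 * R) ⊆ B.paramSpace)
    (hT : ∀ θ ∈ Metric.closedBall B.θs R, ∃ θ' ∈ T, θ' ∈ Metric.closedBall B.θs R ∧ ‖θ - θ'‖ ≤ ρ)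
    {ε₁ : ℝ} (hρ0 : 0 < ρ) (hρ1 : ρ ≤ 1) (hρε : ρ ≤ ε₁)
    (hsl : ∀ θ ∈ Metric.closedBall B.θs R, ∀ θ' ∈ Metric.closedBall B.θs R,
      ‖θ - θ'‖ ≤ ρ → ∀ s s', 0 < s → s ≤ ρ → 0 < s' → s' ≤ ρ → ∀ k l a b x, a ≤ b →
      |slopeFrom B.θs (fun θ => edgeLogLik B k l θ a b x) s θ -
        slopeFrom B.θs (fun θ => edgeLogLik B k l θ a b x) s' θ'| ≤ ε₁ * windowWeight x a b)
    (hA : 0 < G.A.card) (hm : 0 < m) (hc : 0 ≤ c)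
    (hRc : 2 * M * R * W ≤ c / 8) (hεc : 8 * M * (ξ * W + ε) ≤ c / 8)
    (hsmall : τ + ε₁ * W + 2 * c * R * ε₁ + 4 * M * R * (ξ * W + ε) ≤ c * R ^ 2 / 4)
    {η : ℝ} (hη0 : 0 ≤ η) (hη1 : 2 * c * η ≤ 1) (hη2 : η * (M * W) ^ 2 ≤ c * R ^ 2 / 2)
    (hκ : 0 < κ) (hκm : κ ≤ 1 / (2 * m)) (hd : ∀ i ∈ Nu, d ≤ G.deg i)
    (hξ : K * (Real.exp (-(c / 4) * d) / κ) ≤ ξ) (hξ1 : ξ ≤ 1 / 2) :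
    GoodState B G Nu R κ ξ q0 (onlineStep B G x η n s) ∧
      ∀ i ∈ Nu, 1 - (onlineStep B G x η n s).q i (G.zs i) ≤ ξ := by
  have hξ0 : 0 ≤ ξ := le_trans (by positivity) hξ
  have hm' : (0 : ℝ) < m := by exact_mod_cast hm
  set s' := onlineStep B G x η n s with hs'
  have hS' : ∀ i k, s'.S i k =
      s.S i k * Real.exp (meanOverOthers s.q i k (windowLogLik B G x n s.θ)) := fun _ _ => rfl
  have hq' : ∀ i k, s'.q i k = s.π k * s'.S i k / ∑ l, s.π l * s'.S i l := fun _ _ => rfl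
  have hSpos : ∀ i k, 0 < s'.S i k := fun i k => mul_pos (hs.S_pos i k) (Real.exp_pos _)
  -- Only the evidence of the current window is quantified. From the earlier windows it suffices
  -- that they do not favour a wrong label.
  have hSle : ∀ i ∈ Nu, ∀ k ≠ G.zs i,
      s'.S i k ≤ s'.S i (G.zs i) * Real.exp (-(c / 4) * d) := fun i hi k hk => by
    have h1 := hg.labelGain_le hB hM hR0.le
      ((Metric.closedBall_subset_closedBall (by linarith)).trans hR) hs.q_mem hξ0 hs.q_near hRc hεc
      hc hs.θ_mem hi hk
    have h2 : c / 4 * d ≤ c / 4 * G.deg i := mul_le_mul_of_nonneg_left (hd i hi) (by positivity)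
    rw [labelGain] at h1
    rw [hS', hS', mul_assoc, ← Real.exp_add]
    refine mul_le_mul (hs.S_le i hi k) (Real.exp_le_exp.2 ?_) (Real.exp_pos _).le
      (hs.S_pos _ _).le
    linarith
  have hqmem : IsProductDist s'.q := fun i => normalize_mem_stdSimplex hs.π_mem (hSpos i)
  have hnear : ∀ i ∈ Nu, 1 - s'.q i (G.zs i) ≤ ξ := fun i hi => by
    rw [hq']
    exact (one_sub_normalize_le hs.π_mem (hSpos i) hκ (hs.π_ge i hi) (Real.exp_pos _).le
      (hSle i hi)).trans hξ
  have hπ' : ∀ k, s'.π k = 1 / (m : ℝ) * ∑ i, s'.q i k := fun _ => rfl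
  refine ⟨⟨?_, hqmem, ⟨fun k => ?_, ?_⟩, hSpos, fun i hi k => ?_, fun i hi => ?_, Or.inr hnear⟩,
    hnear⟩
  · exact hg.norm_step_le hB hM hR0 hR hT hρ0 hρ1 hρε hsl hA hqmem hξ0 hnear hc hsmall hη0 hη1 hη2
      hs.θ_mem
  · rw [hπ']
    exact mul_nonneg (by positivity) (Finset.sum_nonneg fun i _ => (hqmem i).1 k)
  · simp only [hπ']
    rw [← Finset.mul_sum, Finset.sum_comm, Finset.sum_congr rfl fun i _ => (hqmem i).2]
    simp [hm'.ne']
  · rw [hS', hS']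
    by_cases hk : k = G.zs i
    · rw [hk]
    · have h1 := hg.labelGain_le hB hM hR0.le
        ((Metric.closedBall_subset_closedBall (by linarith)).trans hR) hs.q_mem hξ0 hs.q_near hRc
        hεc hc hs.θ_mem hi hk
      have h2 : 0 ≤ c / 4 * G.deg i := by positivity
      rw [labelGain] at h1
      refine mul_le_mul (hs.S_le i hi k) (Real.exp_le_exp.2 ?_) (Real.exp_pos _).le
        (hs.S_pos _ _).le
      linarith
  · rw [hπ']
    refine hκm.trans ?_
    -- The node's own posterior weight, at least `1 / 2`, already bounds the average from below,
    -- however small its class is.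
    have h1 : s'.q i (G.zs i) ≤ ∑ j, s'.q j (G.zs i) :=
      Finset.single_le_sum (f := fun j => s'.q j (G.zs i)) (fun j _ => (hqmem j).1 _)
        (Finset.mem_univ i)
    have h2 : (1 : ℝ) / 2 ≤ ∑ j, s'.q j (G.zs i) := by linarith [hnear i hi]
    calc (1 : ℝ) / (2 * m) = 1 / m * (1 / 2) := by field_simp
      _ ≤ _ := by gcongr

theorem argmax_eq_of_one_sub_lt {z zhat : Fin K} {u : Fin K → ℝ} (hu : u ∈ stdSimplex ℝ (Fin K))
    (hz : 1 - u z < 1 / 2) (hmax : ∀ k, u k ≤ u zhat) : zhat = z := by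
  by_contra hne
  have h1 : u zhat + u z ≤ ∑ k, u k := by
    rw [← Finset.sum_pair hne]
    exact Finset.sum_le_sum_of_subset_of_nonneg (Finset.subset_univ _) fun k _ _ => hu.1 k
  rw [hu.2] at h1
  linarith [hmax z]

end Deterministic

/-! ### Concentration of edge sums and of the label gains. -/

section Concentration

variable {K p m : ℕ} {B : BlockModel K p} {G : LabelledNetwork K m} {M s R : ℝ}
  {Ω : Type*} [MeasurableSpace Ω] {P : Measure Ω} {X : Fin m × Fin m → Ω → EventStream}

/-- Every window has length `dT` and every intensity is at most `M`, so one exponent `s` serves all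
edges and windows. -/
theorem CondBounded.lintegral_exp_card_le [IsProbabilityMeasure P] (hB : CondBounded B M)
    (hM : 0 ≤ M) (hX : IsEventData B G P X) (hs : 0 ≤ s) (hsM : (Real.exp s - 1) * M * B.dT ≤ 1 / 2) {n : ℕ}
    (hn : 1 ≤ n) {e : Fin m × Fin m} (he : e ∈ G.A) :
    ∫⁻ ω, ENNReal.ofReal (Real.exp (s *
      ((X e ω).window (((n : ℝ) - 1) * B.dT) ((n : ℝ) * B.dT)).card)) ∂P ≤ 2 := by
  have hn' : (1 : ℝ) ≤ n := by exact_mod_cast hn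
  refine (hX.intensity e he).lintegral_exp_le (hX.measurable e he) (fun t h =>
    (le_abs_self _).trans ((hB.lam_smooth _ _).bound _ hB.true_mem t h)) hM hs
    (mul_nonneg (by linarith) hB.dT_pos.le) (hB.window_le n) ?_
  convert hsM using 2
  ring

theorem CondBounded.window_start_nonneg (hB : CondBounded B M) {n : ℕ} (hn : 1 ≤ n) :
    0 ≤ ((n : ℝ) - 1) * B.dT := by
  have hn' : (1 : ℝ) ≤ n := by exact_mod_cast hn
  exact mul_nonneg (by linarith) hB.dT_pos.le

theorem IsEventData.measurable_card (hB : CondBounded B M) (hX : IsEventData B G P X) {n : ℕ}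
    (hn : 1 ≤ n) {e : Fin m × Fin m} (he : e ∈ G.A) :
    Measurable fun ω => (((X e ω).window (((n : ℝ) - 1) * B.dT) ((n : ℝ) * B.dT)).card : ℝ) :=
  measurable_from_top.comp ((EventStream.measurable_card_window
    (hB.window_start_nonneg hn)).comp (hX.measurable e he))

theorem edgeWeight_eq (x : Fin m × Fin m → EventStream) (n : ℕ) (e : Fin m × Fin m) :
    edgeWeight B x n e =
      ((x e).window (((n : ℝ) - 1) * B.dT) ((n : ℝ) * B.dT)).card + B.dT := by
  rw [edgeWeight, windowWeight]
  ring

/-- Exponential bound for the total weight of a set of edges. -/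
theorem IsEventData.measure_sum_edgeWeight_gt_le [IsProbabilityMeasure P] (hX : IsEventData B G P X)
    (hB : CondBounded B M) (hM : 0 ≤ M) (hs : 0 < s)
    (hsM : (Real.exp s - 1) * M * B.dT ≤ 1 / 2) {n : ℕ} (hn : 1 ≤ n)
    {E : Finset (Fin m × Fin m)} (hE : E ⊆ G.A) (y : ℝ) :
    P {ω | y < ∑ e ∈ E, edgeWeight B (fun e => X e ω) n e} ≤
      ENNReal.ofReal (Real.exp (E.card * (1 + s * B.dT) - s * y)) := by
  have hcard : (E.subtype (· ∈ G.A)).card = E.card := by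
    rw [Finset.card_subtype, Finset.filter_true_of_mem hE]
  have h := measure_sum_gt_le (P := P) (ι := {e // e ∈ G.A}) hs (E.subtype (· ∈ G.A))
    (N := fun e ω => (((X e ω).window (((n : ℝ) - 1) * B.dT) ((n : ℝ) * B.dT)).card : ℝ))
    (fun e => hX.measurable_card hB hn e.2)
    (hX.indep.comp (fun _ x => ((x.window (((n : ℝ) - 1) * B.dT) ((n : ℝ) * B.dT)).card : ℝ))
      fun _ => measurable_from_top.comp (EventStream.measurable_card_window
        (hB.window_start_nonneg hn)))
    (fun e => hB.lintegral_exp_card_le hM hX hs.le hsM hn e.2) (y - E.card * B.dT)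
  rw [hcard] at h
  convert h using 2
  · ext ω
    simp only [Set.mem_ofPred_eq, edgeWeight_eq, Finset.sum_add_distrib, Finset.sum_const,
      nsmul_eq_mul]
    rw [Finset.sum_subtype_of_mem (fun e =>
      (((X e ω).window (((n : ℝ) - 1) * B.dT) ((n : ℝ) * B.dT)).card : ℝ)) hE, sub_lt_iff_lt_add]
  · congr 1
    ring

theorem integrable_edge [IsProbabilityMeasure P] (hX : IsEventData B G P X)
    (hB : CondBounded B M) (hM : 0 ≤ M) (hs : 0 < s)
    (hsM : (Real.exp s - 1) * M * B.dT ≤ 1 / 2) {n : ℕ} (hn : 1 ≤ n) {e : Fin m × Fin m}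
    (he : e ∈ G.A) {φ : EventStream → ℝ} (hφ : Measurable φ) {H : ℝ} (hH : 0 ≤ H)
    (hb : ∀ x, |φ x| ≤ H * windowWeight x (((n : ℝ) - 1) * B.dT) ((n : ℝ) * B.dT)) :
    Integrable (fun ω => φ (X e ω)) P := by
  refine integrable_of_dominated (H := H * (1 + B.dT)) (hX.measurable_card hB hn he)
    (hφ.comp (hX.measurable e he)) (hB.lintegral_exp_card_le hM hX hs.le hsM hn he) hs
    (mul_nonneg hH (by linarith [hB.dT_pos])) fun ω => (hb _).trans ?_
  rw [mul_assoc]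
  refine mul_le_mul_of_nonneg_left ?_ hH
  rw [windowWeight]
  have := hB.dT_pos
  have h0 : (0 : ℝ) ≤ ((X e ω).window (((n : ℝ) - 1) * B.dT) ((n : ℝ) * B.dT)).card := by positivity
  nlinarith

theorem integral_edgeWeight_le [IsProbabilityMeasure P] (hX : IsEventData B G P X)
    (hB : CondBounded B M) (hM : 0 ≤ M) (hs : 0 < s)
    (hsM : (Real.exp s - 1) * M * B.dT ≤ 1 / 2) {n : ℕ} (hn : 1 ≤ n) {e : Fin m × Fin m}
    (he : e ∈ G.A) :
    Integrable (fun ω => edgeWeight B (fun e => X e ω) n e) P ∧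
      ∫ ω, edgeWeight B (fun e => X e ω) n e ∂P ≤ 2 / s + B.dT := by
  have hN := hX.measurable_card hB hn he
  have hexp := hB.lintegral_exp_card_le hM hX hs.le hsM hn he
  obtain ⟨h1, h2⟩ := integrable_exp_of_lintegral_le hN hexp
  have hNi : Integrable (fun ω =>
      (((X e ω).window (((n : ℝ) - 1) * B.dT) ((n : ℝ) * B.dT)).card : ℝ)) P :=
    integrable_of_dominated (H := 1) hN hN hexp hs zero_le_one fun ω => by
      rw [abs_of_nonneg (by positivity)]; linarith
  simp only [edgeWeight_eq]
  refine ⟨hNi.add (integrable_const _), ?_⟩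
  rw [integral_add hNi (integrable_const _), integral_const]
  have : ∫ ω, (((X e ω).window (((n : ℝ) - 1) * B.dT) ((n : ℝ) * B.dT)).card : ℝ) ∂P ≤
      ∫ ω, 1 / s * Real.exp (s *
        ((X e ω).window (((n : ℝ) - 1) * B.dT) ((n : ℝ) * B.dT)).card) ∂P := by
    refine integral_mono hNi (h1.const_mul _) fun ω => ?_
    dsimp only
    rw [one_div, ← div_eq_inv_mul, le_div_iff₀ hs]
    linarith [Real.add_one_le_exp (s *
        ((X e ω).window (((n : ℝ) - 1) * B.dT) ((n : ℝ) * B.dT)).card)]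
  rw [integral_const_mul] at this
  have h3 : 1 / s * ∫ ω, Real.exp (s *
        ((X e ω).window (((n : ℝ) - 1) * B.dT) ((n : ℝ) * B.dT)).card) ∂P ≤ 1 / s * 2 := by gcongr
  have h4 : 1 / s * 2 = 2 / s := by ring
  simp
  linarith

/-- Concentration of sums over edges of functions of the event streams. -/
theorem exists_edge_chernoff_rate (B : BlockModel K p) (hB : CondBounded B M) (hM : 0 ≤ M)
    (hs : 0 < s) (hsM : (Real.exp s - 1) * M * B.dT ≤ 1 / 2) {H τ : ℝ} (hH : 0 < H) (hτ : 0 < τ) :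
    ∃ C > 0, ∀ {m : ℕ} {G : LabelledNetwork K m} {Ω : Type*} [MeasurableSpace Ω] {P : Measure Ω}
      [IsProbabilityMeasure P] {X : Fin m × Fin m → Ω → EventStream}, IsEventData B G P X →
      ∀ {n : ℕ}, 1 ≤ n → ∀ {E : Finset (Fin m × Fin m)}, E ⊆ G.A →
      ∀ φ : Fin m × Fin m → EventStream → ℝ, (∀ e, Measurable (φ e)) →
      (∀ e x, |φ e x| ≤ H * windowWeight x (((n : ℝ) - 1) * B.dT) ((n : ℝ) * B.dT)) →
      P {ω | ∑ e ∈ E, ∫ ω, φ e (X e ω) ∂P + τ * E.card ≤ ∑ e ∈ E, φ e (X e ω)} ≤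
        ENNReal.ofReal (Real.exp (-C * E.card)) := by
  obtain ⟨C, hC, h⟩ := exists_chernoff_rate (H := H * (1 + B.dT)) hs
    (mul_pos hH (by linarith [hB.dT_pos])) hτ
  refine ⟨C, hC, ?_⟩
  intro m G Ω _ P _ X hX n hn E hE φ hφ hb
  have hcard : (E.subtype (· ∈ G.A)).card = E.card := by
    rw [Finset.card_subtype, Finset.filter_true_of_mem hE]
  have h1 := h (P := P) (ι := {e // e ∈ G.A}) (E.subtype (· ∈ G.A))
    (N := fun e ω => (((X e ω).window (((n : ℝ) - 1) * B.dT) ((n : ℝ) * B.dT)).card : ℝ))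
    (Y := fun e ω => φ e (X e ω))
    (fun e => hX.measurable_card hB hn e.2) (fun e => (hφ e).comp (hX.measurable e e.2))
    (hX.indep.comp (fun e => φ e) fun e => hφ e)
    (fun e => hB.lintegral_exp_card_le hM hX hs.le hsM hn e.2)
    (fun e ω => (hb _ _).trans (by
      rw [mul_assoc]
      refine mul_le_mul_of_nonneg_left ?_ hH.le
      rw [windowWeight]
      have := hB.dT_pos
      have h0 : (0 : ℝ) ≤ ((X e ω).window (((n : ℝ) - 1) * B.dT) ((n : ℝ) * B.dT)).card := by
        positivity
      nlinarith))
  rw [hcard, Finset.sum_subtype_of_mem (fun e => ∫ ω, φ e (X e ω) ∂P) hE] at h1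
  convert h1 using 2
  ext ω
  simp only [Set.mem_ofPred_eq]
  rw [Finset.sum_subtype_of_mem (fun e => φ e (X e ω)) hE]

theorem integral_meanOver {q : Fin m → Fin K → ℝ} {F : Ω → (Fin m → Fin K) → ℝ}
    (hF : ∀ z, Integrable (fun ω => F ω z) P) :
    Integrable (fun ω => meanOver q (F ω)) P ∧
      ∫ ω, meanOver q (F ω) ∂P = meanOver q fun z => ∫ ω, F ω z ∂P := by
  refine ⟨integrable_finsetSum _ fun z _ => (hF z).const_mul _, ?_⟩
  simp only [meanOver]
  rw [integral_finsetSum _ fun z _ => (hF z).const_mul _]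
  simp only [integral_const_mul]

theorem measurable_meanOver {α : Type*} [MeasurableSpace α] {q : Fin m → Fin K → ℝ}
    {F : α → (Fin m → Fin K) → ℝ} (hF : ∀ z, Measurable fun a => F a z) :
    Measurable fun a => meanOver q (F a) :=
  Finset.measurable_sum _ fun z _ => (hF z).const_mul _

theorem CondBounded.integrable_edgeWindowLogLik [IsProbabilityMeasure P] (hX : IsEventData B G P X)
    (hB : CondBounded B M) (hM : 0 ≤ M) (hs : 0 < s)
    (hsM : (Real.exp s - 1) * M * B.dT ≤ 1 / 2) {n : ℕ} (hn : 1 ≤ n) {e : Fin m × Fin m}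
    (he : e ∈ G.A) {θ : Param p} (hθ : θ ∈ B.paramSpace) (z : Fin m → Fin K) :
    Integrable (fun ω => edgeWindowLogLik B (fun e => X e ω) n e θ z) P :=
  integrable_edge hX hB hM hs hsM hn he
    (measurable_edgeLogLik (hB.measurable _ _ θ hθ) (hB.window_start_nonneg hn)) hM
    fun _ => hB.abs_edgeLogLik_le (hB.window_le n) hθ

theorem CondBounded.integrable_windowLogLik [IsProbabilityMeasure P] (hX : IsEventData B G P X)
    (hB : CondBounded B M) (hM : 0 ≤ M) (hs : 0 < s)
    (hsM : (Real.exp s - 1) * M * B.dT ≤ 1 / 2) {n : ℕ} (hn : 1 ≤ n)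
    {θ : Param p} (hθ : θ ∈ B.paramSpace) (z : Fin m → Fin K) :
    Integrable (fun ω => windowLogLik B G (fun e => X e ω) n θ z) P :=
  integrable_finsetSum _ fun _ he =>
    CondBounded.integrable_edgeWindowLogLik hX hB hM hs hsM hn he hθ z

/-- Stationarity carries the conditions, stated for the first window, over to the `n`-th. -/
theorem integral_windowLogLik (hA : 0 < G.A.card) (hC1 : CondStationary B G P X)
    {n : ℕ} (hn : 1 ≤ n) {θ : Param p} (hθ : θ ∈ B.paramSpace) (z : Fin m → Fin K) :
    ∫ ω, windowLogLik B G (fun e => X e ω) n θ z ∂P = G.A.card * meanLogLik B G P X 1 θ z := by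
  have hA' : (G.A.card : ℝ) ≠ 0 := by exact_mod_cast hA.ne'
  rw [← hC1 n hn θ hθ z, meanLogLik, integral_const_mul]
  field_simp

/-- A single wrong label in C2' is the analogue of C7 at the point mass, so one concentration result
covers both reference distributions. -/
theorem CondIdentification.condInitial {c δ : ℝ} (h : CondIdentification B G P X c δ)
    (hδ : 0 < δ) (hB : CondBounded B M) :
    CondInitial B G P X c (fun i => Pi.single (G.zs i) 1) := by
  intro i k hk
  have hq1 := fun i => (isProductDist_single G.zs i).2
  rw [meanOverOthers_eq hq1, meanOverOthers_eq hq1, meanOver_single, meanOver_single,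
    Function.update_eq_self]
  have := h B.θs ⟨hB.true_mem, Metric.mem_ball_self hδ⟩ {i} (Function.update G.zs i k)
    (by simpa using hk) (fun j hj => Function.update_of_ne (by simpa using hj) _ _)
  simpa using this

theorem exists_labelGain_rate (B : BlockModel K p) (hB : CondBounded B M) (hM : 0 < M)
    (hs : 0 < s) (hsM : (Real.exp s - 1) * M * B.dT ≤ 1 / 2) {c : ℝ} (hc : 0 < c) :
    ∃ C > 0, ∀ {m : ℕ} {G : LabelledNetwork K m} {Ω : Type*} [MeasurableSpace Ω] {P : Measure Ω}
      [IsProbabilityMeasure P] {X : Fin m × Fin m → Ω → EventStream}, IsEventData B G P X →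
      CondStationary B G P X → 0 < G.A.card →
      ∀ {n : ℕ}, 1 ≤ n → ∀ {q}, IsProductDist q → CondInitial B G P X c q →
      ∀ i, ∀ k ≠ G.zs i,
      P {ω | -(c / 2) * G.deg i < labelGain B G (fun e => X e ω) n q B.θs i k} ≤
        ENNReal.ofReal (Real.exp (-C * G.deg i)) := by
  -- An excess of `c / 4` on each of at most `2 * deg` edges uses half of the expected margin `c *
  -- deg`.
  obtain ⟨C, hC, h⟩ := exists_edge_chernoff_rate B hB hM.le hs hsM
    (H := 2 * M) (τ := c / 4) (by positivity) (by positivity)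
  refine ⟨C, hC, ?_⟩
  intro m G Ω _ P _ X hX hC1 hA n hn q hq hq0 i k hk
  have hA' : (0 : ℝ) < G.A.card := by exact_mod_cast hA
  have hq1 : ∀ i, ∑ k, q i k = 1 := fun i => (hq i).2
  -- The term of the edge `e` reads the stream of `e` only, so a constant family of streams can be
  -- inserted. This exhibits the gain as a sum of independent terms.
  set φ : Fin m × Fin m → EventStream → ℝ := fun e x => meanOver q fun z =>
    edgeWindowLogLik B (fun _ => x) n e B.θs (Function.update z i k) -
      edgeWindowLogLik B (fun _ => x) n e B.θs (Function.update z i (G.zs i)) with hφdef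
  have hsum : ∀ ω, labelGain B G (fun e => X e ω) n q B.θs i k =
      ∑ e ∈ G.edgesAt i, φ e (X e ω) := fun ω => labelGain_eq_sum B G _ n hq1 _ i k
  have hint : ∑ e ∈ G.edgesAt i, ∫ ω, φ e (X e ω) ∂P ≤ -c * G.deg i := by
    have hi : ∀ e ∈ G.edgesAt i, Integrable (fun ω => φ e (X e ω)) P := fun e he =>
      (integral_meanOver fun z =>
        (CondBounded.integrable_edgeWindowLogLik hX hB hM.le hs hsM hn (G.edgesAt_subset i he)
          hB.true_mem (Function.update z i k)).sub
        (CondBounded.integrable_edgeWindowLogLik hX hB hM.le hs hsM hn (G.edgesAt_subset i he)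
          hB.true_mem (Function.update z i (G.zs i)))).1
    rw [← integral_finsetSum _ hi]
    simp only [← hsum, labelGain, meanOverOthers]
    have hw := fun z => CondBounded.integrable_windowLogLik hX hB hM.le hs hsM hn hB.true_mem z
    rw [integral_sub (integral_meanOver hw).1 (integral_meanOver hw).1, (integral_meanOver hw).2,
      (integral_meanOver hw).2]
    simp only [integral_windowLogLik hA hC1 hn hB.true_mem, meanOver_const_mul]
    have h1 := mul_le_mul_of_nonneg_left (hq0 i k hk) hA'.le
    have h2 : (G.A.card : ℝ) * (c * G.deg i / G.A.card) = c * G.deg i := by field_simp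
    rw [mul_sub, h2] at h1
    simp only [meanOverOthers] at h1
    linarith
  have hcard : ((G.edgesAt i).card : ℝ) ≤ 2 * G.deg i := by exact_mod_cast G.card_edgesAt_le i
  have hcard' : (G.deg i : ℝ) ≤ (G.edgesAt i).card := by exact_mod_cast G.deg_le_card_edgesAt i
  have hmeas : ∀ e, Measurable (φ e) := fun e => measurable_meanOver fun z =>
    (measurable_edgeLogLik (hB.measurable _ _ _ hB.true_mem) (hB.window_start_nonneg hn)).sub
      (measurable_edgeLogLik (hB.measurable _ _ _ hB.true_mem) (hB.window_start_nonneg hn))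
  have hb : ∀ e x, |φ e x| ≤ 2 * M * windowWeight x (((n : ℝ) - 1) * B.dT) ((n : ℝ) * B.dT) := by
    intro e x
    rw [← meanOver_const hq1 (2 * M * _)]
    refine abs_meanOver_le (fun i k => (hq i).1 k) fun z => ?_
    have h1 : ∀ z, |edgeWindowLogLik B (fun _ => x) n e B.θs z| ≤
        M * windowWeight x (((n : ℝ) - 1) * B.dT) ((n : ℝ) * B.dT) := fun z =>
      hB.abs_edgeLogLik_le (hB.window_le n) hB.true_mem
    refine (abs_sub _ _).trans ?_
    linarith [h1 (Function.update z i k), h1 (Function.update z i (G.zs i))]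
  calc P {ω | -(c / 2) * G.deg i < labelGain B G (fun e => X e ω) n q B.θs i k}
      ≤ P {ω | ∑ e ∈ G.edgesAt i, ∫ ω, φ e (X e ω) ∂P + c / 4 * (G.edgesAt i).card ≤
          ∑ e ∈ G.edgesAt i, φ e (X e ω)} := by
        refine measure_mono fun ω hω => ?_
        simp only [Set.mem_ofPred_eq] at hω ⊢
        rw [hsum] at hω
        nlinarith
    _ ≤ ENNReal.ofReal (Real.exp (-C * (G.edgesAt i).card)) :=
        h hX hn (G.edgesAt_subset i) φ hmeas hb
    _ ≤ _ := by
        refine ENNReal.ofReal_le_ofReal (Real.exp_le_exp.2 ?_)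
        nlinarith

end Concentration

/-! ### The slope of the likelihood towards the true parameter. -/

section Slope

variable {K p m : ℕ} {B : BlockModel K p} {G : LabelledNetwork K m} {M s R c δ ε₁ ρ : ℝ}
  {Ω : Type*} [MeasurableSpace Ω] {P : Measure Ω} {X : Fin m × Fin m → Ω → EventStream}

/-- If all difference quotients with step in `(0, ρ]` are close to each other, then the one with
step `ρ` is bounded by the directional derivative. -/
theorem slopeFrom_le_of_inner_gradient_le {θs θ : Param p} {F : Param p → ℝ} (hc : 0 < c)
    {e : ℝ} (he : 0 ≤ e) (hρ : 0 < ρ)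
    (h : ∀ r, 0 < r → r ≤ ρ → slopeFrom θs F ρ θ - slopeFrom θs F r θ ≤ e)
    (hg : inner ℝ (gradient F θ) (θ - θs) ≤ -c * ‖θ - θs‖ ^ 2) :
    slopeFrom θs F ρ θ ≤ -c * ‖θ - θs‖ ^ 2 + e := by
  by_cases hθ : θ = θs
  · subst hθ
    simpa [slopeFrom] using he
  have hpos : 0 < ‖θ - θs‖ := norm_pos_iff.2 (sub_ne_zero.2 hθ)
  -- A strictly negative inner product excludes the default gradient zero, hence forces
  -- differentiability.
  have hd : DifferentiableAt ℝ F θ := by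
    by_contra hd
    have h0 : gradient F θ = 0 := by simp [gradient, fderiv_zero_of_not_differentiableAt hd]
    rw [h0, inner_zero_left] at hg
    have : 0 < c * ‖θ - θs‖ ^ 2 := by positivity
    linarith
  have h1 : HasDerivAt (fun r : ℝ => F (θ + r • (θ - θs))) (inner ℝ (gradient F θ) (θ - θs)) 0 := by
    have := hasDerivAt_comp_line (F := F) (θ := θ) (v := θ - θs) (u := 0) (by simpa using hd)
    simpa using this
  have h2 : slopeFrom θs F ρ θ - e ≤ inner ℝ (gradient F θ) (θ - θs) := by
    refine ge_of_tendsto h1.tendsto_slope_zero_right ?_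
    filter_upwards [Ioc_mem_nhdsGT hρ] with r hr
    have h3 := h r hr.1 hr.2
    have h4 : slopeFrom θs F r θ = r⁻¹ • (F (θ + (0 + r) • (θ - θs)) - F (θ + (0 : ℝ) • (θ - θs))) := by
      simp [slopeFrom, div_eq_inv_mul]
    rw [← h4]
    linarith
  linarith

theorem integral_slope_windowLogLik [IsProbabilityMeasure P] (hX : IsEventData B G P X)
    (hB : CondBounded B M) (hM : 0 ≤ M) (hs : 0 < s)
    (hsM : (Real.exp s - 1) * M * B.dT ≤ 1 / 2) (hA : 0 < G.A.card)
    (hC1 : CondStationary B G P X) {n : ℕ} (hn : 1 ≤ n)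
    (hR : Metric.closedBall B.θs (2 * R) ⊆ B.paramSpace) {θ : Param p}
    (hθ : θ ∈ Metric.closedBall B.θs R) {r : ℝ} (hr0 : 0 < r) (hr : r ≤ 1) (z : Fin m → Fin K) :
    Integrable (fun ω => slopeFrom B.θs
        (fun θ => windowLogLik B G (fun e => X e ω) n θ z) r θ) P ∧
      ∫ ω, slopeFrom B.θs (fun θ => windowLogLik B G (fun e => X e ω) n θ z) r θ ∂P =
        G.A.card * slopeFrom B.θs (fun θ => meanLogLik B G P X 1 θ z) r θ := by
  have hR0 : 0 ≤ R := (norm_nonneg _).trans (mem_closedBall_iff_norm.1 hθ)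
  have h1 : θ ∈ B.paramSpace := hR (Metric.closedBall_subset_closedBall (by linarith) hθ)
  have h2 : θ + r • (θ - B.θs) ∈ B.paramSpace := hR (add_smul_sub_mem_closedBall hθ hr0.le hr)
  have i1 := CondBounded.integrable_windowLogLik hX hB hM hs hsM hn h1 z
  have i2 := CondBounded.integrable_windowLogLik hX hB hM hs hsM hn h2 z
  refine ⟨(i2.sub i1).div_const r, ?_⟩
  simp only [slopeFrom]
  rw [integral_div, integral_sub i2 i1, integral_windowLogLik hA hC1 hn h1,
    integral_windowLogLik hA hC1 hn h2]
  ring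

/-- At the point mass the label distance is `0`, so C3' gives `θq q = θs`, the expected `Q` is the
expected likelihood at the true labels, and C4 bounds its gradient. The passage to step `ρ` costs
`ε₁` times the mean edge weight, at most `2 / s + dT`. -/
theorem slope_meanLogLik_le [IsProbabilityMeasure P] (hX : IsEventData B G P X)
    (hB : CondBounded B M) (hM : 0 ≤ M) (hs : 0 < s)
    (hsM : (Real.exp s - 1) * M * B.dT ≤ 1 / 2) (hA : 0 < G.A.card) (hc : 0 < c) (hδ : 0 < δ)
    {θq : (Fin m → Fin K → ℝ) → Param p} (hC1 : CondStationary B G P X)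
    (hC3 : CondContinuity B G P X θq M δ) (hC4 : CondGradient B G P X θq c M δ)
    (hR : Metric.closedBall B.θs (2 * R) ⊆ B.paramSpace) (hRδ : R < δ) {θ : Param p}
    (hθ : θ ∈ Metric.closedBall B.θs R) (hε₁ : 0 ≤ ε₁) (hρ0 : 0 < ρ) (hρ1 : ρ ≤ 1)
    (hsl : ∀ r, 0 < r → r ≤ ρ → ∀ k l a b x, a ≤ b →
      |slopeFrom B.θs (fun θ => edgeLogLik B k l θ a b x) ρ θ -
        slopeFrom B.θs (fun θ => edgeLogLik B k l θ a b x) r θ| ≤ ε₁ * windowWeight x a b) :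
    slopeFrom B.θs (fun θ => meanLogLik B G P X 1 θ G.zs) ρ θ ≤
      -c * ‖θ - B.θs‖ ^ 2 + ε₁ * (2 / s + B.dT) := by
  have hR0 : 0 ≤ R := (norm_nonneg _).trans (mem_closedBall_iff_norm.1 hθ)
  have hA' : (0 : ℝ) < G.A.card := by exact_mod_cast hA
  have hdT := hB.dT_pos
  set q : Fin m → Fin K → ℝ := fun i => Pi.single (G.zs i) 1 with hqdef
  have hnear : NearTruth G δ q := ⟨isProductDist_single G.zs, by
    rw [labelDist_single]; exact hδ.le⟩
  have hθq : θq q = B.θs := by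
    have := (hC3 q hnear).2
    rw [labelDist_single, mul_zero] at this
    exact sub_eq_zero.1 (norm_eq_zero.1 (le_antisymm this (norm_nonneg _)))
  have hQ : (fun θ => meanQ B G P X θ q) = fun θ => meanLogLik B G P X 1 θ G.zs := by
    funext θ
    simp only [meanQ, sampleQ, meanLogLik, hqdef, meanOver_single]
  have hg := (hC4 q hnear θ ⟨hR (Metric.closedBall_subset_closedBall (by linarith) hθ), by
    rw [hθq]; exact Metric.closedBall_subset_ball hRδ hθ⟩).1
  rw [hθq, hQ] at hg
  refine slopeFrom_le_of_inner_gradient_le hc (by positivity) hρ0 (fun r hr0 hr => ?_) hg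
  obtain ⟨i1, e1⟩ := integral_slope_windowLogLik hX hB hM hs hsM hA hC1 le_rfl hR hθ hρ0 hρ1 G.zs
  obtain ⟨i2, e2⟩ := integral_slope_windowLogLik hX hB hM hs hsM hA hC1 le_rfl hR hθ hr0
    (hr.trans hρ1) G.zs
  have hw := fun e (he : e ∈ G.A) => integral_edgeWeight_le hX hB hM hs hsM le_rfl he
  have h1 : G.A.card * (slopeFrom B.θs (fun θ => meanLogLik B G P X 1 θ G.zs) ρ θ -
      slopeFrom B.θs (fun θ => meanLogLik B G P X 1 θ G.zs) r θ) ≤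
      G.A.card * (ε₁ * (2 / s + B.dT)) := by
    rw [mul_sub, ← e1, ← e2, ← integral_sub i1 i2]
    calc _ ≤ ∫ ω, ε₁ * ∑ e ∈ G.A, edgeWeight B (fun e => X e ω) 1 e ∂P := by
          refine integral_mono (i1.sub i2)
            ((integrable_finsetSum _ fun e he => (hw e he).1).const_mul _) fun ω => ?_
          exact (abs_le.1 (hB.abs_slope_sub_le G _ 1 (hsl r hr0 hr) G.zs)).2
      _ = ε₁ * ∑ e ∈ G.A, ∫ ω, edgeWeight B (fun e => X e ω) 1 e ∂P := by
          rw [integral_const_mul, integral_finsetSum _ fun e he => (hw e he).1]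
      _ ≤ ε₁ * ∑ _e ∈ G.A, (2 / s + B.dT) := by
          gcongr with e he
          exact (hw e he).2
      _ = _ := by
          rw [Finset.sum_const, nsmul_eq_mul]
          ring
  exact le_of_mul_le_mul_left h1 hA'

/-- The edge terms are bounded by `M * R` times the weight whatever the step, so the rate `C` can be
fixed independently of `ρ` and of the net. -/
theorem exists_slope_rate (B : BlockModel K p) (hB : CondBounded B M) (hM : 0 < M)
    (hs : 0 < s) (hsM : (Real.exp s - 1) * M * B.dT ≤ 1 / 2) (hR0 : 0 < R)
    (hR : Metric.closedBall B.θs (2 * R) ⊆ B.paramSpace) {τ : ℝ} (hτ : 0 < τ) :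
    ∃ C > 0, ∀ {m : ℕ} {G : LabelledNetwork K m} {Ω : Type*} [MeasurableSpace Ω] {P : Measure Ω}
      [IsProbabilityMeasure P] {X : Fin m × Fin m → Ω → EventStream}, IsEventData B G P X →
      CondStationary B G P X → 0 < G.A.card →
      ∀ {n : ℕ}, 1 ≤ n → ∀ {ρ H}, 0 < ρ → ρ ≤ 1 → ∀ θ ∈ Metric.closedBall B.θs R,
      slopeFrom B.θs (fun θ => meanLogLik B G P X 1 θ G.zs) ρ θ ≤ H →
      P {ω | (H + τ) * G.A.card <
          slopeFrom B.θs (fun θ => windowLogLik B G (fun e => X e ω) n θ G.zs) ρ θ} ≤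
        ENNReal.ofReal (Real.exp (-C * G.A.card)) := by
  obtain ⟨C, hC, h⟩ := exists_edge_chernoff_rate B hB hM.le hs hsM
    (H := M * R) (τ := τ) (by positivity) hτ
  refine ⟨C, hC, ?_⟩
  intro m G Ω _ P _ X hX hC1 hA n hn ρ H hρ0 hρ1 θ hθ hH
  have hA' : (0 : ℝ) < G.A.card := by exact_mod_cast hA
  have h1 : θ ∈ B.paramSpace := hR (Metric.closedBall_subset_closedBall (by linarith) hθ)
  have h2 : θ + ρ • (θ - B.θs) ∈ B.paramSpace := hR (add_smul_sub_mem_closedBall hθ hρ0.le hρ1)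
  set φ : Fin m × Fin m → EventStream → ℝ := fun e x =>
    slopeFrom B.θs (fun θ => edgeWindowLogLik B (fun _ => x) n e θ G.zs) ρ θ with hφdef
  have hsum : ∀ ω, slopeFrom B.θs (fun θ => windowLogLik B G (fun e => X e ω) n θ G.zs) ρ θ =
      ∑ e ∈ G.A, φ e (X e ω) := fun ω => by
    simp only [windowLogLik_eq_sum, slopeFrom_sum]
    rfl
  have hmeas : ∀ e, Measurable (φ e) := fun e =>
    ((measurable_edgeLogLik (hB.measurable _ _ _ h2) (hB.window_start_nonneg hn)).sub
      (measurable_edgeLogLik (hB.measurable _ _ _ h1) (hB.window_start_nonneg hn))).div_const ρ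
  have hb : ∀ e x, |φ e x| ≤ M * R * windowWeight x (((n : ℝ) - 1) * B.dT) ((n : ℝ) * B.dT) :=
    fun e x => hB.abs_slope_edge_le (fun _ => x) n hM.le hR hθ hρ0 hρ1 e G.zs
  have hint : ∑ e ∈ G.A, ∫ ω, φ e (X e ω) ∂P ≤ H * G.A.card := by
    rw [← integral_finsetSum _ fun e he => integrable_edge hX hB hM.le hs hsM hn he (hmeas e)
      (by positivity) (hb e)]
    simp only [← hsum]
    rw [(integral_slope_windowLogLik hX hB hM.le hs hsM hA hC1 hn hR hθ hρ0 hρ1 G.zs).2]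
    nlinarith
  refine (measure_mono fun ω hω => ?_).trans (h hX hn subset_rfl φ hmeas hb)
  simp only [Set.mem_ofPred_eq] at hω ⊢
  rw [hsum] at hω
  linarith

end Slope

/-! ### The probability of a good window. -/

section GoodProb

theorem measure_exists_le {Ω ι : Type*} [MeasurableSpace Ω] {P : Measure Ω} (s : Finset ι)
    (p : ι → Ω → Prop) {b : ℝ≥0∞} {N : ℕ} (hN : s.card ≤ N)
    (h : ∀ i ∈ s, P {ω | p i ω} ≤ b) : P {ω | ∃ i ∈ s, p i ω} ≤ N * b := by
  have e : {ω | ∃ i ∈ s, p i ω} = ⋃ i ∈ s, {ω | p i ω} := by ext; simp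
  rw [e]
  calc _ ≤ ∑ i ∈ s, P {ω | p i ω} := measure_biUnion_finset_le _ _
    _ ≤ s.card • b := Finset.sum_le_card_nsmul _ _ _ h
    _ ≤ N * b := by
      rw [nsmul_eq_mul]
      gcongr

theorem measure_or_le {Ω : Type*} [MeasurableSpace Ω] {P : Measure Ω} {p q : Ω → Prop}
    {a b : ℕ} {u : ℝ≥0∞} (hp : P {ω | p ω} ≤ a * u) (hq : P {ω | q ω} ≤ b * u) :
    P {ω | p ω ∨ q ω} ≤ (a + b : ℕ) * u := by
  have : {ω | p ω ∨ q ω} = {ω | p ω} ∪ {ω | q ω} := rfl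
  rw [this, Nat.cast_add, add_mul]
  exact (measure_union_le _ _).trans (add_le_add hp hq)

variable {K p m : ℕ} {B : BlockModel K p} {G : LabelledNetwork K m} {Nu : Finset (Fin m)}
  {c W ε ρ τ M R s C d : ℝ} {T : Finset (Param p)} {q0 : Fin m → Fin K → ℝ}
  {Ω : Type*} [MeasurableSpace Ω] {P : Measure Ω} {X : Fin m × Fin m → Ω → EventStream}

/-- The union bound counts `2 * m` weights at nodes, `2` total weights, `2 * (m * K)` gains and one
slope per point of `T`. The weights on edges with an end outside `Nu` are small because there are at
most `2 * D` such edges at a node of `Nu`, and few compared with all edges. -/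
theorem measure_not_goodWindow_le [IsProbabilityMeasure P] (hX : IsEventData B G P X)
    (hB : CondBounded B M) (hM : 0 ≤ M) (hs : 0 < s)
    (hsM : (Real.exp s - 1) * M * B.dT ≤ 1 / 2) {n : ℕ} (hn : 1 ≤ n) {D : ℕ}
    (hW : 2 * (1 + s * B.dT) + 1 ≤ s * W)
    (hdeg : CondDegree G Nu d D) (hd0 : 0 ≤ d) (hdA : d ≤ G.A.card)
    (hDd : 2 * D * (1 + s * B.dT) ≤ s * ε / 2 * d)
    (hoff : 2 * D * Nuᶜ.card * (1 + s * B.dT) ≤ s * ε / 2 * G.A.card)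
    (hε : 0 ≤ ε) (hC1 : C ≤ 1) (hCε : C ≤ s * ε / 2)
    (hgain_init : ∀ i ∈ Nu, ∀ k ≠ G.zs i,
      P {ω | -(c / 2) * G.deg i < labelGain B G (fun e => X e ω) n q0 B.θs i k} ≤
        ENNReal.ofReal (Real.exp (-C * d)))
    (hgain_true : ∀ i ∈ Nu, ∀ k ≠ G.zs i,
      P {ω | -(c / 2) * G.deg i <
          labelGain B G (fun e => X e ω) n (fun i => Pi.single (G.zs i) 1) B.θs i k} ≤
        ENNReal.ofReal (Real.exp (-C * d)))
    (hslope : ∀ θ ∈ T, P {ω | (-c * ‖θ - B.θs‖ ^ 2 + τ) * G.A.card <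
          slopeFrom B.θs (fun θ => windowLogLik B G (fun e => X e ω) n θ G.zs) ρ θ} ≤
        ENNReal.ofReal (Real.exp (-C * d))) :
    P {ω | ¬ GoodWindow B G Nu c W ε ρ τ T q0 (fun e => X e ω) n} ≤
      (2 * m + 2 + 2 * (m * K) + T.card : ℕ) * ENNReal.ofReal (Real.exp (-C * d)) := by
  have hu : 0 ≤ 1 + s * B.dT := by
    have := hB.dT_pos
    positivity
  have hWpos : 0 ≤ W := by
    by_contra! hneg
    nlinarith
  have hNu : Nu.card ≤ m := (Finset.card_le_univ _).trans (by simp)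
  have hNuK : (Nu ×ˢ (Finset.univ : Finset (Fin K))).card ≤ m * K := by
    rw [Finset.card_product]
    simpa using Nat.mul_le_mul_right K hNu
  have h1 := measure_exists_le Nu (fun i ω => W * G.deg i <
      ∑ e ∈ G.edgesAt i, edgeWeight B (fun e => X e ω) n e) hNu (P := P)
    (b := ENNReal.ofReal (Real.exp (-C * d))) fun i hi => by
      refine (hX.measure_sum_edgeWeight_gt_le hB hM hs hsM hn (G.edgesAt_subset i) _).trans
        (ENNReal.ofReal_le_ofReal (Real.exp_le_exp.2 ?_))
      have h : ((G.edgesAt i).card : ℝ) ≤ 2 * G.deg i := by exact_mod_cast G.card_edgesAt_le i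
      have h' := mul_le_mul_of_nonneg_right h hu
      have h2 := mul_le_mul_of_nonneg_right hW (hd0.trans (hdeg.1 i hi))
      have h3 := mul_le_mul_of_nonneg_right hC1 hd0
      linarith [hdeg.1 i hi]
  have h2 := measure_exists_le Nu (fun i ω => ε * G.deg i <
      ∑ e ∈ G.edgesAtOff Nu i, edgeWeight B (fun e => X e ω) n e) hNu (P := P)
    (b := ENNReal.ofReal (Real.exp (-C * d))) fun i hi => by
      refine (hX.measure_sum_edgeWeight_gt_le hB hM hs hsM hn (G.edgesAtOff_subset Nu i) _).trans
        (ENNReal.ofReal_le_ofReal (Real.exp_le_exp.2 ?_))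
      have h : ((G.edgesAtOff Nu i).card : ℝ) ≤ 2 * D := by
        exact_mod_cast G.card_edgesAtOff_le hi (hdeg.2.2 i)
      have h' := mul_le_mul_of_nonneg_right h hu
      have h2 := mul_le_mul_of_nonneg_left (hdeg.1 i hi) (show 0 ≤ s * ε by positivity)
      have h3 := mul_le_mul_of_nonneg_right hCε hd0
      linarith
  have h3 : P {ω | W * G.A.card < ∑ e ∈ G.A, edgeWeight B (fun e => X e ω) n e} ≤
      (1 : ℕ) * ENNReal.ofReal (Real.exp (-C * d)) := by
    rw [Nat.cast_one, one_mul]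
    refine (hX.measure_sum_edgeWeight_gt_le hB hM hs hsM hn subset_rfl _).trans
        (ENNReal.ofReal_le_ofReal (Real.exp_le_exp.2 ?_))
    have h2 := mul_le_mul_of_nonneg_right hW (hd0.trans hdA)
    have h3 := mul_le_mul_of_nonneg_right hC1 hd0
    have h4 := mul_nonneg hu (hd0.trans hdA)
    linarith
  have h4 : P {ω | ε * G.A.card < ∑ e ∈ G.edgesOff Nu, edgeWeight B (fun e => X e ω) n e} ≤
      (1 : ℕ) * ENNReal.ofReal (Real.exp (-C * d)) := by
    rw [Nat.cast_one, one_mul]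
    refine (hX.measure_sum_edgeWeight_gt_le hB hM hs hsM hn (G.edgesOff_subset Nu) _).trans
        (ENNReal.ofReal_le_ofReal (Real.exp_le_exp.2 ?_))
    have h : ((G.edgesOff Nu).card : ℝ) ≤ 2 * D * Nuᶜ.card := by
      exact_mod_cast G.card_edgesOff_le hdeg.2.1
    have h' := mul_le_mul_of_nonneg_right h hu
    have h2 := mul_le_mul_of_nonneg_left hdA (show 0 ≤ s * ε by positivity)
    have h3 := mul_le_mul_of_nonneg_right hCε hd0
    linarith
  have h5 := fun (q : Fin m → Fin K → ℝ) (hq : ∀ i ∈ Nu, ∀ k ≠ G.zs i,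
      P {ω | -(c / 2) * G.deg i < labelGain B G (fun e => X e ω) n q B.θs i k} ≤
        ENNReal.ofReal (Real.exp (-C * d))) =>
    measure_exists_le (Nu ×ˢ (Finset.univ : Finset (Fin K))) (fun u ω => u.2 ≠ G.zs u.1 ∧
      -(c / 2) * G.deg u.1 < labelGain B G (fun e => X e ω) n q B.θs u.1 u.2) hNuK (P := P)
    (b := ENNReal.ofReal (Real.exp (-C * d))) fun u hu => by
      by_cases hk : u.2 = G.zs u.1
      · simp [hk]
      · simpa [hk] using hq u.1 (Finset.mem_product.1 hu).1 u.2 hk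
  have h6 := measure_exists_le T (fun θ ω => (-c * ‖θ - B.θs‖ ^ 2 + τ) * G.A.card <
          slopeFrom B.θs (fun θ => windowLogLik B G (fun e => X e ω) n θ G.zs) ρ θ) le_rfl hslope
  have hall := measure_or_le h1 (measure_or_le h2 (measure_or_le h3 (measure_or_le h4
    (measure_or_le (h5 _ hgain_init) (measure_or_le (h5 _ hgain_true) h6)))))
  refine (measure_mono fun ω hω => ?_).trans (hall.trans_eq ?_)
  · by_contra hcon
    refine hω ?_
    simp only [Set.mem_ofPred_eq, not_or, not_exists, not_and, not_lt, Finset.mem_product,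
      Finset.mem_univ, and_true, Prod.forall] at hcon
    obtain ⟨g1, g2, g3, g4, g5, g6, g7⟩ := hcon
    exact ⟨g1, g2, g3, g4, fun i hi k hk => g5 i k hi hk, fun i hi k hk => g6 i k hi hk, g7⟩
  · congr 2
    ring

end GoodProb

/-! ### Choice of the constants and the main theorem. -/

theorem tendsto_mul_exp_neg_rpow {a r : ℝ} (ha : 0 < a) (hr : 0 < r) :
    Tendsto (fun m : ℕ => (m : ℝ) * Real.exp (-a * (m : ℝ) ^ r)) atTop (𝓝 0) := by
  have h1 : Tendsto (fun m : ℕ => (m : ℝ) ^ r) atTop atTop :=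
    (tendsto_rpow_atTop hr).comp tendsto_natCast_atTop_atTop
  refine ((tendsto_rpow_mul_exp_neg_mul_atTop_nhds_zero (1 / r) a ha).comp h1).congr fun m => ?_
  simp only [Function.comp]
  rw [← Real.rpow_mul (by positivity), mul_one_div_cancel hr.ne', Real.rpow_one]

theorem exists_small_exponent {M dT : ℝ} (hM : 0 < M) (hdT : 0 < dT) :
    ∃ s > 0, (Real.exp s - 1) * M * dT ≤ 1 / 2 := by
  have h : 0 < 1 / (2 * (M * dT)) := by positivity
  refine ⟨Real.log (1 + 1 / (2 * (M * dT))), Real.log_pos (by linarith), ?_⟩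
  rw [Real.exp_log (by linarith)]
  refine le_of_eq ?_
  field_simp
  ring

theorem exists_finset_cover {p : ℕ} (θs : Param p) (R : ℝ) {ρ : ℝ} (hρ : 0 < ρ) :
    ∃ T : Finset (Param p), (∀ θ ∈ T, θ ∈ Metric.closedBall θs R) ∧
      ∀ θ ∈ Metric.closedBall θs R, ∃ θ' ∈ T, ‖θ - θ'‖ ≤ ρ := by
  obtain ⟨t, ht, hf, hc⟩ := (isCompact_closedBall θs R).finite_cover_balls hρ
  refine ⟨hf.toFinset, fun θ hθ => ht (hf.mem_toFinset.1 hθ), fun θ hθ => ?_⟩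
  obtain ⟨θ', h1, h2⟩ := Set.mem_iUnion₂.1 (hc hθ)
  exact ⟨θ', hf.mem_toFinset.2 h1, (mem_ball_iff_norm.1 h2).le⟩

theorem mainTheorem3 {K p : ℕ} (B : BlockModel K p) (G : ∀ m : ℕ, LabelledNetwork K m)
    (Nu : ∀ m : ℕ, Finset (Fin m))
    {Ω : ℕ → Type*} [∀ m, MeasurableSpace (Ω m)] (P : ∀ m, Measure (Ω m))
    [∀ m, IsProbabilityMeasure (P m)]
    (X : ∀ m : ℕ, Fin m × Fin m → Ω m → EventStream)
    (hX : ∀ m, IsEventData B (G m) (P m) (X m))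
    (θq : ∀ m : ℕ, (Fin m → Fin K → ℝ) → Param p)
    (c δ M κ r : ℝ) (D : ℕ) (hc : 0 < c) (hδ : 0 < δ) (hκ : 0 < κ) (hr : 0 < r)
    (hmax : ∀ᶠ m in atTop, IsPopulationMaximizer B (G m) (P m) (X m) (θq m) δ)
    (hC1 : ∀ᶠ m in atTop, CondStationary B (G m) (P m) (X m))
    (hC2' : ∀ᶠ m in atTop, CondIdentification B (G m) (P m) (X m) c δ)
    (hC3' : ∀ᶠ m in atTop, CondContinuity B (G m) (P m) (X m) (θq m) M δ)
    (hC4 : ∀ᶠ m in atTop, CondGradient B (G m) (P m) (X m) (θq m) c M δ)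
    (hC5 : CondBounded B M)
    (hC6' : ∀ᶠ m in atTop, CondDegree (G m) (Nu m) ((m : ℝ) ^ r) D)
    (hC6'o : Tendsto (fun m => (((Nu m)ᶜ.card : ℕ) : ℝ) / ((G m).A.card : ℝ)) atTop (𝓝 0)) :
    ∃ δ₁ > 0, ∃ η₀ > 0, ∃ C > 0, ∀ᶠ m : ℕ in atTop,
      ∀ (θ0 : Param p) (q0 : Fin m → Fin K → ℝ) (π0 : Fin K → ℝ) (η : ℕ → ℝ) (N : ℕ),
        θ0 ∈ Metric.ball B.θs δ₁ →
        IsProductDist q0 →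
        CondInitial B (G m) (P m) (X m) c q0 →
        π0 ∈ stdSimplex ℝ (Fin K) → (∀ k, κ ≤ π0 k) →
        (∀ n, 0 ≤ η n ∧ η n ≤ η₀) →
        1 ≤ N →
        P m {ω | ¬ ∀ zhat : Fin m → Fin K,
            IsArgmaxLabel (onlineRun B (G m) (fun e => X m e ω) η θ0 q0 π0 N).q zhat →
              ∀ i ∈ Nu m, zhat i = (G m).zs i}
          ≤ ENNReal.ofReal ((N : ℝ) * Real.exp (-C * (m : ℝ) ^ r)) := by
  -- The network with one node exhibits a class, so `K` is positive.
  have k₀ : Fin K := (G 1).zs 0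
  have hK : (0 : ℝ) < K := by exact_mod_cast Fin.pos k₀
  have hM : 0 < M := by
    have x₀ : EventStream := ⟨∅, by simp, by simp⟩
    exact (hC5.pos k₀ k₀ _ hC5.true_mem 0 x₀).trans_le
      ((le_abs_self _).trans ((hC5.lam_smooth k₀ k₀).bound _ hC5.true_mem 0 x₀))
  have hdT := hC5.dT_pos
  obtain ⟨s, hs, hsM⟩ := exists_small_exponent hM hdT
  -- With this `W` the exponent `2 * deg * (1 + s * dT) - s * W * deg` of the weight bound is
  -- `-deg`.
  obtain ⟨W, hW⟩ : ∃ W, W = (2 * (1 + s * B.dT) + 1) / s := ⟨_, rfl⟩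
  have hW0 : 0 < W := by rw [hW]; positivity
  have hsW : 2 * (1 + s * B.dT) + 1 ≤ s * W := by rw [hW]; exact (mul_div_cancel₀ _ hs.ne').ge
  -- The doubled ball must lie in the parameter space, the ball in the range of C4, and the change
  -- of `θ` may cost a label gain at most `c / 8`.
  obtain ⟨R, hR0, hR, hRδ, hRc⟩ : ∃ R > 0, Metric.closedBall B.θs (2 * R) ⊆ B.paramSpace ∧ R < δ ∧
      2 * M * R * W ≤ c / 8 := by
    obtain ⟨r₀, hr₀, h₀⟩ := Metric.nhds_basis_closedBall.mem_iff.1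
      (hC5.isOpen.mem_nhds hC5.true_mem)
    refine ⟨min (r₀ / 2) (min (δ / 2) (c / (16 * (M * W)))), by positivity,
      (Metric.closedBall_subset_closedBall ?_).trans h₀, ?_, ?_⟩
    · linarith [min_le_left (r₀ / 2) (min (δ / 2) (c / (16 * (M * W))))]
    · linarith [(min_le_right (r₀ / 2) _).trans (min_le_left (δ / 2) (c / (16 * (M * W))))]
    · have := (min_le_right (r₀ / 2) _).trans (min_le_right (δ / 2) (c / (16 * (M * W))))
      rw [le_div_iff₀ (by positivity)] at this
      linarith
  -- Four errors of at most `a` enter the slope: equicontinuity, sampling, `ξ` and `ε`. Together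
  -- they stay below `c * R ^ 2 / 4`.
  obtain ⟨a, ha⟩ : ∃ a, a = c * R ^ 2 / 32 := ⟨_, rfl⟩
  have ha0 : 0 < a := by rw [ha]; positivity
  obtain ⟨ε₁, hε₁, hε₁a⟩ : ∃ ε₁ > 0, ε₁ * (2 / s + B.dT + W + 2 * c * R) ≤ a :=
    ⟨a / (2 / s + B.dT + W + 2 * c * R), by positivity, (div_mul_cancel₀ _ (by positivity)).le⟩
  obtain ⟨ε, hε, hεc, hεa⟩ : ∃ ε > 0, 8 * M * ε ≤ c / 16 ∧ 4 * M * R * ε ≤ a := by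
    refine ⟨min (c / (128 * M)) (a / (4 * M * R)), by positivity, ?_, ?_⟩
    · have := min_le_left (c / (128 * M)) (a / (4 * M * R))
      rw [le_div_iff₀ (by positivity)] at this
      linarith
    · have := min_le_right (c / (128 * M)) (a / (4 * M * R))
      rw [le_div_iff₀ (by positivity)] at this
      linarith
  obtain ⟨ξ, hξ, hξ4, hξc, hξa⟩ : ∃ ξ > 0, ξ ≤ 1 / 4 ∧ 8 * M * (ξ * W) ≤ c / 16 ∧
      4 * M * R * (ξ * W) ≤ a := by
    refine ⟨min (1 / 4) (min (c / (128 * M)) (a / (4 * M * R)) / W), by positivity,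
      min_le_left _ _, ?_, ?_⟩
    all_goals
      have h1 := min_le_right (1 / 4) (min (c / (128 * M)) (a / (4 * M * R)) / W)
      rw [le_div_iff₀ hW0] at h1
    · have := h1.trans (min_le_left _ _)
      rw [le_div_iff₀ (by positivity)] at this
      linarith
    · have := h1.trans (min_le_right _ _)
      rw [le_div_iff₀ (by positivity)] at this
      linarith
  obtain ⟨η₀, hη₀, hη₀c, hη₀W⟩ : ∃ η₀ > 0, 2 * c * η₀ ≤ 1 ∧ η₀ * (M * W) ^ 2 ≤ c * R ^ 2 / 2 := by
    refine ⟨min (1 / (2 * c)) (c * R ^ 2 / 2 / (M * W) ^ 2), by positivity, ?_, ?_⟩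
    · have := min_le_left (1 / (2 * c)) (c * R ^ 2 / 2 / (M * W) ^ 2)
      rw [le_div_iff₀ (by positivity)] at this
      linarith
    · have := min_le_right (1 / (2 * c)) (c * R ^ 2 / 2 / (M * W) ^ 2)
      rwa [le_div_iff₀ (by positivity)] at this
  obtain ⟨ρ, hρ0, hρ1, hρε, hsl⟩ := hC5.exists_slope_edgeLogLik_le hM hR0 hR hε₁
  obtain ⟨T, hTmem, hT⟩ := exists_finset_cover B.θs R hρ0
  obtain ⟨Cg, hCg, hgain⟩ := exists_labelGain_rate B hC5 hM hs hsM hc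
  obtain ⟨Cs, hCs, hslope⟩ := exists_slope_rate B hC5 hM hs hsM hR0 hR ha0
  obtain ⟨C, hC0, hCle1, hCε, hCg', hCs'⟩ : ∃ C > 0, C ≤ 1 ∧ C ≤ s * ε / 2 ∧ C ≤ Cg ∧ C ≤ Cs :=
    ⟨min (min 1 (s * ε / 2)) (min Cg Cs), by positivity,
      (min_le_left _ _).trans (min_le_left _ _), (min_le_left _ _).trans (min_le_right _ _),
      (min_le_right _ _).trans (min_le_left _ _), (min_le_right _ _).trans (min_le_right _ _)⟩
  have hrpow : Tendsto (fun m : ℕ => (m : ℝ) ^ r) atTop atTop :=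
    (tendsto_rpow_atTop hr).comp tendsto_natCast_atTop_atTop
  have hev_κ : ∀ᶠ m : ℕ in atTop, 1 / (2 * (m : ℝ)) ≤ κ := by
    filter_upwards [tendsto_natCast_atTop_atTop.eventually_ge_atTop (1 / (2 * κ)),
      eventually_gt_atTop 0] with m h1 h2
    have h2' : (0 : ℝ) < m := by exact_mod_cast h2
    rw [div_le_iff₀ (by positivity)] at h1 ⊢
    linarith
  -- The prior weight is only known to be at least `1 / (2 * m)`; the factor `2 * m` is beaten by
  -- the exponential in `m ^ r`.
  have hev_ξ : ∀ᶠ m : ℕ in atTop,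
      K * (Real.exp (-(c / 4) * (m : ℝ) ^ r) / (1 / (2 * (m : ℝ)))) ≤ ξ := by
    have h := (tendsto_mul_exp_neg_rpow (a := c / 4) (by positivity) hr).const_mul (2 * (K : ℝ))
    rw [mul_zero] at h
    filter_upwards [h.eventually_le_const hξ] with m hm
    refine le_trans (le_of_eq ?_) hm
    rw [div_div_eq_mul_div, div_one]
    ring
  have hev_D : ∀ᶠ m : ℕ in atTop, 2 * D * (1 + s * B.dT) ≤ s * ε / 2 * (m : ℝ) ^ r := by
    filter_upwards [hrpow.eventually_ge_atTop (2 * D * (1 + s * B.dT) / (s * ε / 2))] with m hm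
    rw [div_le_iff₀ (by positivity)] at hm
    linarith
  have hev_off : ∀ᶠ m : ℕ in atTop, 2 * D * (1 + s * B.dT) *
      (((Nu m)ᶜ.card : ℝ) / (G m).A.card) ≤ s * ε / 2 := by
    have h := hC6'o.const_mul (2 * D * (1 + s * B.dT))
    rw [mul_zero] at h
    exact h.eventually_le_const (by positivity)
  -- Half of the exponent absorbs the number of events in the union bound, which is linear in `m`.
  have hev_exp : ∀ᶠ m : ℕ in atTop, ((2 * m + 2 + 2 * (m * K) + T.card : ℕ) : ℝ) *
      Real.exp (-C * (m : ℝ) ^ r) ≤ Real.exp (-(C / 2) * (m : ℝ) ^ r) := by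
    have h := (tendsto_mul_exp_neg_rpow (half_pos hC0) hr).const_mul
      (2 + 2 + 2 * (K : ℝ) + T.card)
    rw [mul_zero] at h
    filter_upwards [h.eventually_le_const one_pos, eventually_ge_atTop 1] with m hm hm1
    have hm1' : (1 : ℝ) ≤ m := by exact_mod_cast hm1
    have e : Real.exp (-C * (m : ℝ) ^ r) =
        Real.exp (-(C / 2) * (m : ℝ) ^ r) * Real.exp (-(C / 2) * (m : ℝ) ^ r) := by
      rw [← Real.exp_add]; ring_nf
    have h1 : ((2 * m + 2 + 2 * (m * K) + T.card : ℕ) : ℝ) ≤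
        (2 + 2 + 2 * (K : ℝ) + T.card) * m := by
      push_cast
      nlinarith [(Nat.cast_nonneg T.card : (0 : ℝ) ≤ T.card)]
    have h2 : 0 < Real.exp (-(C / 2) * (m : ℝ) ^ r) := Real.exp_pos _
    rw [e]
    refine (mul_assoc _ _ _).symm.trans_le (mul_le_of_le_one_left h2.le
      ((mul_le_mul_of_nonneg_right h1 h2.le).trans ?_))
    rwa [mul_assoc]
  refine ⟨R, hR0, η₀, hη₀, C / 2, by positivity, ?_⟩
  filter_upwards [hC1, hC2', hC3', hC4, hC6', hev_κ, hev_ξ, hev_D, hev_off, hev_exp,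
    eventually_gt_atTop 0] with m hC1 hC2 hC3 hC4 hdeg hmκ hmξ hmD hmoff hmexp hm0
  intro θ0 q0 π0 η N hθ0 hq0 hinit hπ0 hπκ hη hN
  have hm0' : (0 : ℝ) < m := by exact_mod_cast hm0
  -- Without nodes in `Nu` nothing is claimed. Otherwise one such node already forces `m ^ r ≤ |A|`.
  rcases (Nu m).eq_empty_or_nonempty with hNu | ⟨i₀, hi₀⟩
  · simp [hNu]
  have hd0 : (0 : ℝ) < (m : ℝ) ^ r := Real.rpow_pos_of_pos hm0' r
  have hdA : (m : ℝ) ^ r ≤ (G m).A.card := by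
    refine (hdeg.1 i₀ hi₀).trans ?_
    exact_mod_cast ((G m).deg_le_card_edgesAt i₀).trans
      (Finset.card_le_card ((G m).edgesAt_subset i₀))
  have hA' : (0 : ℝ) < (G m).A.card := hd0.trans_le hdA
  have hA : 0 < (G m).A.card := by exact_mod_cast hA'
  have hoff : 2 * D * (Nu m)ᶜ.card * (1 + s * B.dT) ≤ s * ε / 2 * (G m).A.card := by
    rw [← mul_div_assoc, div_le_iff₀ hA'] at hmoff
    linarith
  set τ := ε₁ * (2 / s + B.dT) + a with hτ
  have hrate : ∀ {C' x : ℝ}, C ≤ C' → (m : ℝ) ^ r ≤ x →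
      ENNReal.ofReal (Real.exp (-C' * x)) ≤ ENNReal.ofReal (Real.exp (-C * (m : ℝ) ^ r)) :=
    fun {C' x} h1 h2 => ENNReal.ofReal_le_ofReal (Real.exp_le_exp.2 (by
      have := mul_le_mul h1 h2 hd0.le (hC0.le.trans h1)
      linarith))
  have hprob : ∀ n : ℕ, 1 ≤ n → P m {ω | ¬ GoodWindow B (G m) (Nu m) c W ε ρ τ T q0
      (fun e => X m e ω) n} ≤ ENNReal.ofReal (Real.exp (-(C / 2) * (m : ℝ) ^ r)) := by
    intro n hn
    refine (measure_not_goodWindow_le (hX m) hC5 hM.le hs hsM hn hsW hdeg hd0.le hdA hmD hoff hε.le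
      hCle1 hCε (fun i hi k hk => ?_) (fun i hi k hk => ?_) (fun θ hθ => ?_)).trans ?_
    · exact (hgain (hX m) hC1 hA hn hq0 hinit i k hk).trans (hrate hCg' (hdeg.1 i hi))
    · exact (hgain (hX m) hC1 hA hn (isProductDist_single _) (hC2.condInitial hδ hC5) i k hk).trans
        (hrate hCg' (hdeg.1 i hi))
    · have h1 := slope_meanLogLik_le (hX m) hC5 hM.le hs hsM hA hc hδ hC1 hC3 hC4 hR hRδ
        (hTmem θ hθ) hε₁.le hρ0 hρ1 fun u hu0 hu =>
          hsl θ (hTmem θ hθ) θ (hTmem θ hθ) (by simpa using hρ0.le) ρ u hρ0 le_rfl hu0 hu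
      have h2 := hslope (hX m) hC1 hA hn hρ0 hρ1 θ (hTmem θ hθ) h1
      rw [add_assoc] at h2
      exact h2.trans (hrate hCs' hdA)
    · rw [← ENNReal.ofReal_natCast, ← ENNReal.ofReal_mul (by positivity)]
      exact ENNReal.ofReal_le_ofReal hmexp
  -- The passage from state `j` to state `j + 1` processes window `j + 1`. Closeness to the truth is
  -- asserted only from `n = 1` on, since `q0` may be far from it.
  have hrun : ∀ ω, ∀ n, (∀ j < n, GoodWindow B (G m) (Nu m) c W ε ρ τ T q0
      (fun e => X m e ω) (j + 1)) →
      GoodState B (G m) (Nu m) R (1 / (2 * (m : ℝ))) ξ q0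
        (onlineRun B (G m) (fun e => X m e ω) η θ0 q0 π0 n) ∧
      (1 ≤ n → ∀ i ∈ Nu m,
        1 - (onlineRun B (G m) (fun e => X m e ω) η θ0 q0 π0 n).q i ((G m).zs i) ≤ ξ) := by
    intro ω n
    induction n with
    | zero =>
      intro _
      refine ⟨⟨Metric.ball_subset_closedBall hθ0, hq0, hπ0, fun i k => ?_, fun i _ k => le_rfl,
        fun i _ => hmκ.trans (hπκ _), Or.inl rfl⟩, fun h => absurd h (by norm_num)⟩
      simp only [onlineRun]
      positivity
    | succ n ih =>
      intro hgood
      obtain ⟨h1, -⟩ := ih fun j hj => hgood j (hj.trans n.lt_succ_self)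
      obtain ⟨h2, h3⟩ := h1.step (hgood n n.lt_succ_self) hC5 hM.le hR0 hR
        (fun θ hθ => by
          obtain ⟨θ', hθ', h⟩ := hT θ hθ
          exact ⟨θ', hθ', hTmem θ' hθ', h⟩) hρ0 hρ1 hρε hsl hA hm0 hc.le hRc
        (by linarith) (by rw [hτ]; linarith) (hη (n + 1)).1
        ((mul_le_mul_of_nonneg_left (hη (n + 1)).2 (by positivity)).trans hη₀c)
        ((mul_le_mul_of_nonneg_right (hη (n + 1)).2 (by positivity)).trans hη₀W)
        (by positivity) le_rfl hdeg.1 hmξ (by linarith)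
      exact ⟨h2, fun _ => h3⟩
  calc _ ≤ P m {ω | ∃ j ∈ Finset.range N, ¬ GoodWindow B (G m) (Nu m) c W ε ρ τ T q0
        (fun e => X m e ω) (j + 1)} := by
        refine measure_mono fun ω hω => ?_
        by_contra hcon
        refine hω fun zhat hz i hi => ?_
        obtain ⟨h1, h2⟩ := hrun ω N fun j hj => by
          by_contra hj'
          exact hcon ⟨j, Finset.mem_range.2 hj, hj'⟩
        exact argmax_eq_of_one_sub_lt (h1.q_mem i) (by linarith [h2 hN i hi]) (hz i)
    _ ≤ N * ENNReal.ofReal (Real.exp (-(C / 2) * (m : ℝ) ^ r)) :=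
        measure_exists_le _ _ (by simp) fun j _ => hprob (j + 1) (by omega)
    _ = _ := by rw [ENNReal.ofReal_mul (by positivity), ENNReal.ofReal_natCast]

end
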